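/- All graphs are finite and simple. A subdivision of $K_4$ is any graph obtained from the complete graph $K_4$ by repeatedly subdividing edges (possibly zero times). A graph is *series-parallel* if none of its subgraphs (induced or not) is a subdivision of $K_4$; it is *ISK4-free* if none of its induced subgraphs is a subdivision of $K_4$. Write $N(x)$ for the set of neighbours of a vertex $x$ and $N[x]=N(x)\cup\{x\}$. A *hole* is a chordless cycle of length at least $4$. A *wheel* $(H,x)$ in a graph $G$ consists of a hole $H$ of $G$ and a vertex $x\in V(G)\setminus V(H)$ with at least three neighbours on $H$. Let $x_1,\dots,x_n$ be the neighbours of $x$ on $H$, in the order in which they appear along $H$ (indices modulo $n$), and let the *sector* $S_i$ be the subpath of $H$ with ends $x_i$ and $x_{i+1}$ none of whose interior vertices is adjacent to $x$. The graph $G$ has a *wheel decomposition* if for some wheel $(H,x)$ of $G$ and for every $i\in\{1,\dots,n\}$ the set $$C_i=(N[x]\setminus V(H))\cup\{x_i,x_{i+1}\}$$ is a cutset of $G$ (that is, $G\setminus C_i$ is disconnected) separating $S_i$ from $H\setminus S_i$: both $V(S_i)\setminus C_i$ and $(V(H)\setminus V(S_i))\setminus C_i$ are non-empty, and no path of $G\setminus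 C_i$ joins a vertex of the first set to a vertex of the second. **Theorem.** Let $G$ be a graph that contains no triangle and no $K_{3,3}$ as an induced subgraph and that is ISK4-free. Then $G$ is series-parallel or $G$ has a wheel decomposition. -/

import Mathlib

namespace SimpleGraph

/-- `S` is a subdivision of `K`: it consists of branch vertices `f w`, one for each vertex `w` of
`K`, and of paths `P a b`, one for each edge `ab` of `K` (the path of `ba` is the reverse of the
path of `ab`), such that no path has a branch vertex in its interior, paths of distinct edges
meet in branch vertices only, and every vertex and every edge of `S` is accounted for. -/
def IsSubdivision {W U : Type*} (K : SimpleGraph W) (S : SimpleGraph U) : Prop :=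
  ∃ (f : W ↪ U) (P : ∀ a b : W, K.Adj a b → S.Walk (f a) (f b)),
    (∀ a b (h : K.Adj a b), (P a b h).IsPath) ∧
    (∀ a b (h : K.Adj a b), P b a h.symm = (P a b h).reverse) ∧
    (∀ a b (h : K.Adj a b) (w : W), f w ∈ (P a b h).support → w = a ∨ w = b) ∧
    (∀ a b (h : K.Adj a b) c d (h' : K.Adj c d), s(a, b) ≠ s(c, d) →
      ∀ u, u ∈ (P a b h).support → u ∈ (P c d h').support → u ∈ Set.range f) ∧
    (∀ u : U, u ∈ Set.range f ∨ ∃ a b, ∃ h : K.Adj a b, u ∈ (P a b h).support) ∧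
    (∀ u v : U, S.Adj u v → ∃ a b, ∃ h : K.Adj a b, s(u, v) ∈ (P a b h).edges)

variable {V : Type*}

/-- No induced subgraph of `G` is a subdivision of `K₄`. -/
def ISK4Free (G : SimpleGraph V) : Prop :=
  ¬ ∃ U : Set V, IsSubdivision (completeGraph (Fin 4)) (G.induce U)

/-- No subgraph of `G`, induced or not, is a subdivision of `K₄`. -/
def IsSeriesParallel (G : SimpleGraph V) : Prop :=
  ¬ ∃ G' : G.Subgraph, IsSubdivision (completeGraph (Fin 4)) G'.coe

/-- `H` is (the vertex set of) a hole of `G`: a chordless cycle of length at least 4. -/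
def IsHole (G : SimpleGraph V) (H : Set V) : Prop :=
  ∃ (a : V) (c : G.Walk a a),
    c.IsCycle ∧ 4 ≤ c.length ∧ c.IsChordless ∧ {v | v ∈ c.support} = H

/-- `(H, x)` is a wheel of `G`: `H` is a hole and `x` is a vertex outside `H` with at least three
neighbours on `H`. -/
def IsWheel (G : SimpleGraph V) (H : Set V) (x : V) : Prop :=
  IsHole G H ∧ x ∉ H ∧ 3 ≤ (G.neighborSet x ∩ H).encard

/-- `p` is a sector of the wheel `(H, x)`: a subpath of `H` whose (distinct) ends are adjacent to
`x` and whose interior vertices are not. As `H` is chordless, the subpaths of the hole are the paths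
of `G` all of whose vertices are in `H`. -/
def IsSector (G : SimpleGraph V) (H : Set V) (x : V) {a b : V} (p : G.Walk a b) : Prop :=
  p.IsPath ∧ a ≠ b ∧ (∀ v ∈ p.support, v ∈ H) ∧ G.Adj x a ∧ G.Adj x b ∧
    ∀ v ∈ p.support, v ≠ a → v ≠ b → ¬ G.Adj x v

/-- `C` is a cutset of `G`: deleting it leaves a disconnected graph. -/
def IsCutset (G : SimpleGraph V) (C : Set V) : Prop :=
  ¬ (G.induce Cᶜ).Preconnected

/-- `C` separates `A` from `B` in `G`: both sets have vertices outside `C`, and every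
walk from `A` to `B` meets `C`. -/
def Separates (G : SimpleGraph V) (C A B : Set V) : Prop :=
  (A \ C).Nonempty ∧ (B \ C).Nonempty ∧
    ∀ a ∈ A, ∀ b ∈ B, ∀ w : G.Walk a b, ∃ v ∈ C, v ∈ w.support

/-- `G` has a wheel decomposition: for some wheel `(H, x)` and every sector `S` of it, with ends `a`
and `b`, the set `(N[x] \ H) ∪ {a, b}` is a cutset of `G` separating `S` from `H \ S`. -/
def HasWheelDecomposition (G : SimpleGraph V) : Prop :=
  ∃ (H : Set V) (x : V), IsWheel G H x ∧
    ∀ (a b : V) (p : G.Walk a b), IsSector G H x p →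
      IsCutset G ((insert x (G.neighborSet x) \ H) ∪ {a, b}) ∧
      Separates G ((insert x (G.neighborSet x) \ H) ∪ {a, b})
        {v | v ∈ p.support} (H \ {v | v ∈ p.support})

end SimpleGraph

/-! ### Connected vertex sets and induced paths -/

namespace SimpleGraph

variable {V : Type*} {G : SimpleGraph V}

/-! Almost every contradiction has one source, `not_isk4Free_of_three_edges`: in a triangle-free
graph, a hole and a disjoint connected set joined by exactly three edges, with distinct ends on the
hole, contain an induced subdivision of K₄. Inside the connected set there is an induced tripod with
feet at the three edges, and the hole supplies the other three paths. The hole used is usually an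
arc of a given hole closed up by an induced path (`IsHoleFn.not_isk4Free_of_arc`), and the connected
set is usually a wheel centre together with another arc.

Existence of a wheel (`exists_isWheelFn`). A K₄-subdivision yields a cycle and a connected set T
disjoint from it with at least three attachments on the cycle. Minimise the length of the cycle,
then |T|. The cycle is then a hole. If T is one vertex, it is the centre of a wheel. Otherwise T has
two vertices p, q whose deletion leaves T connected, and by minimality each of them is the only
neighbour in T of one out of any three attachments. So there are three or four attachments. With
three, rerouting the hole through T gives a wheel or an induced subdivision of K₄. With four, p and
q own two each; rerouting the cycle through p contradicts minimality unless the pairs cross on a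
4-cycle, and then there is an induced K₃,₃ or subdivision of K₄.

From a wheel to a decomposition. Every wheel has at least four spokes. A wheel with shortest rim,
and then fewest spokes, is proper (`exists_properWheel`): a vertex off the wheel and nonadjacent to
the centre sees the rim within one sector. Among proper wheels with the same centre, descend on the
number of spokes. If an arc of the rim with at least three but not all spokes can be closed up away
from the neighbourhood of the centre (a detour), then there is a proper wheel with fewer spokes
(`IsProperWheel.exists_smaller_of_isDetour`). If there is no detour, every connected set avoiding
the rim and the closed neighbourhood of the centre attaches to one sector only
(`IsProperWheel.isSeparatedWheel`): a minimal counterexample is an induced path joining two sectors,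
and it yields a detour or an induced subdivision of K₄. Attachment to single sectors is exactly the
separation demanded by a wheel decomposition (`IsSeparatedWheel.separates`). -/

/-- `v` can be reached from `u` by a walk all of whose vertices lie in `T` (or `u = v`). -/
def ReachIn (G : SimpleGraph V) (T : Set V) (u v : V) : Prop :=
  Relation.ReflTransGen (fun a b => G.Adj a b ∧ a ∈ T ∧ b ∈ T) u v

/-- The vertex set `T` induces a preconnected subgraph. -/
def ConnOn (G : SimpleGraph V) (T : Set V) : Prop :=
  ∀ u ∈ T, ∀ v ∈ T, ReachIn G T u v

theorem ReachIn.mono {S T : Set V} (h : S ⊆ T) {u v : V} (huv : ReachIn G S u v) :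
    ReachIn G T u v := by
  induction huv with
  | refl => exact Relation.ReflTransGen.refl
  | tail _ hbc ih => exact ih.tail ⟨hbc.1, h hbc.2.1, h hbc.2.2⟩

theorem ReachIn.symm {T : Set V} {u v : V} (huv : ReachIn G T u v) : ReachIn G T v u := by
  induction huv with
  | refl => exact Relation.ReflTransGen.refl
  | tail _ hbc ih => exact ih.head ⟨hbc.1.symm, hbc.2.2, hbc.2.1⟩

theorem ReachIn.trans {T : Set V} {u v w : V} (h1 : ReachIn G T u v) (h2 : ReachIn G T v w) :
    ReachIn G T u w := Relation.ReflTransGen.trans h1 h2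

theorem ReachIn.of_adj {T : Set V} {u v : V} (h : G.Adj u v) (hu : u ∈ T) (hv : v ∈ T) :
    ReachIn G T u v := Relation.ReflTransGen.single ⟨h, hu, hv⟩

theorem ConnOn.of_center {T : Set V} (c : V) (h : ∀ u ∈ T, ReachIn G T c u) : ConnOn G T :=
  fun u hu v hv => (h u hu).symm.trans (h v hv)

theorem ConnOn.singleton (v : V) : ConnOn G {v} := by
  rintro u rfl w rfl
  exact Relation.ReflTransGen.refl

theorem ConnOn.union {S T : Set V} (hS : ConnOn G S) (hT : ConnOn G T) {s t : V} (hs : s ∈ S)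
    (ht : t ∈ T) (h : s = t ∨ G.Adj s t) : ConnOn G (S ∪ T) := by
  refine ConnOn.of_center s ?_
  rintro u (hu | hu)
  · exact (hS s hs u hu).mono Set.subset_union_left
  · have h1 : ReachIn G (S ∪ T) s t := by
      rcases h with rfl | h
      · exact Relation.ReflTransGen.refl
      · exact ReachIn.of_adj h (Or.inl hs) (Or.inr ht)
    exact h1.trans ((hT t ht u hu).mono Set.subset_union_right)

theorem ConnOn.insert {T : Set V} (hT : ConnOn G T) {s t : V} (ht : t ∈ T) (h : G.Adj s t) :
    ConnOn G (insert s T) := by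
  rw [Set.insert_eq]
  exact (ConnOn.singleton s).union hT rfl ht (Or.inr h)

/-- `p 0, …, p n` is an induced path of `G`. -/
structure IsPathFn (G : SimpleGraph V) (n : ℕ) (p : ℕ → V) : Prop where
  inj : ∀ i j, i < j → j ≤ n → p i ≠ p j
  adj : ∀ i, i < n → G.Adj (p i) (p (i + 1))
  chord : ∀ i j, i + 1 < j → j ≤ n → ¬ G.Adj (p i) (p j)

/-- `S` is the vertex set of an induced path of `G` from `a` to `b`. -/
def PathSet (G : SimpleGraph V) (S : Set V) (a b : V) : Prop :=
  ∃ (n : ℕ) (p : ℕ → V), IsPathFn G n p ∧ p 0 = a ∧ p n = b ∧ ∀ v, v ∈ S ↔ ∃ i ≤ n, p i = v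

theorem IsPathFn.mono {n m : ℕ} {p : ℕ → V} (hp : IsPathFn G n p) (hm : m ≤ n) :
    IsPathFn G m p :=
  ⟨fun i j h1 h2 => hp.inj i j h1 (by omega), fun i h => hp.adj i (by omega),
    fun i j h1 h2 => hp.chord i j h1 (by omega)⟩

theorem IsPathFn.shift {n : ℕ} {p : ℕ → V} (hp : IsPathFn G n p) (m : ℕ) (hm : m ≤ n) :
    IsPathFn G (n - m) (fun i => p (i + m)) :=
  ⟨fun i j h1 h2 => hp.inj _ _ (by omega) (by omega),
    fun i h => by
      have := hp.adj (i + m) (by omega)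
      rwa [show i + m + 1 = i + 1 + m by omega] at this,
    fun i j h1 h2 => hp.chord _ _ (by omega) (by omega)⟩

theorem IsPathFn.reverse {n : ℕ} {p : ℕ → V} (hp : IsPathFn G n p) :
    IsPathFn G n (fun i => p (n - i)) :=
  ⟨fun i j h1 h2 => (hp.inj _ _ (by omega) (by omega)).symm,
    fun i h => by
      have := hp.adj (n - (i + 1)) (by omega)
      rw [show n - (i + 1) + 1 = n - i by omega] at this
      exact this.symm,
    fun i j h1 h2 h => hp.chord _ _ (by omega) (by omega) h.symm⟩

theorem IsPathFn.pathSet {n : ℕ} {p : ℕ → V} (hp : IsPathFn G n p) :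
    PathSet G {v | ∃ i ≤ n, p i = v} (p 0) (p n) := ⟨n, p, hp, rfl, rfl, fun _ => Iff.rfl⟩

theorem IsPathFn.reachIn {n : ℕ} {p : ℕ → V} {T : Set V} (hp : ∀ i, i < n → G.Adj (p i) (p (i + 1)))
    (hT : ∀ i ≤ n, p i ∈ T) : ReachIn G T (p 0) (p n) := by
  induction n with
  | zero => exact Relation.ReflTransGen.refl
  | succ n ih =>
    exact (ih (fun i hi => hp i (by omega)) (fun i hi => hT i (by omega))).trans
      (ReachIn.of_adj (hp n (by omega)) (hT n (by omega)) (hT _ le_rfl))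

theorem PathSet.connOn {S : Set V} {a b : V} (h : PathSet G S a b) : ConnOn G S := by
  obtain ⟨n, p, hp, ha, hb, hS⟩ := h
  refine ConnOn.of_center (p 0) ?_
  intro u hu
  obtain ⟨i, hi, rfl⟩ := (hS u).1 hu
  exact IsPathFn.reachIn (fun j hj => hp.adj j (by omega))
    (fun j hj => (hS _).2 ⟨j, by omega, rfl⟩)

theorem PathSet.left_mem {S : Set V} {a b : V} (h : PathSet G S a b) : a ∈ S := by
  obtain ⟨n, p, hp, ha, hb, hS⟩ := h
  exact (hS a).2 ⟨0, by omega, ha⟩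

theorem PathSet.right_mem {S : Set V} {a b : V} (h : PathSet G S a b) : b ∈ S := by
  obtain ⟨n, p, hp, ha, hb, hS⟩ := h
  exact (hS b).2 ⟨n, by omega, hb⟩

theorem PathSet.singleton (a : V) : PathSet G {a} a a :=
  ⟨0, fun _ => a, ⟨by omega, by omega, by omega⟩, rfl, rfl, fun v => by
    constructor
    · rintro rfl; exact ⟨0, le_rfl, rfl⟩
    · rintro ⟨_, _, rfl⟩; rfl⟩

theorem PathSet.symm {S : Set V} {a b : V} (h : PathSet G S a b) : PathSet G S b a := by
  obtain ⟨n, p, hp, ha, hb, hS⟩ := h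
  refine ⟨n, _, hp.reverse, by simpa using hb, by simpa using ha, fun v => ?_⟩
  rw [hS]
  constructor
  · rintro ⟨i, hi, rfl⟩
    exact ⟨n - i, by omega, by simp only [show n - (n - i) = i by omega]⟩
  · rintro ⟨i, hi, rfl⟩
    exact ⟨n - i, by omega, rfl⟩

theorem PathSet.concat {S S' : Set V} {a b a' b' : V} (h : PathSet G S a b)
    (h' : PathSet G S' a' b') (hd : Disjoint S S') (hba : G.Adj b a')
    (honly : ∀ u ∈ S, ∀ v ∈ S', G.Adj u v → u = b ∧ v = a') : PathSet G (S ∪ S') a b' := by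
  obtain ⟨n, p, hp, ha, hb, hS⟩ := h
  obtain ⟨m, q, hq, ha', hb', hS'⟩ := h'
  have hpS : ∀ i ≤ n, p i ∈ S := fun i hi => (hS _).2 ⟨i, hi, rfl⟩
  have hqS : ∀ i ≤ m, q i ∈ S' := fun i hi => (hS' _).2 ⟨i, hi, rfl⟩
  have hne : ∀ i ≤ n, ∀ j ≤ m, p i ≠ q j := fun i hi j hj =>
    hd.ne_of_mem (hpS i hi) (hqS j hj)
  refine ⟨n + m + 1, fun i => if i ≤ n then p i else q (i - n - 1), ⟨?_, ?_, ?_⟩, ?_, ?_, ?_⟩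
  · intro i j h1 h2
    by_cases hj : j ≤ n
    · simp only [hj, show i ≤ n by omega, if_true]
      exact hp.inj i j h1 hj
    · by_cases hi : i ≤ n
      · simp only [hj, hi, if_true, if_false]
        exact hne i hi _ (by omega)
      · simp only [hj, hi, if_false]
        exact hq.inj _ _ (by omega) (by omega)
  · intro i h1
    by_cases hj : i + 1 ≤ n
    · simp only [hj, show i ≤ n by omega, if_true]
      exact hp.adj i hj
    · by_cases hi : i ≤ n
      · simp only [hj, hi, if_true, if_false]
        obtain rfl : i = n := by omega
        simp only [show i + 1 - i - 1 = 0 by omega, ha', hb]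
        exact hba
      · simp only [hj, hi, if_false]
        have := hq.adj (i - n - 1) (by omega)
        rwa [show i - n - 1 + 1 = i + 1 - n - 1 by omega] at this
  · intro i j h1 h2
    by_cases hj : j ≤ n
    · simp only [hj, show i ≤ n by omega, if_true]
      exact hp.chord i j h1 hj
    · by_cases hi : i ≤ n
      · simp only [hj, hi, if_true, if_false]
        intro hadj
        obtain ⟨e1, e2⟩ := honly _ (hpS i hi) _ (hqS (j - n - 1) (by omega)) hadj
        have e3 : ¬ i < n := fun hlt => hp.inj i n hlt le_rfl (e1.trans hb.symm)
        have e4 : ¬ 0 < j - n - 1 := fun hlt => hq.inj 0 _ hlt (by omega) (ha'.trans e2.symm)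
        omega
      · simp only [hj, hi, if_false]
        exact hq.chord _ _ (by omega) (by omega)
  · simpa using ha
  · simp only [show ¬ n + m + 1 ≤ n by omega, if_false, show n + m + 1 - n - 1 = m by omega, hb']
  · intro v
    rw [Set.mem_union, hS, hS']
    constructor
    · rintro (⟨i, hi, rfl⟩ | ⟨i, hi, rfl⟩)
      · exact ⟨i, by omega, by simp [hi]⟩
      · exact ⟨n + 1 + i, by omega, by
          simp only [show ¬ n + 1 + i ≤ n by omega, if_false, show n + 1 + i - n - 1 = i by omega]⟩
    · rintro ⟨i, hi, rfl⟩
      by_cases h : i ≤ n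
      · exact Or.inl ⟨i, h, by simp [h]⟩
      · exact Or.inr ⟨i - n - 1, by omega, by simp [h]⟩

/-- A vertex attached to an induced path can be reached by an induced path along a prefix of it. -/
theorem PathSet.attach {S : Set V} {a b v : V} (h : PathSet G S a b) (hv : v ∉ S)
    (hadj : ∃ s ∈ S, G.Adj v s) : ∃ S₁ ⊆ S, PathSet G (S₁ ∪ {v}) a v ∧ a ∈ S₁ := by
  classical
  obtain ⟨n, p, hp, ha, hb, hS⟩ := h
  have hex : ∃ i, i ≤ n ∧ G.Adj v (p i) := by
    obtain ⟨s, hs, hvs⟩ := hadj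
    obtain ⟨i, hi, rfl⟩ := (hS s).1 hs
    exact ⟨i, hi, hvs⟩
  obtain ⟨hl, hvl⟩ := Nat.find_spec hex
  set l := Nat.find hex
  have hmin : ∀ i < l, ¬ G.Adj v (p i) := fun i hi hadj =>
    Nat.find_min hex hi ⟨by omega, hadj⟩
  have hP := (hp.mono hl).pathSet
  rw [ha] at hP
  refine ⟨{v | ∃ i ≤ l, p i = v}, ?_, hP.concat (PathSet.singleton v) ?_ hvl.symm ?_,
    0, by omega, ha⟩
  · rintro u ⟨i, hi, rfl⟩
    exact (hS _).2 ⟨i, by omega, rfl⟩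
  · rw [Set.disjoint_singleton_right]
    rintro ⟨i, hi, rfl⟩
    exact hv ((hS _).2 ⟨i, by omega, rfl⟩)
  · rintro u ⟨i, hi, rfl⟩ w rfl huw
    refine ⟨?_, rfl⟩
    rcases Nat.lt_or_ge i l with h | h
    · exact absurd huw.symm (hmin i h)
    · rw [show i = l by omega]

theorem ReachIn.exists_fn {T : Set V} {u v : V} (hu : u ∈ T) (h : ReachIn G T u v) :
    ∃ (n : ℕ) (p : ℕ → V), p 0 = u ∧ p n = v ∧ (∀ i ≤ n, p i ∈ T) ∧
      ∀ i < n, G.Adj (p i) (p (i + 1)) := by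
  induction h with
  | refl => exact ⟨0, fun _ => u, rfl, rfl, fun _ _ => hu, by omega⟩
  | @tail b c _ hbc ih =>
    obtain ⟨n, p, h0, hn, hT, hadj⟩ := ih
    refine ⟨n + 1, fun i => if i ≤ n then p i else c, by simpa using h0, by simp, ?_, ?_⟩
    · intro i hi
      by_cases h : i ≤ n
      · simp only [h, if_true]; exact hT i h
      · simp only [h, if_false]; exact hbc.2.2
    · intro i hi
      by_cases h : i + 1 ≤ n
      · simp only [h, show i ≤ n by omega, if_true]; exact hadj i h
      · obtain rfl : i = n := by omega
        simp only [h, le_refl, if_true, if_false, hn]; exact hbc.1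

/-- A shortest walk within T is an induced path. A chord would be a shortcut. A repetition p i = p j
either makes p i adjacent to p (j + 1), again a chord, or has j = n, and then the walk could have
stopped at i. -/
theorem ConnOn.exists_pathSet {T : Set V} (hT : ConnOn G T) {u v : V} (hu : u ∈ T) (hv : v ∈ T) :
    ∃ S ⊆ T, PathSet G S u v := by
  classical
  have hex : ∃ n, ∃ p : ℕ → V, p 0 = u ∧ p n = v ∧ (∀ i ≤ n, p i ∈ T) ∧
      ∀ i < n, G.Adj (p i) (p (i + 1)) := (hT u hu v hv).exists_fn hu
  obtain ⟨p, h0, hn, hpT, hadj⟩ := Nat.find_spec hex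
  set n := Nat.find hex
  have hmin : ∀ m < n, ¬ ∃ p : ℕ → V, p 0 = u ∧ p m = v ∧ (∀ i ≤ m, p i ∈ T) ∧
      ∀ i < m, G.Adj (p i) (p (i + 1)) := fun m hm => Nat.find_min hex hm
  have hchord : ∀ i j, i + 1 < j → j ≤ n → ¬ G.Adj (p i) (p j) := by
    intro i j h1 h2 hij
    refine hmin (n - (j - i - 1)) (by omega)
      ⟨fun k => if k ≤ i then p k else p (k + (j - i - 1)), by simpa using h0, ?_, ?_, ?_⟩
    · simp only [show ¬ n - (j - i - 1) ≤ i by omega, if_false,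
        show n - (j - i - 1) + (j - i - 1) = n by omega, hn]
    · intro k hk
      by_cases h : k ≤ i
      · simp only [h, if_true]; exact hpT k (by omega)
      · simp only [h, if_false]; exact hpT _ (by omega)
    · intro k hk
      by_cases h : k + 1 ≤ i
      · simp only [h, show k ≤ i by omega, if_true]; exact hadj k (by omega)
      · by_cases h' : k ≤ i
        · obtain rfl : k = i := by omega
          simp only [h, le_refl, if_true, if_false, show k + 1 + (j - k - 1) = j by omega]
          exact hij
        · simp only [h, h', if_false]
          have := hadj (k + (j - i - 1)) (by omega)
          rwa [show k + (j - i - 1) + 1 = k + 1 + (j - i - 1) by omega] at this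
  refine ⟨{v | ∃ i ≤ n, p i = v}, ?_, n, p, ⟨?_, fun i hi => hadj i hi, hchord⟩, h0, hn,
    fun _ => Iff.rfl⟩
  · rintro w ⟨i, hi, rfl⟩
    exact hpT i hi
  · intro i j h1 h2 heq
    rcases Nat.lt_or_ge j n with hj | hj
    · have h3 := hadj j hj
      rw [← heq] at h3
      exact hchord i (j + 1) (by omega) (by omega) h3
    · obtain rfl : j = n := by omega
      exact hmin i (by omega) ⟨p, h0, heq.trans hn, fun k hk => hpT k (by omega),
        fun k hk => hadj k (by omega)⟩

end SimpleGraph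

/-! ### Cycles and holes as periodic maps on the integers -/

namespace SimpleGraph

variable {V : Type*} {G : SimpleGraph V}

theorem CliqueFree.no_triangle (hG : G.CliqueFree 3) {a b c : V} (hab : G.Adj a b)
    (hbc : G.Adj b c) (hac : G.Adj a c) : False := by
  classical
  exact hG {a, b, c} (is3Clique_triple_iff.2 ⟨hab, hac, hbc⟩)

/-- `h` is an `N`-periodic parametrization of a (not necessarily induced) cycle of `G`. -/
structure IsCycFn (G : SimpleGraph V) (N : ℕ) (h : ℤ → V) : Prop where
  three : 3 ≤ N
  per : ∀ i : ℤ, h (i + N) = h i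
  inj : ∀ i j : ℤ, i < j → j < i + N → h i ≠ h j
  adj : ∀ i : ℤ, G.Adj (h i) (h (i + 1))

/-- `h` is an `N`-periodic parametrization of a hole of `G`. -/
structure IsHoleFn (G : SimpleGraph V) (N : ℕ) (h : ℤ → V) : Prop extends IsCycFn G N h where
  four : 4 ≤ N
  chord : ∀ i j : ℤ, i + 1 < j → j < i + N - 1 → ¬ G.Adj (h i) (h j)

variable {N : ℕ} {h : ℤ → V}

theorem IsCycFn.per_mul (hh : IsCycFn G N h) (i k : ℤ) : h (i + k * N) = h i := by
  induction k using Int.induction_on with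
  | zero => simp
  | succ k ih => rw [← ih, ← hh.per (i + k * N)]; congr 1; ring
  | pred k ih => rw [← ih, ← hh.per]; congr 1; ring

/-- Shifting by periods into a chosen window of length N turns questions about cyclic order into
linear integer inequalities; the lower end of the window is adapted to each argument. -/
theorem IsCycFn.exists_shift (hh : IsCycFn G N h) (c i : ℤ) :
    ∃ k : ℤ, c ≤ i + k * N ∧ i + k * N < c + N := by
  have hN : (0 : ℤ) < N := by have := hh.three; omega
  refine ⟨-((i - c) / N), ?_, ?_⟩
  · have := Int.emod_nonneg (i - c) hN.ne'
    have h2 := Int.emod_add_mul_ediv (i - c) N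
    nlinarith
  · have := Int.emod_lt_of_pos (i - c) hN
    have h2 := Int.emod_add_mul_ediv (i - c) N
    nlinarith

theorem IsCycFn.exists_rep (hh : IsCycFn G N h) (c i : ℤ) :
    ∃ j, c ≤ j ∧ j < c + N ∧ h j = h i := by
  obtain ⟨k, h1, h2⟩ := hh.exists_shift c i
  exact ⟨_, h1, h2, hh.per_mul i k⟩

theorem IsCycFn.exists_rep_of_mem (hh : IsCycFn G N h) (c : ℤ) {v : V} (hv : v ∈ Set.range h) :
    ∃ j, c ≤ j ∧ j < c + N ∧ h j = v := by
  obtain ⟨i, rfl⟩ := hv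
  exact hh.exists_rep c i

theorem IsCycFn.eq_of_window (hh : IsCycFn G N h) {i j : ℤ} (h1 : i < j + N) (h2 : j < i + N)
    (he : h i = h j) : i = j := by
  rcases lt_trichotomy i j with hl | hl | hl
  · exact absurd he (hh.inj i j hl h2)
  · exact hl
  · exact absurd he.symm (hh.inj j i hl h1)

theorem IsCycFn.sub_per (hh : IsCycFn G N h) (i : ℤ) : h (i - N) = h i := by
  rw [← hh.per (i - N)]; congr 1; ring

theorem IsCycFn.adj' (hh : IsCycFn G N h) {i j : ℤ} (hj : j = i + 1) : G.Adj (h i) (h j) :=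
  hj ▸ hh.adj i

theorem IsHoleFn.adj_window (hh : IsHoleFn G N h) {i j : ℤ} (h1 : i < j) (h2 : j < i + N)
    (ha : G.Adj (h i) (h j)) : j = i + 1 ∨ j = i + N - 1 := by
  by_contra hcon
  exact hh.chord i j (by omega) (by omega) ha

theorem IsHoleFn.eq_of_adj (hh : IsHoleFn G N h) {i : ℤ} {v : V} (hv : v ∈ Set.range h)
    (ha : G.Adj (h i) v) : v = h (i + 1) ∨ v = h (i - 1) := by
  obtain ⟨j, h1, h2, rfl⟩ := hh.exists_rep_of_mem i hv
  have h3 : i ≠ j := by rintro rfl; exact ha.ne rfl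
  rcases hh.adj_window (by omega) h2 ha with rfl | rfl
  · exact Or.inl rfl
  · right; rw [← hh.per (i - 1)]; congr 1; ring

/-- A cycle is given on one window and extended by reducing indices modulo N; `last` is the only
edge that wraps around. -/
theorem IsCycFn.exists_window (c : ℤ) (g : ℤ → V) (hN : 3 ≤ N)
    (inj : ∀ i j, c ≤ i → i < j → j < c + N → g i ≠ g j)
    (adj : ∀ i, c ≤ i → i + 1 < c + N → G.Adj (g i) (g (i + 1)))
    (last : G.Adj (g (c + N - 1)) (g c)) :
    ∃ h, IsCycFn G N h ∧ ∀ i, c ≤ i → i < c + N → h i = g i := by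
  have hN0 : (0 : ℤ) < N := by omega
  have key : ∀ i, c ≤ c + (i - c) % N ∧ c + (i - c) % N < c + N := fun i => by
    have := Int.emod_nonneg (i - c) hN0.ne'
    have := Int.emod_lt_of_pos (i - c) hN0
    omega
  -- Reducing two indices less than N apart preserves their difference, or lowers it by N if the
  -- window boundary lies between them.
  have step : ∀ i j : ℤ, i ≤ j → j < i + N →
      c + (j - c) % N = c + (i - c) % N + (j - i) ∨
      c + (j - c) % N = c + (i - c) % N + (j - i) - N := by
    intro i j h1 h2
    have e1 := Int.emod_add_mul_ediv (i - c) N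
    have k1 := key i
    set r := (i - c) % N
    set q := (i - c) / (N : ℤ)
    by_cases hlt : r + (j - i) < N
    · left
      have : (j - c) % N = r + (j - i) := by
        rw [show j - c = (r + (j - i)) + N * q by linarith, Int.add_mul_emod_self_left,
          Int.emod_eq_of_lt (by omega) hlt]
      omega
    · right
      have : (j - c) % N = r + (j - i) - N := by
        rw [show j - c = (r + (j - i) - N) + N * (q + 1) by linarith, Int.add_mul_emod_self_left,
          Int.emod_eq_of_lt (by omega) (by omega)]
      omega
  refine ⟨fun i => g (c + (i - c) % N), ⟨hN, ?_, ?_, ?_⟩, ?_⟩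
  · intro i
    simp only [show i + (N : ℤ) - c = i - c + N by ring, Int.add_emod_right]
  · intro i j h1 h2
    have k1 := key i
    have k2 := key j
    rcases step i j h1.le h2 with e | e
    · exact inj _ _ k1.1 (by omega) k2.2
    · exact (inj _ _ k2.1 (by omega) k1.2).symm
  · intro i
    have k1 := key i
    have k2 := key (i + 1)
    rcases step i (i + 1) (by omega) (by omega) with e | e
    · simp only [e]
      rw [show i + 1 - i = 1 by ring]
      exact adj _ k1.1 (by omega)
    · have e1 : c + (i - c) % N = c + N - 1 := by omega
      have e2 : c + (i + 1 - c) % N = c := by omega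
      simp only [e1, e2]
      exact last
  · intro i h1 h2
    simp only [Int.emod_eq_of_lt (show 0 ≤ i - c by omega) (show i - c < N by omega)]
    congr 1; ring

/-- Length at least four comes for free: a cycle of length three is a triangle. The only pair exempt
from `chord` consists of the two ends of the window, which are joined by `last`. -/
theorem IsHoleFn.exists_window (hG : G.CliqueFree 3) (c : ℤ) (g : ℤ → V) (hN : 3 ≤ N)
    (inj : ∀ i j, c ≤ i → i < j → j < c + N → g i ≠ g j)
    (adj : ∀ i, c ≤ i → i + 1 < c + N → G.Adj (g i) (g (i + 1)))
    (last : G.Adj (g (c + N - 1)) (g c))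
    (chord : ∀ i j, c ≤ i → i + 1 < j → j < c + N → ¬ (i = c ∧ j = c + N - 1) →
      ¬ G.Adj (g i) (g j)) :
    ∃ h, IsHoleFn G N h ∧ ∀ i, c ≤ i → i < c + N → h i = g i := by
  obtain ⟨h, hh, hg⟩ := IsCycFn.exists_window c g hN inj adj last
  refine ⟨h, ⟨hh, ?_, ?_⟩, hg⟩
  · by_contra hlt
    obtain rfl : N = 3 := by omega
    refine hG.no_triangle (hh.adj c) (hh.adj (c + 1)) ?_
    have := hh.adj (c + 2)
    rw [show c + 2 + 1 = c + (3 : ℕ) by push_cast; ring, hh.per] at this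
    rw [show c + 1 + 1 = c + 2 by ring]
    exact this.symm
  · intro i j h1 h2 hij
    obtain ⟨k, k1, k2⟩ := hh.exists_shift c i
    rw [← hh.per_mul i k, ← hh.per_mul j k] at hij
    generalize hi' : i + k * N = i' at *
    generalize hj' : j + k * N = j' at *
    have e : j' - i' = j - i := by rw [← hi', ← hj']; ring
    by_cases hlt : j' < c + N
    · rw [hg _ k1 k2, hg _ (by omega) hlt] at hij
      exact chord _ _ k1 (by omega) hlt (by omega) hij
    · rw [← hh.sub_per j', hg _ k1 k2, hg (j' - N) (by omega) (by omega)] at hij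
      exact chord _ _ (by omega) (by omega) (by omega) (by omega) hij.symm

/-- The set of vertices `h k` with `i ≤ k ≤ j`. -/
def arc (h : ℤ → V) (i j : ℤ) : Set V := {v | ∃ k, i ≤ k ∧ k ≤ j ∧ h k = v}

theorem mem_arc {i j k : ℤ} (h1 : i ≤ k) (h2 : k ≤ j) : h k ∈ arc h i j := ⟨k, h1, h2, rfl⟩

theorem arc_subset_range (i j : ℤ) : arc h i j ⊆ Set.range h := by
  rintro v ⟨k, _, _, rfl⟩; exact ⟨k, rfl⟩

theorem IsCycFn.connOn_arc (hh : IsCycFn G N h) (i j : ℤ) : ConnOn G (arc h i j) := by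
  refine ConnOn.of_center (h i) ?_
  rintro u ⟨k, h1, h2, rfl⟩
  have := IsPathFn.reachIn (G := G) (n := (k - i).toNat) (p := fun t => h (i + t))
    (T := arc h i j) (fun t _ => hh.adj' (by push_cast; ring))
    (fun t ht => mem_arc (by omega) (by omega))
  simpa [show i + max (k - i) 0 = k by omega] using this

/-- The bound is strict because for j = i + N - 1 the two ends would be consecutive on the hole, and
the arc would not be induced. -/
theorem IsHoleFn.pathSet_arc (hh : IsHoleFn G N h) {i j : ℤ} (hij : i ≤ j) (hj : j < i + N - 1) :
    PathSet G (arc h i j) (h i) (h j) := by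
  refine ⟨(j - i).toNat, fun t => h (i + t), ⟨?_, ?_, ?_⟩, by simp, ?_, ?_⟩
  · intro s t h1 h2
    exact hh.inj _ _ (by omega) (by omega)
  · intro t _
    exact hh.adj' (by push_cast; ring)
  · intro s t h1 h2
    exact hh.chord _ _ (by omega) (by omega)
  · simp only; congr 1; omega
  · intro v
    constructor
    · rintro ⟨k, h1, h2, rfl⟩
      exact ⟨(k - i).toNat, by omega, by simp only; congr 1; omega⟩
    · rintro ⟨t, ht, rfl⟩
      exact mem_arc (by omega) (by omega)

/-- The new hole runs along the arc and returns through P; by `honly` the only edges between the two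
parts are those at the ends. The condition `hne` excludes one vertex closed up by one vertex; all
other cases have at least three vertices, hence at least four by triangle-freeness. -/
theorem IsHoleFn.close (hG : G.CliqueFree 3) (hh : IsHoleFn G N h) {i j : ℤ} (hij : i ≤ j)
    (hj : j < i + N - 1) {P : Set V} {a b : V} (hP : PathSet G P a b) (hne : i < j ∨ a ≠ b)
    (hd : ∀ k, i ≤ k → k ≤ j → h k ∉ P) (ha : G.Adj (h j) a) (hb : G.Adj b (h i))
    (honly : ∀ k, i ≤ k → k ≤ j → ∀ u ∈ P, G.Adj (h k) u → (k = j ∧ u = a) ∨ (k = i ∧ u = b)) :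
    ∃ (N' : ℕ) (h' : ℤ → V), IsHoleFn G N' h' ∧ (N' : ℤ) = j - i + 1 + P.ncard ∧
      (∀ k, i ≤ k → k ≤ j → h' k = h k) ∧ (∀ k, j < k → k < i + N' → h' k ∈ P) ∧
      (∀ u ∈ P, ∃ k, j < k ∧ k < i + N' ∧ h' k = u) := by
  obtain ⟨n, p, hp, rfl, rfl, hS⟩ := hP
  have hcard : P.ncard = n + 1 := by
    have : P = p '' (Finset.range (n + 1) : Set ℕ) := by
      ext v; rw [hS]; simp
    rw [this, Set.InjOn.ncard_image, Set.ncard_coe_finset, Finset.card_range]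
    intro s hs t ht hst
    simp only [Finset.coe_range, Set.mem_Iio] at hs ht
    by_contra hne
    rcases lt_or_gt_of_ne hne with hl | hl
    · exact hp.inj s t hl (by omega) hst
    · exact hp.inj t s hl (by omega) hst.symm
  have hpP : ∀ t ≤ n, p t ∈ P := fun t ht => (hS _).2 ⟨t, ht, rfl⟩
  have h0n : i < j ∨ 0 < n := by
    rcases hne with h | h
    · exact Or.inl h
    · right; by_contra h0
      obtain rfl : n = 0 := by omega
      exact h rfl
  have hpe : ∀ s t, s ≤ n → t ≤ n → p s = p t → s = t := by
    intro s t hs ht hst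
    by_contra hne
    rcases lt_or_gt_of_ne hne with hl | hl
    · exact hp.inj s t hl (by omega) hst
    · exact hp.inj t s hl (by omega) hst.symm
  set M : ℕ := (j - i + 1).toNat + (n + 1) with hM
  have hMi : (M : ℤ) = j - i + 1 + (n + 1) := by omega
  have hgl : ∀ k, k ≤ j → (if k ≤ j then h k else p (k - j - 1).toNat) = h k :=
    fun k hk => by simp [hk]
  have hgr : ∀ k, j < k → (if k ≤ j then h k else p (k - j - 1).toNat) = p (k - j - 1).toNat :=
    fun k hk => by simp [show ¬ k ≤ j by omega]
  obtain ⟨h', hh', hg⟩ := IsHoleFn.exists_window (G := G) (N := M) hG i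
    (fun k => if k ≤ j then h k else p (k - j - 1).toNat) (by omega)
    (by
      intro s t h1 h2 h3
      by_cases ht : t ≤ j
      · simp only [hgl t ht, hgl s (by omega)]
        exact hh.inj _ _ h2 (by omega)
      · by_cases hs : s ≤ j
        · simp only [hgr t (by omega), hgl s hs]
          intro e
          exact hd s h1 hs (e ▸ hpP _ (by omega))
        · simp only [hgr t (by omega), hgr s (by omega)]
          exact hp.inj _ _ (by omega) (by omega))
    (by
      intro s h1 h2
      by_cases ht : s + 1 ≤ j
      · simp only [hgl _ ht, hgl s (by omega)]
        exact hh.adj s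
      · by_cases hs : s ≤ j
        · simp only [hgr (s + 1) (by omega), hgl s hs]
          obtain rfl : s = j := by omega
          simpa using ha
        · simp only [hgr (s + 1) (by omega), hgr s (by omega)]
          have := hp.adj (s - j - 1).toNat (by omega)
          rwa [show (s - j - 1).toNat + 1 = (s + 1 - j - 1).toNat by omega] at this)
    (by
      simp only [hgr (i + M - 1) (by omega), hgl i hij]
      rw [show (i + M - 1 - j - 1).toNat = n by omega]
      exact hb)
    (by
      intro s t h1 h2 h3 h4
      by_cases ht : t ≤ j
      · simp only [hgl t ht, hgl s (by omega)]
        exact hh.chord _ _ h2 (by omega)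
      · by_cases hs : s ≤ j
        · simp only [hgr t (by omega), hgl s hs]
          intro e
          rcases honly s h1 hs _ (hpP _ (by omega)) e with ⟨e1, e2⟩ | ⟨e1, e2⟩
          · have := hpe _ _ (by omega) (by omega) e2
            omega
          · have := hpe _ _ (by omega) (by omega) e2
            omega
        · simp only [hgr t (by omega), hgr s (by omega)]
          exact hp.chord _ _ (by omega) (by omega))
  refine ⟨M, h', hh', by omega, ?_, ?_, ?_⟩
  · intro k h1 h2
    rw [hg k h1 (by omega)]; exact hgl k h2
  · intro k h1 h2
    rw [hg k (by omega) h2, hgr k h1]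
    exact hpP _ (by omega)
  · intro u hu
    obtain ⟨t, ht, rfl⟩ := (hS u).1 hu
    refine ⟨j + 1 + t, by omega, by omega, ?_⟩
    rw [hg _ (by omega) (by omega), hgr _ (by omega)]
    congr 1; omega

end SimpleGraph

/-! ### From induced paths to walks and subdivisions -/

namespace SimpleGraph

variable {V : Type*} {G : SimpleGraph V}

theorem exists_walk_of_fn {n : ℕ} {p : ℕ → V} (inj : ∀ i j, i < j → j ≤ n → p i ≠ p j)
    (adj : ∀ i, i < n → G.Adj (p i) (p (i + 1))) :
    ∃ w : G.Walk (p 0) (p n), w.IsPath ∧ (∀ v, v ∈ w.support ↔ ∃ i ≤ n, p i = v) ∧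
      w.length = n ∧ ∀ e, e ∈ w.edges ↔ ∃ i < n, e = s(p i, p (i + 1)) := by
  induction n with
  | zero =>
    refine ⟨Walk.nil, Walk.IsPath.nil, fun v => ?_, rfl, fun e => by simp⟩
    simp [eq_comm]
  | succ n ih =>
    obtain ⟨w, hw, hs, hl, he⟩ := ih (fun i j h1 h2 => inj i j h1 (by omega))
      (fun i hi => adj i (by omega))
    refine ⟨w.concat (adj n (by omega)), hw.concat ?_ _, fun v => ?_, by simp [hl], fun e => ?_⟩
    · rw [hs]
      rintro ⟨i, hi, h⟩
      exact inj i (n + 1) (by omega) le_rfl h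
    · rw [Walk.support_concat, List.mem_append, hs, List.mem_singleton]
      constructor
      · rintro (⟨i, hi, rfl⟩ | rfl)
        · exact ⟨i, by omega, rfl⟩
        · exact ⟨n + 1, le_rfl, rfl⟩
      · rintro ⟨i, hi, rfl⟩
        rcases Nat.lt_or_ge n i with h | h
        · right; congr 1; omega
        · exact Or.inl ⟨i, h, rfl⟩
    · rw [Walk.edges_concat, List.concat_eq_append, List.mem_append, he, List.mem_singleton]
      constructor
      · rintro (⟨i, hi, rfl⟩ | rfl)
        · exact ⟨i, by omega, rfl⟩
        · exact ⟨n, by omega, rfl⟩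
      · rintro ⟨i, hi, rfl⟩
        rcases Nat.lt_or_ge i n with h | h
        · exact Or.inl ⟨i, h, rfl⟩
        · right; obtain rfl : i = n := by omega
          rfl

theorem PathSet.exists_walk {S U : Set V} {a b : V} (hP : PathSet G S a b) (hSU : S ⊆ U) (ha hb) :
    ∃ w : (G.induce U).Walk ⟨a, ha⟩ ⟨b, hb⟩, w.IsPath ∧ (∀ u : U, u ∈ w.support ↔ (u : V) ∈ S) ∧
      ∀ u v : U, (u : V) ∈ S → (v : V) ∈ S → G.Adj u v → s(u, v) ∈ w.edges := by
  obtain ⟨n, p, hp, rfl, rfl, hS⟩ := hP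
  -- The path function is unconstrained beyond n, so it is frozen there to take all its values in U.
  have hpU : ∀ i, p (min i n) ∈ U := fun i => hSU ((hS _).2 ⟨min i n, by omega, rfl⟩)
  obtain ⟨w, hw, hs, -, he⟩ := exists_walk_of_fn (G := G.induce U) (n := n)
    (p := fun i => ⟨p (min i n), hpU i⟩)
    (fun i j h1 h2 e => by
      have := congrArg Subtype.val e
      simp only [show min i n = i by omega, show min j n = j by omega] at this
      exact hp.inj i j h1 h2 this)
    (fun i hi => by
      simp only [comap_adj, Function.Embedding.subtype_apply,
        show min i n = i by omega, show min (i + 1) n = i + 1 by omega]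
      exact hp.adj i hi)
  have e0 : (⟨p (min 0 n), hpU 0⟩ : U) = ⟨p 0, ha⟩ := by simp
  have en : (⟨p (min n n), hpU n⟩ : U) = ⟨p n, hb⟩ := by simp
  refine ⟨w.copy e0 en, by simpa using hw, fun u => ?_, fun u v hu hv huv => ?_⟩
  · rw [Walk.support_copy, hs, hS]
    constructor
    · rintro ⟨i, hi, rfl⟩; exact ⟨i, hi, by simp [hi]⟩
    · rintro ⟨i, hi, h⟩; exact ⟨i, hi, Subtype.ext (by simp [hi, h])⟩
  · rw [Walk.edges_copy, he]
    obtain ⟨i, hi, hi'⟩ := (hS _).1 hu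
    obtain ⟨j, hj, hj'⟩ := (hS _).1 hv
    rw [← hi', ← hj'] at huv
    have hij : i ≠ j := by rintro rfl; exact huv.ne rfl
    have hcases : j = i + 1 ∨ i = j + 1 := by
      by_contra hcon
      rcases lt_or_gt_of_ne hij with hl | hl
      · exact hp.chord i j (by omega) hj huv
      · exact hp.chord j i (by omega) hi huv.symm
    have hu' : (⟨p (min i n), hpU i⟩ : U) = u := Subtype.ext (by simp [hi, hi'])
    have hv' : (⟨p (min j n), hpU j⟩ : U) = v := Subtype.ext (by simp [hj, hj'])
    rcases hcases with rfl | rfl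
    · exact ⟨i, by omega, by simp only [hu', hv']⟩
    · exact ⟨j, by omega, by simp only [hu', hv', Sym2.eq_swap]⟩

/-- Because the six paths are induced, an edge with both ends in one of them is an edge of that
path. It therefore suffices, in `hedge`, to place the ends of each edge in a common path. The paths
are given for a < b only and reversed for a > b. -/
theorem IsSubdivision.of_pathSets (f : Fin 4 → V) (hf : Function.Injective f)
    (S : Fin 4 → Fin 4 → Set V) (hS : ∀ a b, a < b → PathSet G (S a b) (f a) (f b))
    (hend : ∀ a b, a < b → ∀ c, f c ∈ S a b → c = a ∨ c = b)
    (hdisj : ∀ a b c d, a < b → c < d → ¬ (a = c ∧ b = d) → ∀ u ∈ S a b, u ∈ S c d →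
      u ∈ Set.range f)
    (hedge : ∀ u v, G.Adj u v → (∃ a b, a < b ∧ u ∈ S a b) → (∃ a b, a < b ∧ v ∈ S a b) →
      ∃ a b, a < b ∧ u ∈ S a b ∧ v ∈ S a b) :
    IsSubdivision (completeGraph (Fin 4)) (G.induce {v | ∃ a b, a < b ∧ v ∈ S a b}) := by
  set U : Set V := {v | ∃ a b, a < b ∧ v ∈ S a b} with hU
  have hfU : ∀ a, f a ∈ U := by
    intro a
    by_cases ha : a = 0
    · exact ⟨0, 1, by decide, ha ▸ (hS 0 1 (by decide)).left_mem⟩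
    · exact ⟨0, a, by omega, (hS 0 a (by omega)).right_mem⟩
  have hW := fun a b (hab : a < b) => (hS a b hab).exists_walk (U := U)
    (fun v hv => ⟨a, b, hab, hv⟩) (hfU a) (hfU b)
  choose W hWp hWs hWe using hW
  let F : Fin 4 ↪ U := ⟨fun a => ⟨f a, hfU a⟩, fun a b h => hf (congrArg Subtype.val h)⟩
  let P : ∀ a b : Fin 4, (completeGraph (Fin 4)).Adj a b → (G.induce U).Walk (F a) (F b) :=
    fun a b hab => if hlt : a < b then W a b hlt else
      (W b a (lt_of_le_of_ne (not_lt.1 hlt) (Ne.symm hab))).reverse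
  have hPs : ∀ a b hab, ∃ c d, ∃ hcd : c < d, s(c, d) = s(a, b) ∧
      (P a b hab).support.Perm (W c d hcd).support := by
    intro a b hab
    by_cases hlt : a < b
    · refine ⟨a, b, hlt, rfl, ?_⟩
      simp only [P, hlt, dite_true]; exact List.Perm.refl _
    · refine ⟨b, a, lt_of_le_of_ne (not_lt.1 hlt) (Ne.symm hab), Sym2.eq_swap, ?_⟩
      simp only [P, hlt, dite_false, Walk.support_reverse]
      exact List.reverse_perm _
  refine ⟨F, P, ?_, ?_, ?_, ?_, ?_, ?_⟩
  · intro a b hab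
    by_cases hlt : a < b
    · simp only [P, hlt, dite_true]; exact hWp a b hlt
    · simp only [P, hlt, dite_false]; exact (hWp b a _).reverse
  · intro a b hab
    by_cases hlt : a < b
    · simp only [P, hlt, not_lt.2 hlt.le, dite_true, dite_false]
    · have hlt' : b < a := lt_of_le_of_ne (not_lt.1 hlt) (Ne.symm hab)
      simp only [P, hlt, hlt', dite_true, dite_false, Walk.reverse_reverse]
  · intro a b hab w hw
    obtain ⟨c, d, hcd, hs, hperm⟩ := hPs a b hab
    rw [hperm.mem_iff, hWs] at hw
    have := hend c d hcd w hw
    rcases Sym2.eq_iff.1 hs with ⟨rfl, rfl⟩ | ⟨rfl, rfl⟩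
    · exact this
    · exact this.symm
  · intro a b hab c d hcd hne u hu hu'
    obtain ⟨a', b', hab', hs, hperm⟩ := hPs a b hab
    obtain ⟨c', d', hcd', hs', hperm'⟩ := hPs c d hcd
    rw [hperm.mem_iff, hWs] at hu
    rw [hperm'.mem_iff, hWs] at hu'
    obtain ⟨x, hx⟩ := hdisj a' b' c' d' hab' hcd'
      (by rintro ⟨rfl, rfl⟩; exact hne (hs.symm.trans hs')) u hu hu'
    exact ⟨x, Subtype.ext hx⟩
  · rintro ⟨u, a, b, hab, hu⟩
    right
    refine ⟨a, b, hab.ne, ?_⟩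
    simp only [P, hab, dite_true]
    exact (hWs a b hab _).2 hu
  · intro u v huv
    obtain ⟨a, b, hab, hu, hv⟩ := hedge u v huv u.2 v.2
    refine ⟨a, b, hab.ne, ?_⟩
    simp only [P, hab, dite_true]
    exact hWe a b hab u v hu hv huv

end SimpleGraph

/-! ### Tripods and the three-edge lemma -/

namespace SimpleGraph

variable {V : Type*} {G : SimpleGraph V}

theorem IsPathFn.pathSet_sub {n : ℕ} {p : ℕ → V} (hp : IsPathFn G n p) {i j : ℕ} (hij : i ≤ j)
    (hj : j ≤ n) : PathSet G {v | ∃ k, i ≤ k ∧ k ≤ j ∧ p k = v} (p i) (p j) := by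
  refine ⟨j - i, fun k => p (k + i), (hp.mono hj).shift i hij, by simp,
    by simp [Nat.sub_add_cancel hij], fun v => ?_⟩
  constructor
  · rintro ⟨k, h1, h2, rfl⟩
    exact ⟨k - i, by omega, by simp [Nat.sub_add_cancel h1]⟩
  · rintro ⟨k, h1, rfl⟩
    exact ⟨k + i, by omega, by omega, rfl⟩

/-- From a vertex `t` of a connected set `T` there is an induced path in `T` to a neighbour of
`Q ⊆ T`, only the last vertex of which has neighbours in `Q`. -/
theorem ConnOn.exists_approach {T Q : Set V} (hT : ConnOn G T) (hQ : Q ⊆ T) (hne : Q.Nonempty)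
    {t : V} (ht : t ∈ T) (htQ : t ∉ Q) :
    ∃ R ⊆ T, ∃ r, PathSet G R t r ∧ Disjoint R Q ∧ (∃ q ∈ Q, G.Adj r q) ∧
      ∀ u ∈ R, ∀ q ∈ Q, G.Adj u q → u = r := by
  classical
  obtain ⟨q0, hq0⟩ := hne
  obtain ⟨S, hST, n, p, hp, h0, hn, hS⟩ := hT.exists_pathSet ht (hQ hq0)
  have hn0 : n ≠ 0 := by
    rintro rfl
    exact htQ (by rw [← h0, hn]; exact hq0)
  have hex : ∃ i, i < n ∧ ∃ q ∈ Q, G.Adj (p i) q := by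
    refine ⟨n - 1, by omega, q0, hq0, ?_⟩
    have := hp.adj (n - 1) (by omega)
    rwa [show n - 1 + 1 = n by omega, hn] at this
  obtain ⟨hl, hlq⟩ := Nat.find_spec hex
  set l := Nat.find hex
  have hmin : ∀ i < l, ¬ ∃ q ∈ Q, G.Adj (p i) q := fun i hi hadj =>
    Nat.find_min hex hi ⟨by omega, hadj⟩
  refine ⟨{v | ∃ i ≤ l, p i = v}, ?_, p l, h0 ▸ (hp.mono hl.le).pathSet, ?_, hlq, ?_⟩
  · rintro v ⟨i, hi, rfl⟩
    exact hST ((hS _).2 ⟨i, by omega, rfl⟩)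
  · rw [Set.disjoint_left]
    rintro v ⟨i, hi, rfl⟩ hv
    rcases Nat.eq_zero_or_pos i with rfl | hpos
    · exact htQ (h0 ▸ hv)
    · refine hmin (i - 1) (by omega) ⟨_, hv, ?_⟩
      have := hp.adj (i - 1) (by omega)
      rwa [show i - 1 + 1 = i by omega] at this
  · rintro u ⟨i, hi, rfl⟩ q hq hadj
    rcases Nat.lt_or_ge i l with h | h
    · exact absurd ⟨q, hq, hadj⟩ (hmin i h)
    · congr 1; omega

/-- Three induced paths of `T` from a common vertex `f` to `t₁`, `t₂`, `t₃` which have no common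
vertices and no edges between them but at `f`. -/
structure IsTripod (G : SimpleGraph V) (T : Set V) (t₁ t₂ t₃ f : V) (L₁ L₂ L₃ : Set V) : Prop where
  sub₁ : L₁ ⊆ T
  sub₂ : L₂ ⊆ T
  sub₃ : L₃ ⊆ T
  path₁ : PathSet G L₁ f t₁
  path₂ : PathSet G L₂ f t₂
  path₃ : PathSet G L₃ f t₃
  inter₁₂ : ∀ u ∈ L₁, u ∈ L₂ → u = f
  inter₁₃ : ∀ u ∈ L₁, u ∈ L₃ → u = f
  inter₂₃ : ∀ u ∈ L₂, u ∈ L₃ → u = f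
  adj₁₂ : ∀ u ∈ L₁, ∀ v ∈ L₂, G.Adj u v → u = f ∨ v = f
  adj₁₃ : ∀ u ∈ L₁, ∀ v ∈ L₃, G.Adj u v → u = f ∨ v = f
  adj₂₃ : ∀ u ∈ L₂, ∀ v ∈ L₃, G.Adj u v → u = f ∨ v = f

/-- Take an induced path Q from t₁ to t₂ and approach it from t₃ until the first vertex r with
neighbours on Q. If r has one neighbour on Q, the tripod branches there. Otherwise it branches at r
and uses the extreme neighbours of r on Q. -/
theorem ConnOn.exists_tripod (hG : G.CliqueFree 3) {T : Set V} (hT : ConnOn G T) {t₁ t₂ t₃ : V}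
    (h₁ : t₁ ∈ T) (h₂ : t₂ ∈ T) (h₃ : t₃ ∈ T) :
    ∃ f L₁ L₂ L₃, IsTripod G T t₁ t₂ t₃ f L₁ L₂ L₃ := by
  classical
  obtain ⟨Q, hQT, n, q, hq, h0, hn, hQ⟩ := hT.exists_pathSet h₁ h₂
  have hqQ : ∀ i ≤ n, q i ∈ Q := fun i hi => (hQ _).2 ⟨i, hi, rfl⟩
  have hqe : ∀ i j, i ≤ n → j ≤ n → q i = q j → i = j := by
    intro i j hi hj he
    by_contra hne
    rcases lt_or_gt_of_ne hne with hl | hl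
    · exact hq.inj i j hl hj he
    · exact hq.inj j i hl hi he.symm
  have hsub : ∀ i j, j ≤ n → {v | ∃ k, i ≤ k ∧ k ≤ j ∧ q k = v} ⊆ Q := by
    rintro i j hj v ⟨k, _, _, rfl⟩
    exact hqQ k (by omega)
  have hPl : ∀ i ≤ n, PathSet G {v | ∃ k, 0 ≤ k ∧ k ≤ i ∧ q k = v} (q i) t₁ := fun i hi =>
    h0 ▸ (hq.pathSet_sub (Nat.zero_le i) hi).symm
  have hPr : ∀ i ≤ n, PathSet G {v | ∃ k, i ≤ k ∧ k ≤ n ∧ q k = v} (q i) t₂ := fun i hi =>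
    hn ▸ (hq.pathSet_sub hi le_rfl)
  have hI : ∀ i ≤ n, ∀ u ∈ {v | ∃ k, 0 ≤ k ∧ k ≤ i ∧ q k = v},
      u ∈ {v | ∃ k, i ≤ k ∧ k ≤ n ∧ q k = v} → u = q i := by
    rintro i hi u ⟨k, k0, k1, rfl⟩ ⟨l, l0, l1, e⟩
    have := hqe l k l1 (by omega) e
    congr 1; omega
  have hA : ∀ i ≤ n, ∀ u ∈ {v | ∃ k, 0 ≤ k ∧ k ≤ i ∧ q k = v},
      ∀ v ∈ {v | ∃ k, i ≤ k ∧ k ≤ n ∧ q k = v}, G.Adj u v → u = q i ∨ v = q i := by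
    rintro i hi u ⟨k, k0, k1, rfl⟩ v ⟨l, l0, l1, rfl⟩ hadj
    by_contra hcon
    push Not at hcon
    have e1 : k ≠ i := fun e => hcon.1 (by rw [e])
    have e2 : l ≠ i := fun e => hcon.2 (by rw [e])
    exact hq.chord k l (by omega) l1 hadj
  by_cases h3Q : t₃ ∈ Q
  · obtain ⟨i, hi, rfl⟩ := (hQ _).1 h3Q
    refine ⟨q i, _, _, {q i}, (hsub 0 i hi).trans hQT, (hsub i n le_rfl).trans hQT, ?_, hPl i hi,
      hPr i hi, PathSet.singleton _, hI i hi, fun u _ h => h, fun u _ h => h, hA i hi,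
      fun u _ v h _ => Or.inr h, fun u _ v h _ => Or.inr h⟩
    rintro v rfl
    exact h₃
  obtain ⟨R, hRT, r, hR, hRQ, hrq, hronly⟩ := hT.exists_approach hQT ⟨_, hqQ 0 (by omega)⟩ h₃ h3Q
  have hrR := hR.right_mem
  have hrQ : r ∉ Q := fun h => Set.disjoint_left.1 hRQ hrR h
  have hex : ∃ i, i ≤ n ∧ G.Adj r (q i) := by
    obtain ⟨x, hx, hrx⟩ := hrq
    obtain ⟨i, hi, rfl⟩ := (hQ x).1 hx
    exact ⟨i, hi, hrx⟩
  obtain ⟨hi, hri⟩ := Nat.find_spec hex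
  have hmini : ∀ k < Nat.find hex, ¬ G.Adj r (q k) := fun k hk hadj =>
    Nat.find_min hex hk ⟨by omega, hadj⟩
  obtain ⟨i, hi, hri, hmini⟩ : ∃ i ≤ n, G.Adj r (q i) ∧ ∀ k < i, ¬ G.Adj r (q k) :=
    ⟨_, hi, hri, hmini⟩
  obtain ⟨j, hij, hj, hrj, hmaxj⟩ : ∃ j, i ≤ j ∧ j ≤ n ∧ G.Adj r (q j) ∧
      ∀ k, j < k → k ≤ n → ¬ G.Adj r (q k) := by
    refine ⟨Nat.findGreatest (fun k => G.Adj r (q k)) n, Nat.le_findGreatest hi hri,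
      Nat.findGreatest_le n, Nat.findGreatest_spec (P := fun k => G.Adj r (q k)) hi hri,
      fun k hk hkn => Nat.findGreatest_is_greatest hk hkn⟩
  rcases Nat.eq_or_lt_of_le hij with rfl | hlt
  · have hL3 : PathSet G (R ∪ {q i}) t₃ (q i) := by
      refine hR.concat (PathSet.singleton _) ?_ hri ?_
      · rw [Set.disjoint_singleton_right]
        exact fun h => Set.disjoint_left.1 hRQ h (hqQ i hi)
      · rintro u hu v rfl hadj
        exact ⟨hronly u hu _ (hqQ i hi) hadj, rfl⟩
    have hinter : ∀ u ∈ Q, u ∈ R ∪ {q i} → u = q i := by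
      rintro u hu (h | h)
      · exact absurd hu (Set.disjoint_left.1 hRQ h)
      · exact h
    have hadj : ∀ u ∈ Q, ∀ v ∈ R ∪ {q i}, G.Adj u v → u = q i ∨ v = q i := by
      rintro u hu v (h | h) huv
      · left
        have := hronly v h u hu huv.symm
        subst this
        obtain ⟨k, hk, rfl⟩ := (hQ u).1 hu
        have h1 : ¬ k < i := fun hlt => hmini k hlt huv.symm
        have h2 : ¬ i < k := fun hlt => hmaxj k hlt hk huv.symm
        congr 1; omega
      · exact Or.inr h
    refine ⟨q i, _, _, R ∪ {q i}, (hsub 0 i hi).trans hQT, (hsub i n le_rfl).trans hQT, ?_,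
      hPl i hi, hPr i hi, hL3.symm, hI i hi, fun u hu => hinter u (hsub 0 i hi hu),
      fun u hu => hinter u (hsub i n le_rfl hu), hA i hi, fun u hu => hadj u (hsub 0 i hi hu),
      fun u hu => hadj u (hsub i n le_rfl hu)⟩
    rintro v (hv | rfl)
    · exact hRT hv
    · exact hQT (hqQ i hi)
  -- The extreme neighbours of r are not consecutive on Q, since r would complete a triangle. Hence
  -- the two pieces of Q that are kept have no edge between them.
  · have hij2 : i + 1 < j := by
      by_contra hcon
      obtain rfl : j = i + 1 := by omega
      exact hG.no_triangle hri (hq.adj i (by omega)) hrj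
    have hL1 : PathSet G ({r} ∪ {v | ∃ k, 0 ≤ k ∧ k ≤ i ∧ q k = v}) r t₁ := by
      refine (PathSet.singleton r).concat (hPl i hi) ?_ hri ?_
      · rw [Set.disjoint_singleton_left]
        exact fun h => hrQ (hsub 0 i hi h)
      · rintro u rfl v ⟨k, _, hk, rfl⟩ hadj
        refine ⟨rfl, ?_⟩
        have h1 : ¬ k < i := fun hlt => hmini k hlt hadj
        congr 1; omega
    have hL2 : PathSet G ({r} ∪ {v | ∃ k, j ≤ k ∧ k ≤ n ∧ q k = v}) r t₂ := by
      refine (PathSet.singleton r).concat (hPr j hj) ?_ hrj ?_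
      · rw [Set.disjoint_singleton_left]
        exact fun h => hrQ (hsub j n le_rfl h)
      · rintro u rfl v ⟨k, hk, hkn, rfl⟩ hadj
        refine ⟨rfl, ?_⟩
        have h1 : ¬ j < k := fun hlt => hmaxj k hlt hkn hadj
        congr 1; omega
    have hinter : ∀ S ⊆ Q, ∀ u ∈ {r} ∪ S, u ∈ R → u = r := by
      rintro S hS u (h | h) hu
      · exact h
      · exact absurd (hS h) (Set.disjoint_left.1 hRQ hu)
    have hadj : ∀ S ⊆ Q, ∀ u ∈ {r} ∪ S, ∀ v ∈ R, G.Adj u v → u = r ∨ v = r := by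
      rintro S hS u (h | h) v hv huv
      · exact Or.inl h
      · exact Or.inr (hronly v hv u (hS h) huv.symm)
    have hsubT : ∀ S ⊆ Q, {r} ∪ S ⊆ T := by
      rintro S hS u (rfl | h)
      · exact hRT hrR
      · exact hQT (hS h)
    refine ⟨r, _, _, R, hsubT _ (hsub 0 i hi), hsubT _ (hsub j n le_rfl), hRT, hL1, hL2, hR.symm,
      ?_, hinter _ (hsub 0 i hi), hinter _ (hsub j n le_rfl), ?_, hadj _ (hsub 0 i hi),
      hadj _ (hsub j n le_rfl)⟩
    · rintro u (h | ⟨k, _, hk, rfl⟩) (h' | ⟨l, hl, hln, e⟩)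
      · exact h
      · exact h
      · exact h'
      · have := hqe l k hln (by omega) e
        omega
    · rintro u (h | ⟨k, _, hk, rfl⟩) v (h' | ⟨l, hl, hln, rfl⟩) huv
      · exact Or.inl h
      · exact Or.inl h
      · exact Or.inr h'
      · exact absurd huv (hq.chord k l (by omega) hln)

/-- The branch vertices are the centre c of a tripod in T and the three ends on the hole. The legs
of the tripod, each extended by one of the three edges, are the paths at c; the arcs of the hole are
the other three. -/
theorem not_isk4Free_of_three_edges_aux (hG : G.CliqueFree 3) {N : ℕ} {h : ℤ → V}
    (hh : IsHoleFn G N h) {T : Set V} (hT : ConnOn G T) (hd : ∀ i, h i ∉ T) {i₁ i₂ i₃ : ℤ}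
    (h12 : i₁ < i₂) (h23 : i₂ < i₃) (h31 : i₃ < i₁ + N) {t₁ t₂ t₃ : V} (ht₁ : t₁ ∈ T)
    (ht₂ : t₂ ∈ T) (ht₃ : t₃ ∈ T) (ha₁ : G.Adj (h i₁) t₁) (ha₂ : G.Adj (h i₂) t₂)
    (ha₃ : G.Adj (h i₃) t₃)
    (honly : ∀ i, ∀ t ∈ T, G.Adj (h i) t → (h i = h i₁ ∧ t = t₁) ∨ (h i = h i₂ ∧ t = t₂) ∨
      (h i = h i₃ ∧ t = t₃)) : ¬ G.ISK4Free := by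
  obtain ⟨c, L₁, L₂, L₃, hL⟩ := hT.exists_tripod hG ht₁ ht₂ ht₃
  have hc₁ := hL.path₁.left_mem
  have hc₂ := hL.path₂.left_mem
  have hc₃ := hL.path₃.left_mem
  have hne12 : h i₁ ≠ h i₂ := hh.inj _ _ h12 (by omega)
  have hne13 : h i₁ ≠ h i₃ := hh.inj _ _ (by omega) (by omega)
  have hne23 : h i₂ ≠ h i₃ := hh.inj _ _ h23 (by omega)
  have hcT : c ∈ T := hL.sub₁ hc₁
  have hcne : ∀ i, c ≠ h i := fun i e => hd i (e ▸ hcT)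
  have hdT : ∀ u ∈ T, ∀ i, u ≠ h i := fun u hu i e => hd i (e ▸ hu)
  have leg : ∀ (L : Set V) (i : ℤ) (t : V), L ⊆ T → PathSet G L c t → G.Adj (h i) t →
      (∀ s ∈ T, G.Adj (h i) s → s = t) → PathSet G (L ∪ {h i}) c (h i) := by
    intro L i t hLT hP hadj ho
    refine hP.concat (PathSet.singleton _) ?_ hadj.symm ?_
    · rw [Set.disjoint_singleton_right]
      exact fun hm => hd i (hLT hm)
    · rintro u hu v rfl huv
      exact ⟨ho u (hLT hu) huv.symm, rfl⟩
  have P1 := leg L₁ i₁ t₁ hL.sub₁ hL.path₁ ha₁ (fun s hs hadj => by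
    rcases honly _ s hs hadj with h | h | h
    · exact h.2
    · exact absurd h.1 hne12
    · exact absurd h.1 hne13)
  have P2 := leg L₂ i₂ t₂ hL.sub₂ hL.path₂ ha₂ (fun s hs hadj => by
    rcases honly _ s hs hadj with h | h | h
    · exact absurd h.1.symm hne12
    · exact h.2
    · exact absurd h.1 hne23)
  have P3 := leg L₃ i₃ t₃ hL.sub₃ hL.path₃ ha₃ (fun s hs hadj => by
    rcases honly _ s hs hadj with h | h | h
    · exact absurd h.1.symm hne13
    · exact absurd h.1.symm hne23
    · exact h.2)
  have A12 := hh.pathSet_arc h12.le (by omega)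
  have A23 := hh.pathSet_arc h23.le (by omega)
  have A31 := hh.pathSet_arc h31.le (by omega)
  rw [hh.per] at A31
  let f : Fin 4 → V := ![c, h i₁, h i₂, h i₃]
  -- Only entries above the diagonal are used. The arc between the branch vertices 1 and 3 runs from
  -- i₃ round to i₁ + N, so as to avoid i₂.
  let S : Fin 4 → Fin 4 → Set V := fun a b =>
    ![![∅, L₁ ∪ {h i₁}, L₂ ∪ {h i₂}, L₃ ∪ {h i₃}], ![∅, ∅, arc h i₁ i₂, arc h i₃ (i₁ + N)],
      ![∅, ∅, ∅, arc h i₂ i₃], ![∅, ∅, ∅, ∅]] a b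
  have pairs : ∀ a b : Fin 4, a < b → (a = 0 ∧ b = 1) ∨ (a = 0 ∧ b = 2) ∨ (a = 0 ∧ b = 3) ∨
      (a = 1 ∧ b = 2) ∨ (a = 1 ∧ b = 3) ∨ (a = 2 ∧ b = 3) := by decide
  have hr : ∀ u, u = c ∨ u = h i₁ ∨ u = h i₂ ∨ u = h i₃ → u ∈ Set.range f := by
    rintro u (rfl | rfl | rfl | rfl)
    · exact ⟨0, rfl⟩
    · exact ⟨1, rfl⟩
    · exact ⟨2, rfl⟩
    · exact ⟨3, rfl⟩
  have arcT : ∀ (i j : ℤ) u, u ∈ T → u ∉ arc h i j := by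
    rintro i j u hu ⟨k, _, _, rfl⟩
    exact hd k hu
  have I12 : ∀ u ∈ L₁ ∪ {h i₁}, u ∈ L₂ ∪ {h i₂} → u ∈ Set.range f := by
    rintro u (hu | rfl) (hu' | hu')
    · exact hr u (Or.inl (hL.inter₁₂ u hu hu'))
    · exact hr u (by simp_all)
    · exact hr _ (by simp)
    · exact hr _ (by simp)
  have I13 : ∀ u ∈ L₁ ∪ {h i₁}, u ∈ L₃ ∪ {h i₃} → u ∈ Set.range f := by
    rintro u (hu | rfl) (hu' | hu')
    · exact hr u (Or.inl (hL.inter₁₃ u hu hu'))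
    · exact hr u (by simp_all)
    · exact hr _ (by simp)
    · exact hr _ (by simp)
  have I23 : ∀ u ∈ L₂ ∪ {h i₂}, u ∈ L₃ ∪ {h i₃} → u ∈ Set.range f := by
    rintro u (hu | rfl) (hu' | hu')
    · exact hr u (Or.inl (hL.inter₂₃ u hu hu'))
    · exact hr u (by simp_all)
    · exact hr _ (by simp)
    · exact hr _ (by simp)
  have IA1 : ∀ u ∈ L₁ ∪ {h i₁}, ∀ i j, u ∈ arc h i j → u ∈ Set.range f := by
    rintro u (hu | rfl) i j hu'
    · exact absurd hu' (arcT _ _ _ (hL.sub₁ hu))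
    · exact hr _ (by simp)
  have IA2 : ∀ u ∈ L₂ ∪ {h i₂}, ∀ i j, u ∈ arc h i j → u ∈ Set.range f := by
    rintro u (hu | rfl) i j hu'
    · exact absurd hu' (arcT _ _ _ (hL.sub₂ hu))
    · exact hr _ (by simp)
  have IA3 : ∀ u ∈ L₃ ∪ {h i₃}, ∀ i j, u ∈ arc h i j → u ∈ Set.range f := by
    rintro u (hu | rfl) i j hu'
    · exact absurd hu' (arcT _ _ _ (hL.sub₃ hu))
    · exact hr _ (by simp)
  have B1 : ∀ u ∈ arc h i₁ i₂, u ∈ arc h i₂ i₃ → u ∈ Set.range f := by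
    rintro u ⟨k, k1, k2, rfl⟩ ⟨l, l1, l2, e⟩
    have := hh.eq_of_window (by omega) (by omega) e
    obtain rfl : k = i₂ := by omega
    exact hr _ (by simp)
  have B2 : ∀ u ∈ arc h i₁ i₂, u ∈ arc h i₃ (i₁ + N) → u ∈ Set.range f := by
    rintro u ⟨k, k1, k2, rfl⟩ ⟨l, l1, l2, e⟩
    by_cases hl : l < k + N
    · have := hh.eq_of_window hl (by omega) e
      omega
    · obtain rfl : k = i₁ := by omega
      exact hr _ (by simp)
  have B3 : ∀ u ∈ arc h i₂ i₃, u ∈ arc h i₃ (i₁ + N) → u ∈ Set.range f := by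
    rintro u ⟨k, k1, k2, rfl⟩ ⟨l, l1, l2, e⟩
    have := hh.eq_of_window (by omega) (by omega) e
    obtain rfl : k = i₃ := by omega
    exact hr _ (by simp)
  have E01 : (0 : Fin 4) < 1 := by decide
  have E02 : (0 : Fin 4) < 2 := by decide
  have E03 : (0 : Fin 4) < 3 := by decide
  have E12 : (1 : Fin 4) < 2 := by decide
  have E13 : (1 : Fin 4) < 3 := by decide
  have E23 : (2 : Fin 4) < 3 := by decide
  have hstep : ∀ k : ℤ, ∃ a b, a < b ∧ h k ∈ S a b ∧ h (k + 1) ∈ S a b := by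
    intro k
    obtain ⟨m, m1, m2⟩ := hh.exists_shift i₁ k
    rw [← hh.per_mul k m, ← hh.per_mul (k + 1) m, show k + 1 + m * N = k + m * N + 1 by ring]
    generalize k + m * N = k at *
    by_cases c2 : k < i₂
    · exact ⟨1, 2, E12, mem_arc m1 (by omega), mem_arc (by omega) (by omega)⟩
    · by_cases c3 : k < i₃
      · exact ⟨2, 3, E23, mem_arc (by omega) (by omega), mem_arc (by omega) (by omega)⟩
      · exact ⟨1, 3, E13, mem_arc (by omega) (by omega), mem_arc (by omega) (by omega)⟩
  have hmemU : ∀ u, (∃ a b, a < b ∧ u ∈ S a b) →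
      (u ∈ L₁ ∨ u ∈ L₂ ∨ u ∈ L₃) ∨ u ∈ Set.range h := by
    rintro u ⟨a, b, hab, hu⟩
    rcases pairs a b hab with ⟨rfl, rfl⟩ | ⟨rfl, rfl⟩ | ⟨rfl, rfl⟩ | ⟨rfl, rfl⟩ | ⟨rfl, rfl⟩ |
      ⟨rfl, rfl⟩
    · rcases hu with hu | rfl
      · exact Or.inl (Or.inl hu)
      · exact Or.inr ⟨_, rfl⟩
    · rcases hu with hu | rfl
      · exact Or.inl (Or.inr (Or.inl hu))
      · exact Or.inr ⟨_, rfl⟩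
    · rcases hu with hu | rfl
      · exact Or.inl (Or.inr (Or.inr hu))
      · exact Or.inr ⟨_, rfl⟩
    · exact Or.inr (arc_subset_range _ _ hu)
    · exact Or.inr (arc_subset_range _ _ hu)
    · exact Or.inr (arc_subset_range _ _ hu)
  have hLT : ∀ u, (u ∈ L₁ ∨ u ∈ L₂ ∨ u ∈ L₃) → u ∈ T := by
    rintro u (h | h | h)
    · exact hL.sub₁ h
    · exact hL.sub₂ h
    · exact hL.sub₃ h
  have S01 : ∀ u ∈ L₁, u ∈ S 0 1 := fun u hu => Or.inl hu
  have S02 : ∀ u ∈ L₂, u ∈ S 0 2 := fun u hu => Or.inl hu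
  have S03 : ∀ u ∈ L₃, u ∈ S 0 3 := fun u hu => Or.inl hu
  have hcross : ∀ i, ∀ v ∈ T, G.Adj (h i) v → ∃ a b, a < b ∧ h i ∈ S a b ∧ v ∈ S a b := by
    intro i v hv hadj
    rcases honly i v hv hadj with ⟨e, rfl⟩ | ⟨e, rfl⟩ | ⟨e, rfl⟩
    · exact ⟨0, 1, E01, Or.inr e, Or.inl hL.path₁.right_mem⟩
    · exact ⟨0, 2, E02, Or.inr e, Or.inl hL.path₂.right_mem⟩
    · exact ⟨0, 3, E03, Or.inr e, Or.inl hL.path₃.right_mem⟩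
  refine fun hfree => hfree ⟨_, IsSubdivision.of_pathSets f ?_ S ?_ ?_ ?_ ?_⟩
  · intro a b hab
    by_contra hne
    have key : ∀ a b, a < b → f a ≠ f b := by
      intro a b hab
      rcases pairs a b hab with ⟨rfl, rfl⟩ | ⟨rfl, rfl⟩ | ⟨rfl, rfl⟩ | ⟨rfl, rfl⟩ | ⟨rfl, rfl⟩ |
        ⟨rfl, rfl⟩
      · exact hcne _
      · exact hcne _
      · exact hcne _
      · exact hne12
      · exact hne13
      · exact hne23
    rcases lt_or_gt_of_ne hne with hl | hl
    · exact key a b hl hab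
    · exact key b a hl hab.symm
  · intro a b hab
    rcases pairs a b hab with ⟨rfl, rfl⟩ | ⟨rfl, rfl⟩ | ⟨rfl, rfl⟩ | ⟨rfl, rfl⟩ | ⟨rfl, rfl⟩ |
      ⟨rfl, rfl⟩
    · exact P1
    · exact P2
    · exact P3
    · exact A12
    · exact A31.symm
    · exact A23
  · have Lh : ∀ (L : Set V) (i j : ℤ), L ⊆ T → h j ∈ L ∪ {h i} → h i ≠ h j → False := by
      rintro L i j hLT (hj | hj) hne
      · exact hd j (hLT hj)
      · exact hne hj.symm
    have cA : ∀ i j, c ∉ arc h i j := fun i j => arcT i j c hcT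
    have hnot : ∀ i j k : ℤ, j < k → k < i + N → h k ∉ arc h i j := by
      rintro i j k h1 h2 ⟨l, l1, l2, e⟩
      have := hh.eq_of_window (by omega) (by omega) e
      omega
    intro a b hab d
    rcases pairs a b hab with ⟨rfl, rfl⟩ | ⟨rfl, rfl⟩ | ⟨rfl, rfl⟩ | ⟨rfl, rfl⟩ | ⟨rfl, rfl⟩ |
      ⟨rfl, rfl⟩ <;> intro hm
    · fin_cases d
      · simp
      · simp
      · exact (Lh _ _ _ hL.sub₁ hm hne12).elim
      · exact (Lh _ _ _ hL.sub₁ hm hne13).elim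
    · fin_cases d
      · simp
      · exact (Lh _ _ _ hL.sub₂ hm hne12.symm).elim
      · simp
      · exact (Lh _ _ _ hL.sub₂ hm hne23).elim
    · fin_cases d
      · simp
      · exact (Lh _ _ _ hL.sub₃ hm hne13.symm).elim
      · exact (Lh _ _ _ hL.sub₃ hm hne23.symm).elim
      · simp
    · fin_cases d
      · exact (cA _ _ hm).elim
      · simp
      · simp
      · exact (hnot _ _ i₃ h23 h31 hm).elim
    · fin_cases d
      · exact (cA _ _ hm).elim
      · simp
      · refine (hnot i₃ (i₁ + N) (i₂ + N) (by omega) (by omega) ?_).elim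
        rw [hh.per]; exact hm
      · simp
    · fin_cases d
      · exact (cA _ _ hm).elim
      · refine (hnot i₂ i₃ (i₁ + N) (by omega) (by omega) ?_).elim
        rw [hh.per]; exact hm
      · simp
      · simp
  · intro a b a' b' hab hab' hne u
    rcases pairs a b hab with ⟨rfl, rfl⟩ | ⟨rfl, rfl⟩ | ⟨rfl, rfl⟩ | ⟨rfl, rfl⟩ | ⟨rfl, rfl⟩ |
      ⟨rfl, rfl⟩ <;>
    rcases pairs a' b' hab' with ⟨rfl, rfl⟩ | ⟨rfl, rfl⟩ | ⟨rfl, rfl⟩ | ⟨rfl, rfl⟩ |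
      ⟨rfl, rfl⟩ | ⟨rfl, rfl⟩ <;> intro hu hu' <;>
    first
    | exact absurd ⟨rfl, rfl⟩ hne
    | exact I12 u hu hu'
    | exact I12 u hu' hu
    | exact I13 u hu hu'
    | exact I13 u hu' hu
    | exact I23 u hu hu'
    | exact I23 u hu' hu
    | exact IA1 u hu _ _ hu'
    | exact IA1 u hu' _ _ hu
    | exact IA2 u hu _ _ hu'
    | exact IA2 u hu' _ _ hu
    | exact IA3 u hu _ _ hu'
    | exact IA3 u hu' _ _ hu
    | exact B1 u hu hu'
    | exact B1 u hu' hu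
    | exact B2 u hu hu'
    | exact B2 u hu' hu
    | exact B3 u hu hu'
    | exact B3 u hu' hu
  · intro u v huv hu hv
    rcases hmemU u hu with hu | hu <;> rcases hmemU v hv with hv | hv
    · rcases hu with hu | hu | hu <;> rcases hv with hv | hv | hv
      · exact ⟨0, 1, E01, S01 u hu, S01 v hv⟩
      · rcases hL.adj₁₂ u hu v hv huv with rfl | rfl
        · exact ⟨0, 2, E02, S02 u hc₂, S02 v hv⟩
        · exact ⟨0, 1, E01, S01 u hu, S01 v hc₁⟩
      · rcases hL.adj₁₃ u hu v hv huv with rfl | rfl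
        · exact ⟨0, 3, E03, S03 u hc₃, S03 v hv⟩
        · exact ⟨0, 1, E01, S01 u hu, S01 v hc₁⟩
      · rcases hL.adj₁₂ v hv u hu huv.symm with rfl | rfl
        · exact ⟨0, 2, E02, S02 u hu, S02 v hc₂⟩
        · exact ⟨0, 1, E01, S01 u hc₁, S01 v hv⟩
      · exact ⟨0, 2, E02, S02 u hu, S02 v hv⟩
      · rcases hL.adj₂₃ u hu v hv huv with rfl | rfl
        · exact ⟨0, 3, E03, S03 u hc₃, S03 v hv⟩
        · exact ⟨0, 2, E02, S02 u hu, S02 v hc₂⟩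
      · rcases hL.adj₁₃ v hv u hu huv.symm with rfl | rfl
        · exact ⟨0, 3, E03, S03 u hu, S03 v hc₃⟩
        · exact ⟨0, 1, E01, S01 u hc₁, S01 v hv⟩
      · rcases hL.adj₂₃ v hv u hu huv.symm with rfl | rfl
        · exact ⟨0, 3, E03, S03 u hu, S03 v hc₃⟩
        · exact ⟨0, 2, E02, S02 u hc₂, S02 v hv⟩
      · exact ⟨0, 3, E03, S03 u hu, S03 v hv⟩
    · obtain ⟨i, rfl⟩ := hv
      obtain ⟨a, b, hab, e1, e2⟩ := hcross i u (hLT u hu) huv.symm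
      exact ⟨a, b, hab, e2, e1⟩
    · obtain ⟨i, rfl⟩ := hu
      exact hcross i v (hLT v hv) huv
    · obtain ⟨i, rfl⟩ := hu
      rcases hh.eq_of_adj hv huv with rfl | rfl
      · exact hstep i
      · obtain ⟨a, b, hab, e1, e2⟩ := hstep (i - 1)
        exact ⟨a, b, hab, by simpa using e2, e1⟩

/-- In a triangle-free graph a hole and a connected set joined by exactly three edges, with distinct
ends on the hole, contain an induced subdivision of `K₄`. -/
theorem not_isk4Free_of_three_edges (hG : G.CliqueFree 3) {N : ℕ} {h : ℤ → V}
    (hh : IsHoleFn G N h) {T : Set V} (hT : ConnOn G T) (hd : ∀ i, h i ∉ T) {a b c s t u : V}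
    (ha : a ∈ Set.range h) (hb : b ∈ Set.range h) (hc : c ∈ Set.range h) (hab : a ≠ b)
    (hac : a ≠ c) (hbc : b ≠ c) (hs : s ∈ T) (ht : t ∈ T) (hu : u ∈ T) (has : G.Adj a s)
    (hbt : G.Adj b t) (hcu : G.Adj c u)
    (honly : ∀ i, ∀ w ∈ T, G.Adj (h i) w → (h i = a ∧ w = s) ∨ (h i = b ∧ w = t) ∨
      (h i = c ∧ w = u)) : ¬ G.ISK4Free := by
  obtain ⟨i, i1, i2, rfl⟩ := hh.exists_rep_of_mem 0 ha
  obtain ⟨j, j1, j2, rfl⟩ := hh.exists_rep_of_mem 0 hb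
  obtain ⟨k, k1, k2, rfl⟩ := hh.exists_rep_of_mem 0 hc
  have nij : i ≠ j := by rintro rfl; exact hab rfl
  have nik : i ≠ k := by rintro rfl; exact hac rfl
  have njk : j ≠ k := by rintro rfl; exact hbc rfl
  rcases lt_or_gt_of_ne nij with h1 | h1 <;> rcases lt_or_gt_of_ne nik with h2 | h2 <;>
    rcases lt_or_gt_of_ne njk with h3 | h3
  · exact not_isk4Free_of_three_edges_aux hG hh hT hd h1 h3 (by omega) hs ht hu has hbt hcu
      (fun i w hw e => by have := honly i w hw e; tauto)
  · exact not_isk4Free_of_three_edges_aux hG hh hT hd h2 h3 (by omega) hs hu ht has hcu hbt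
      (fun i w hw e => by have := honly i w hw e; tauto)
  · omega
  · exact not_isk4Free_of_three_edges_aux hG hh hT hd h2 h1 (by omega) hu hs ht hcu has hbt
      (fun i w hw e => by have := honly i w hw e; tauto)
  · exact not_isk4Free_of_three_edges_aux hG hh hT hd h1 h2 (by omega) ht hs hu hbt has hcu
      (fun i w hw e => by have := honly i w hw e; tauto)
  · omega
  · exact not_isk4Free_of_three_edges_aux hG hh hT hd h3 h2 (by omega) ht hu hs hbt hcu has
      (fun i w hw e => by have := honly i w hw e; tauto)
  · exact not_isk4Free_of_three_edges_aux hG hh hT hd h3 h1 (by omega) hu ht hs hcu hbt has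
      (fun i w hw e => by have := honly i w hw e; tauto)

end SimpleGraph

/-! ### Wheels, spokes and sectors -/

namespace SimpleGraph

variable {V : Type*} {G : SimpleGraph V}

theorem exists_first {P : ℤ → Prop} {a b : ℤ} (hab : a ≤ b) (hb : P b) :
    ∃ s, a ≤ s ∧ s ≤ b ∧ P s ∧ ∀ k, a ≤ k → k < s → ¬ P k := by
  classical
  have hex : ∃ n : ℕ, P (a + n) := ⟨(b - a).toNat, by
    rwa [show a + ((b - a).toNat : ℤ) = b by omega]⟩
  refine ⟨a + (Nat.find hex : ℕ), by omega, ?_, Nat.find_spec hex, ?_⟩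
  · have : Nat.find hex ≤ (b - a).toNat := Nat.find_min' hex (by
      rwa [show a + ((b - a).toNat : ℤ) = b by omega])
    omega
  · intro k h1 h2 hk
    have : Nat.find hex ≤ (k - a).toNat := Nat.find_min' hex (by
      rwa [show a + ((k - a).toNat : ℤ) = k by omega])
    omega

theorem exists_last {P : ℤ → Prop} {a b : ℤ} (hab : a ≤ b) (ha : P a) :
    ∃ s, a ≤ s ∧ s ≤ b ∧ P s ∧ ∀ k, s < k → k ≤ b → ¬ P k := by
  obtain ⟨s, h1, h2, h3, h4⟩ := exists_first (P := fun k => P (-k)) (a := -b) (b := -a)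
    (by omega) (by simpa using ha)
  exact ⟨-s, by omega, by omega, h3, fun k k1 k2 hk => h4 (-k) (by omega) (by omega) (by simpa)⟩

/-- `x` is the centre of a wheel with rim `h`. -/
structure IsWheelFn (G : SimpleGraph V) (N : ℕ) (h : ℤ → V) (x : V) : Prop where
  hole : IsHoleFn G N h
  notMem : ∀ i, h i ≠ x
  three : ∃ a b c, a ≠ b ∧ a ≠ c ∧ b ≠ c ∧ (a ∈ Set.range h ∧ G.Adj x a) ∧
    (b ∈ Set.range h ∧ G.Adj x b) ∧ (c ∈ Set.range h ∧ G.Adj x c)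

/-- In a triangle-free graph without induced subdivision of `K₄`, wheels have at least four
spokes. -/
theorem IsWheelFn.exists_four (hG : G.CliqueFree 3) (hfree : G.ISK4Free) {N : ℕ} {h : ℤ → V}
    {x : V} (hw : IsWheelFn G N h x) (c : ℤ) :
    ∃ p q r s, c ≤ p ∧ p < q ∧ q < r ∧ r < s ∧ s < c + N ∧ G.Adj x (h p) ∧ G.Adj x (h q) ∧
      G.Adj x (h r) ∧ G.Adj x (h s) := by
  obtain ⟨hh, hx, a, b, d, hab, had, hbd, ⟨ha, hxa⟩, ⟨hb, hxb⟩, ⟨hd, hxd⟩⟩ := hw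
  obtain ⟨i, i1, i2, rfl⟩ := hh.exists_rep_of_mem c ha
  obtain ⟨j, j1, j2, rfl⟩ := hh.exists_rep_of_mem c hb
  obtain ⟨k, k1, k2, rfl⟩ := hh.exists_rep_of_mem c hd
  have nij : i ≠ j := by rintro rfl; exact hab rfl
  have nik : i ≠ k := by rintro rfl; exact had rfl
  have njk : j ≠ k := by rintro rfl; exact hbd rfl
  obtain ⟨p, p1, p2, hp, pmin⟩ := exists_first (P := fun t => G.Adj x (h t)) i1 hxa
  have Fp : ∀ t, c ≤ t → G.Adj x (h t) → p ≤ t := fun t t1 ht => by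
    by_contra hlt
    exact pmin t t1 (by omega) ht
  have hex : ∃ t, p + 1 ≤ t ∧ t < c + N ∧ G.Adj x (h t) := by
    by_cases hi : p = i
    · exact ⟨j, by have := Fp j j1 hxb; omega, j2, hxb⟩
    · exact ⟨i, by omega, i2, hxa⟩
  obtain ⟨t, t1, t2, ht⟩ := hex
  obtain ⟨q, q1, q2, hq, qmin⟩ := exists_first (P := fun t => G.Adj x (h t)) t1 ht
  have Fq : ∀ t, c ≤ t → G.Adj x (h t) → t = p ∨ q ≤ t := fun t t1 ht => by
    by_contra hlt
    have := Fp t t1 ht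
    exact qmin t (by omega) (by omega) ht
  have hex : ∃ t, q + 1 ≤ t ∧ t < c + N ∧ G.Adj x (h t) := by
    have A := Fq i i1 hxa
    have B := Fq j j1 hxb
    have C := Fq k k1 hxd
    by_cases hi : q < i
    · exact ⟨i, by omega, i2, hxa⟩
    · by_cases hj : q < j
      · exact ⟨j, by omega, j2, hxb⟩
      · exact ⟨k, by omega, k2, hxd⟩
  obtain ⟨t, t1, t2, ht⟩ := hex
  obtain ⟨r, r1, r2, hr, rmin⟩ := exists_first (P := fun t => G.Adj x (h t)) t1 ht
  have Fr : ∀ t, c ≤ t → G.Adj x (h t) → t = p ∨ t = q ∨ r ≤ t := fun t t1 ht => by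
    by_contra hlt
    have := Fq t t1 ht
    exact rmin t (by omega) (by omega) ht
  by_contra hcon
  have F4 : ∀ t, c ≤ t → t < c + N → G.Adj x (h t) → t = p ∨ t = q ∨ t = r := by
    intro t t1 t2 ht
    by_contra hne
    have := Fr t t1 ht
    exact hcon ⟨p, q, r, t, p1, by omega, by omega, by omega, t2, hp, hq, hr, ht⟩
  -- With exactly three spokes, the set {x} is joined to the rim by three edges.
  refine not_isk4Free_of_three_edges hG hh (ConnOn.singleton x) (fun i hi => hx i hi)
    ⟨p, rfl⟩ ⟨q, rfl⟩ ⟨r, rfl⟩ (hh.inj _ _ (by omega) (by omega))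
    (hh.inj _ _ (by omega) (by omega)) (hh.inj _ _ (by omega) (by omega))
    (s := x) (t := x) (u := x) rfl rfl rfl hp.symm hq.symm hr.symm ?_ hfree
  rintro t w rfl htw
  obtain ⟨t', t1, t2, e⟩ := hh.exists_rep c t
  rw [← e] at htw ⊢
  rcases F4 t' t1 t2 htw.symm with rfl | rfl | rfl
  · exact Or.inl ⟨rfl, rfl⟩
  · exact Or.inr (Or.inl ⟨rfl, rfl⟩)
  · exact Or.inr (Or.inr ⟨rfl, rfl⟩)

/-- The vertices `y`, `z` of the rim lie in a common closed sector. -/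
def SameSector (G : SimpleGraph V) (N : ℕ) (h : ℤ → V) (x y z : V) : Prop :=
  ∃ i j : ℤ, i ≤ j ∧ j < i + N ∧ ((h i = y ∧ h j = z) ∨ (h i = z ∧ h j = y)) ∧
    ∀ k, i < k → k < j → ¬ G.Adj x (h k)

theorem SameSector.symm {N : ℕ} {h : ℤ → V} {x y z : V} (hs : SameSector G N h x y z) :
    SameSector G N h x z y := by
  obtain ⟨i, j, h1, h2, h3, h4⟩ := hs
  exact ⟨i, j, h1, h2, h3.symm, h4⟩

/-- The arc witnessing a common sector may run either way round the rim; a shift by periods makes it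
one of the two arcs between i and j. -/
theorem IsCycFn.sameSector_iff {N : ℕ} {h : ℤ → V} (hh : IsCycFn G N h) {x : V} {i j : ℤ}
    (hij : i < j) (hj : j < i + N) : SameSector G N h x (h i) (h j) ↔
      (∀ k, i < k → k < j → ¬ G.Adj x (h k)) ∨ ∀ k, j < k → k < i + N → ¬ G.Adj x (h k) := by
  constructor
  · rintro ⟨a, b, h1, h2, h3, h4⟩
    have tr : ∀ m : ℤ, ∀ k, a < k + m * N → k + m * N < b → ¬ G.Adj x (h k) := by
      intro m k k1 k2
      have := h4 _ k1 k2
      rwa [hh.per_mul] at this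
    rcases h3 with ⟨e1, e2⟩ | ⟨e1, e2⟩
    · left
      obtain ⟨m, m1, m2⟩ := hh.exists_shift i a
      have e3 := hh.eq_of_window (i := a + m * N) (j := i) (by omega) (by omega)
        (by rw [hh.per_mul, e1])
      have e4 := hh.eq_of_window (i := b + m * N) (j := j) (by omega) (by omega)
        (by rw [hh.per_mul, e2])
      intro k k1 k2
      have e5 : -m * (N : ℤ) = -(m * N) := by ring
      exact tr (-m) k (by omega) (by omega)
    · right
      obtain ⟨m, m1, m2⟩ := hh.exists_shift j a
      have e3 := hh.eq_of_window (i := a + m * N) (j := j) (by omega) (by omega)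
        (by rw [hh.per_mul, e1])
      have e4 := hh.eq_of_window (i := b + m * N) (j := i + N) (by omega) (by omega)
        (by rw [hh.per_mul, hh.per, e2])
      intro k k1 k2
      have e5 : -m * (N : ℤ) = -(m * N) := by ring
      exact tr (-m) k (by omega) (by omega)
  · rintro (h1 | h1)
    · exact ⟨i, j, hij.le, hj, Or.inl ⟨rfl, rfl⟩, h1⟩
    · exact ⟨j, i + N, hj.le, by omega, Or.inr ⟨rfl, hh.per i⟩, h1⟩

theorem SameSector.refl {N : ℕ} {h : ℤ → V} (hh : IsCycFn G N h) {x y : V}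
    (hy : y ∈ Set.range h) : SameSector G N h x y y := by
  obtain ⟨i, rfl⟩ := hy
  have := hh.three
  exact ⟨i, i, le_rfl, by omega, Or.inl ⟨rfl, rfl⟩, by omega⟩

/-- Every vertex that is neither on the wheel nor adjacent to its centre has all its neighbours on
the rim in one sector. -/
def IsProperWheel (G : SimpleGraph V) (N : ℕ) (h : ℤ → V) (x : V) : Prop :=
  ∀ v, v ∉ Set.range h → v ≠ x → ¬ G.Adj x v → ∀ y ∈ Set.range h, ∀ z ∈ Set.range h,
    G.Adj v y → G.Adj v z → SameSector G N h x y z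

/-- Every connected set avoiding the rim, the centre and the neighbours of the centre has all its
neighbours on the rim in one sector. -/
def IsSeparatedWheel (G : SimpleGraph V) (N : ℕ) (h : ℤ → V) (x : V) : Prop :=
  ∀ D : Set V, ConnOn G D → (∀ u ∈ D, u ∉ Set.range h ∧ u ≠ x ∧ ¬ G.Adj x u) →
    ∀ y ∈ Set.range h, ∀ z ∈ Set.range h, (∃ u ∈ D, G.Adj u y) → (∃ u ∈ D, G.Adj u z) →
      SameSector G N h x y z

theorem IsHoleFn.close_set (hG : G.CliqueFree 3) {N : ℕ} {h : ℤ → V} (hh : IsHoleFn G N h)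
    {i j : ℤ} (hij : i ≤ j) (hj : j < i + N - 1) {P : Set V} {a b : V} (hP : PathSet G P a b)
    (hne : i < j ∨ a ≠ b) (hd : ∀ k, i ≤ k → k ≤ j → h k ∉ P) (ha : G.Adj (h j) a)
    (hb : G.Adj b (h i)) (honly : ∀ k, i ≤ k → k ≤ j → ∀ u ∈ P, G.Adj (h k) u →
      (k = j ∧ u = a) ∨ (k = i ∧ u = b)) :
    ∃ (N' : ℕ) (h' : ℤ → V), IsHoleFn G N' h' ∧ (N' : ℤ) = j - i + 1 + P.ncard ∧
      Set.range h' = arc h i j ∪ P := by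
  obtain ⟨N', h', hh', hN', h1, h2, h3⟩ := hh.close hG hij hj hP hne hd ha hb honly
  refine ⟨N', h', hh', hN', ?_⟩
  ext v
  constructor
  · intro hv
    obtain ⟨k, k1, k2, rfl⟩ := hh'.exists_rep_of_mem i hv
    by_cases hk : k ≤ j
    · left; rw [h1 k k1 hk]; exact mem_arc k1 hk
    · right; exact h2 k (by omega) k2
  · rintro (⟨k, k1, k2, rfl⟩ | hv)
    · exact ⟨k, h1 k k1 k2⟩
    · obtain ⟨k, _, _, hk⟩ := h3 v hv
      exact ⟨k, hk⟩

/-- An arc of a hole closed up by an induced path `P` to another hole, and a connected set `T` joined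
to that hole by exactly three edges, give an induced subdivision of `K₄`. -/
theorem IsHoleFn.not_isk4Free_of_arc (hG : G.CliqueFree 3) {N : ℕ} {h : ℤ → V}
    (hh : IsHoleFn G N h) {i j : ℤ} (hij : i ≤ j) (hj : j < i + N - 1) {P : Set V} {a b : V}
    (hP : PathSet G P a b) (hne : i < j ∨ a ≠ b) (hd : ∀ k, i ≤ k → k ≤ j → h k ∉ P)
    (ha : G.Adj (h j) a) (hb : G.Adj b (h i))
    (honly : ∀ k, i ≤ k → k ≤ j → ∀ u ∈ P, G.Adj (h k) u → (k = j ∧ u = a) ∨ (k = i ∧ u = b))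
    {T : Set V} (hT : ConnOn G T) (hTa : ∀ k, i ≤ k → k ≤ j → h k ∉ T) (hTP : ∀ u ∈ P, u ∉ T)
    {c d e s t u : V} (hc : c ∈ arc h i j ∪ P) (hd' : d ∈ arc h i j ∪ P) (he : e ∈ arc h i j ∪ P)
    (hcd : c ≠ d) (hce : c ≠ e) (hde : d ≠ e) (hs : s ∈ T) (ht : t ∈ T) (hu : u ∈ T)
    (hcs : G.Adj c s) (hdt : G.Adj d t) (heu : G.Adj e u)
    (hTonly : ∀ k, i ≤ k → k ≤ j → ∀ w ∈ T, G.Adj (h k) w →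
      (h k = c ∧ w = s) ∨ (h k = d ∧ w = t) ∨ (h k = e ∧ w = u))
    (hTonly' : ∀ y ∈ P, ∀ w ∈ T, G.Adj y w →
      (y = c ∧ w = s) ∨ (y = d ∧ w = t) ∨ (y = e ∧ w = u)) : ¬ G.ISK4Free := by
  obtain ⟨N', h', hh', -, hr⟩ := hh.close_set hG hij hj hP hne hd ha hb honly
  have key : ∀ y ∈ arc h i j ∪ P, y ∉ T := by
    rintro y (⟨k, k1, k2, rfl⟩ | hy)
    · exact hTa k k1 k2
    · exact hTP y hy
  have key2 : ∀ k, h' k ∈ arc h i j ∪ P := fun k => hr ▸ ⟨k, rfl⟩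
  refine not_isk4Free_of_three_edges hG hh' hT (fun k => key _ (key2 k)) (hr ▸ hc) (hr ▸ hd')
    (hr ▸ he) hcd hce hde hs ht hu hcs hdt heu ?_
  intro k w hw hkw
  rcases key2 k with ⟨l, l1, l2, e⟩ | hk
  · rw [← e] at hkw ⊢
    exact hTonly l l1 l2 w hw hkw
  · exact hTonly' _ hk w hw hkw

end SimpleGraph

/-! ### Two nonadjacent vertices with neighbours on the same hole -/

namespace SimpleGraph

variable {V : Type*} {G : SimpleGraph V} {N : ℕ} {h : ℤ → V}

theorem IsCycFn.not_adj_succ (hG : G.CliqueFree 3) (hh : IsCycFn G N h) {x : V} {i j : ℤ}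
    (hi : G.Adj x (h i)) (hj : j = i + 1) : ¬ G.Adj x (h j) := fun hxj =>
  hG.no_triangle hi (hh.adj' hj) hxj

theorem IsCycFn.gap_lt (hG : G.CliqueFree 3) (hh : IsCycFn G N h) {v : V} {s s' : ℤ}
    (hs : G.Adj v (h s)) (hs' : G.Adj v (h s')) (hlt : s' < s + N) : s' < s + N - 1 := by
  by_contra hcon
  refine hh.not_adj_succ hG hs' (j := s + N) (by omega) ?_
  rwa [hh.per]

/-- This is the special case of `IsHoleFn.not_isk4Free_of_arc` in which the closing path is the
single vertex v; two consecutive neighbours of v bound the arc. -/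
theorem IsHoleFn.not_isk4Free_of_gap (hG : G.CliqueFree 3) (hh : IsHoleFn G N h) {v : V}
    (hv : ∀ i, h i ≠ v) {i j : ℤ} (hij : i < j) (hj : j < i + N) (hvi : G.Adj v (h i))
    (hvj : G.Adj v (h j)) (hgap : ∀ k, i < k → k < j → ¬ G.Adj v (h k))
    {T : Set V} (hT : ConnOn G T) (hTa : ∀ k, i ≤ k → k ≤ j → h k ∉ T) (hTv : v ∉ T)
    {c d e s t u : V} (hc : c ∈ arc h i j ∪ {v}) (hd' : d ∈ arc h i j ∪ {v})
    (he : e ∈ arc h i j ∪ {v}) (hcd : c ≠ d) (hce : c ≠ e) (hde : d ≠ e) (hs : s ∈ T) (ht : t ∈ T)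
    (hu : u ∈ T) (hcs : G.Adj c s) (hdt : G.Adj d t) (heu : G.Adj e u)
    (hTonly : ∀ k, i ≤ k → k ≤ j → ∀ w ∈ T, G.Adj (h k) w →
      (h k = c ∧ w = s) ∨ (h k = d ∧ w = t) ∨ (h k = e ∧ w = u))
    (hTonly' : ∀ w ∈ T, G.Adj v w →
      (v = c ∧ w = s) ∨ (v = d ∧ w = t) ∨ (v = e ∧ w = u)) : ¬ G.ISK4Free := by
  refine hh.not_isk4Free_of_arc hG hij.le (hh.gap_lt hG hvi hvj hj) (PathSet.singleton v)
    (Or.inl hij) (fun k _ _ => hv k) hvj.symm hvi ?_ hT hTa ?_ hc hd' he hcd hce hde hs ht hu hcs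
    hdt heu hTonly ?_
  · rintro k k1 k2 u rfl huk
    by_cases e1 : k = j
    · exact Or.inl ⟨e1, rfl⟩
    · by_cases e2 : k = i
      · exact Or.inr ⟨e2, rfl⟩
      · exact absurd huk.symm (hgap k (by omega) (by omega))
  · rintro u rfl; exact hTv
  · rintro y rfl; exact hTonly'

/-- Two nonadjacent vertices `x`, `v` with at least four neighbours each on a hole, such that the
part of the hole between two consecutive neighbours of `v` has exactly two neighbours of `x`, give
an induced subdivision of `K₄`. -/
theorem IsHoleFn.not_isk4Free_of_two_in_gap (hG : G.CliqueFree 3) (hfree : G.ISK4Free)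
    (hh : IsHoleFn G N h) {x v : V} (hx : IsWheelFn G N h x) (hv : IsWheelFn G N h v)
    (hxv : x ≠ v) (hnxv : ¬ G.Adj x v) {s s' : ℤ} (hlt : s < s') (hlt' : s' < s + N)
    (hs : G.Adj v (h s)) (hs' : G.Adj v (h s')) (hgap : ∀ k, s < k → k < s' → ¬ G.Adj v (h k))
    {p q : ℤ} (hp : s ≤ p) (hpq : p < q) (hq : q ≤ s') (hxp : G.Adj x (h p))
    (hxq : G.Adj x (h q)) (honly : ∀ k, s ≤ k → k ≤ s' → G.Adj x (h k) → k = p ∨ k = q) :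
    False := by
  have hs'N := hh.gap_lt hG hs hs' hlt'
  have hsN : G.Adj v (h (s + N)) := by rwa [hh.per]
  have hnv1 : ¬ G.Adj v (h (s' + 1)) := hh.not_adj_succ hG hs' rfl
  have hnvN : ¬ G.Adj v (h (s + N - 1)) := fun hcon =>
    hh.not_adj_succ hG hcon (j := s + N) (by ring) hsN
  obtain ⟨m1, m2, hm12, hm1, hm2, hvm1, hvm2⟩ : ∃ m1 m2, m1 < m2 ∧ s' < m1 ∧ m2 < s + N ∧
      G.Adj v (h m1) ∧ G.Adj v (h m2) := by
    obtain ⟨a, b, c, d, h1, h2, h3, h4, h5, ha, hb, hc, hd⟩ := hv.exists_four hG hfree s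
    have key : ∀ k, s ≤ k → G.Adj v (h k) → k = s ∨ s' ≤ k := fun k k1 hk => by
      by_contra hcon
      exact hgap k (by omega) (by omega) hk
    have := key b (by omega) hb
    exact ⟨c, d, h4, by omega, h5, hc, hd⟩
  -- an outer arc with a spoke of `x` and exactly one neighbour of `v`
  have outer : ∀ l₁ l₂ y m, s' + 1 < l₁ → l₂ < s + N - 1 → l₁ ≤ y → y ≤ l₂ → l₁ ≤ m → m ≤ l₂ →
      G.Adj x (h y) → G.Adj v (h m) → (∀ k, l₁ ≤ k → k ≤ l₂ → G.Adj v (h k) → k = m) → False := by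
    intro l₁ l₂ y m h1 h2 h3 h4 h5 h6 hy hm hmonly
    refine hh.not_isk4Free_of_gap hG hv.notMem hlt hlt' hs hs' hgap (T := {x} ∪ arc h l₁ l₂)
      ((ConnOn.singleton x).union (hh.connOn_arc l₁ l₂) rfl (mem_arc h3 h4) (Or.inr hy))
      ?_ ?_ (c := h p) (d := h q) (e := v) (s := x) (t := x) (u := h m)
      (Or.inl (mem_arc hp (by omega))) (Or.inl (mem_arc (by omega) hq)) (Or.inr rfl)
      (hh.inj _ _ hpq (by omega)) (hv.notMem _) (hv.notMem _) (Or.inl rfl) (Or.inl rfl)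
      (Or.inr (mem_arc h5 h6)) hxp.symm hxq.symm hm ?_ ?_ hfree
    · rintro k k1 k2 (hk | ⟨l, l1, l2, e⟩)
      · exact hx.notMem k hk
      · have := hh.eq_of_window (by omega) (by omega) e
        omega
    · rintro (hk | ⟨l, l1, l2, e⟩)
      · exact hxv hk.symm
      · exact hv.notMem _ e
    · rintro k k1 k2 w (rfl | ⟨l, l1, l2, rfl⟩) hadj
      · rcases honly k k1 k2 hadj.symm with rfl | rfl
        · exact Or.inl ⟨rfl, rfl⟩
        · exact Or.inr (Or.inl ⟨rfl, rfl⟩)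
      · have := hh.adj_window (by omega) (by omega) hadj
        omega
    · rintro w (rfl | ⟨l, l1, l2, rfl⟩) hadj
      · exact absurd hadj.symm hnxv
      · exact Or.inr (Or.inr ⟨rfl, by rw [hmonly l l1 l2 hadj]⟩)
  -- The gap closed up by v is a hole on which x has exactly two neighbours. A spoke of x strictly
  -- inside the rest of the rim leads along the rim to a nearest neighbour of v, and this supplies
  -- the third edge. The positions s' + 1 and s + N - 1 are excluded because they are adjacent to
  -- the gap.
  by_cases hex : ∃ y, s' + 1 < y ∧ y < s + N - 1 ∧ G.Adj x (h y)
  · obtain ⟨y, y1, y2, hy⟩ := hex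
    by_cases hfw : ∃ m, y ≤ m ∧ m < s + N ∧ G.Adj v (h m)
    · obtain ⟨m, m1, m2, hm⟩ := hfw
      obtain ⟨m', m'1, m'2, hm', hmin⟩ := exists_first (P := fun k => G.Adj v (h k)) m1 hm
      have : m' ≠ s + N - 1 := by rintro rfl; exact hnvN hm'
      refine outer y m' y m' y1 (by omega) le_rfl m'1 m'1 le_rfl hy hm' ?_
      intro k k1 k2 hk
      by_contra hne
      exact hmin k k1 (by omega) hk
    · have hm1y : m1 ≤ y := by
        by_contra hcon
        exact hfw ⟨m1, by omega, by omega, hvm1⟩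
      obtain ⟨m', m'1, m'2, hm', hmax⟩ := exists_last (P := fun k => G.Adj v (h k)) hm1y hvm1
      have : m' ≠ s' + 1 := by rintro rfl; exact hnv1 hm'
      refine outer m' y y m' (by omega) y2 m'2 le_rfl le_rfl m'2 hy hm' ?_
      intro k k1 k2 hk
      by_contra hne
      exact hmax k (by omega) k2 hk
  -- Now x has at most the two spokes in the gap and the two just outside it; as it has at least
  -- four, all of these occur.
  · obtain ⟨hx1, hxN⟩ : G.Adj x (h (s' + 1)) ∧ G.Adj x (h (s + N - 1)) := by
      obtain ⟨a, b, c, d, h1, h2, h3, h4, h5, ha, hb, hc, hd⟩ := hx.exists_four hG hfree s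
      have key : ∀ k, s ≤ k → k < s + N → G.Adj x (h k) →
          k = p ∨ k = q ∨ k = s' + 1 ∨ k = s + N - 1 := fun k k1 k2 hk => by
        by_cases hks : k ≤ s'
        · have := honly k k1 hks hk
          omega
        · by_contra hcon
          exact hex ⟨k, by omega, by omega, hk⟩
      have ka := key a (by omega) (by omega) ha
      have kb := key b (by omega) (by omega) hb
      have kc := key c (by omega) (by omega) hc
      have kd := key d (by omega) (by omega) hd
      obtain rfl : c = s' + 1 := by omega
      obtain rfl : d = s + N - 1 := by omega
      exact ⟨hc, hd⟩
    have hqs' : q < s' := by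
      have : q ≠ s' := by rintro rfl; exact hh.not_adj_succ hG hxq rfl hx1
      omega
    obtain ⟨a, a1, a2, ha, hamin⟩ := exists_first (P := fun k => G.Adj v (h k)) (a := s' + 1)
      (b := m1) (by omega) hvm1
    obtain ⟨b, b1, b2, hb, hbmax⟩ := exists_last (P := fun k => G.Adj v (h k)) (a := m2)
      (b := s + N - 1) (by omega) hvm2
    have ha' : a ≠ s' + 1 := by rintro rfl; exact hnv1 ha
    have hb' : b ≠ s + N - 1 := by rintro rfl; exact hnvN hb
    have hab : a + 1 < b := by
      have : b ≠ a + 1 := by rintro rfl; exact hh.not_adj_succ hG ha rfl hb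
      omega
    have hxonly : ∀ k, s' + 1 < k → k < s + N - 1 → ¬ G.Adj x (h k) := fun k k1 k2 hk =>
      hex ⟨k, k1, k2, hk⟩
    -- The second hole runs from h (s' + 1) to the first outer neighbour h a of v, through v to the
    -- last one h b, on to h (s + N - 1), and back through x. The arc from q to s' is joined to it
    -- by three edges, which end at x, v and h (s' + 1).
    have hP : PathSet G ({v} ∪ arc h b (s + N - 1) ∪ {x}) v x := by
      have h1 : PathSet G ({v} ∪ arc h b (s + N - 1)) v (h (s + N - 1)) := by
        refine (PathSet.singleton v).concat (hh.pathSet_arc b2 (by omega)) ?_ hb ?_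
        · rw [Set.disjoint_singleton_left]
          rintro ⟨l, l1, l2, e⟩
          exact hv.notMem l e
        · rintro u rfl w ⟨l, l1, l2, rfl⟩ hadj
          refine ⟨rfl, ?_⟩
          by_cases hl : l = b
          · rw [hl]
          · exact absurd hadj (hbmax l (by omega) l2)
      refine h1.concat (PathSet.singleton x) ?_ hxN.symm ?_
      · rw [Set.disjoint_singleton_right]
        rintro (hk | ⟨l, l1, l2, e⟩)
        · exact hxv hk
        · exact hx.notMem l e
      · rintro u (rfl | ⟨l, l1, l2, rfl⟩) w rfl hadj
        · exact absurd hadj.symm hnxv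
        · refine ⟨?_, rfl⟩
          by_cases hl : l = s + N - 1
          · rw [hl]
          · exact absurd hadj.symm (hxonly l (by omega) (by omega))
    refine hh.not_isk4Free_of_arc hG a1 (by omega) hP (Or.inl (by omega)) ?_ ha.symm hx1 ?_
      (T := arc h q s') (hh.connOn_arc q s') ?_ ?_ (c := x) (d := v) (e := h (s' + 1)) (s := h q)
      (t := h s') (u := h s') (Or.inr (Or.inr rfl)) (Or.inr (Or.inl (Or.inl rfl)))
      (Or.inl (mem_arc le_rfl a1)) hxv (hx.notMem _).symm (hv.notMem _).symm
      (mem_arc le_rfl hqs'.le) (mem_arc hqs'.le le_rfl) (mem_arc hqs'.le le_rfl) hxq hs'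
      (hh.adj s').symm ?_ ?_ hfree
    · rintro k k1 k2 ((hk | ⟨l, l1, l2, e⟩) | hk)
      · exact hv.notMem k hk
      · have := hh.eq_of_window (by omega) (by omega) e
        omega
      · exact hx.notMem k hk
    · rintro k k1 k2 u ((rfl | ⟨l, l1, l2, rfl⟩) | rfl) hadj
      · left
        refine ⟨?_, rfl⟩
        by_contra hne
        exact hamin k k1 (by omega) hadj.symm
      · have := hh.adj_window (by omega) (by omega) hadj
        omega
      · right
        refine ⟨?_, rfl⟩
        by_contra hne
        exact hxonly k (by omega) (by omega) hadj.symm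
    · rintro k k1 k2 ⟨l, l1, l2, e⟩
      have := hh.eq_of_window (by omega) (by omega) e
      omega
    · rintro u ((rfl | ⟨l, l1, l2, rfl⟩) | rfl) ⟨k, k1, k2, e⟩
      · exact hv.notMem k e
      · have := hh.eq_of_window (by omega) (by omega) e
        omega
      · exact hx.notMem k e
    · rintro k k1 k2 w ⟨l, l1, l2, rfl⟩ hadj
      have := hh.adj_window (i := l) (j := k) (by omega) (by omega) hadj.symm
      obtain rfl : k = s' + 1 := by omega
      obtain rfl : l = s' := by omega
      exact Or.inr (Or.inr ⟨rfl, rfl⟩)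
    · rintro u ((rfl | ⟨k, k1, k2, rfl⟩) | rfl) w ⟨l, l1, l2, rfl⟩ hadj
      · right; left
        refine ⟨rfl, ?_⟩
        by_cases hl : l = s'
        · rw [hl]
        · exact absurd hadj (hgap l (by omega) (by omega))
      · have := hh.adj_window (i := l) (j := k) (by omega) (by omega) hadj.symm
        omega
      · left
        refine ⟨rfl, ?_⟩
        rcases honly l (by omega) l2 hadj with rfl | rfl
        · omega
        · rfl

/-- Two nonadjacent vertices with neighbours on a hole which alternate give an induced subdivision of
`K₄`. -/
theorem IsHoleFn.not_isk4Free_of_alternating (hG : G.CliqueFree 3) (hfree : G.ISK4Free)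
    (hh : IsHoleFn G N h) {x v : V} (hx : IsWheelFn G N h x) (hv : IsWheelFn G N h v)
    (hxv : x ≠ v) (hnxv : ¬ G.Adj x v)
    (hvgap : ∀ s s' : ℤ, s < s' → s' < s + N → G.Adj v (h s) → G.Adj v (h s') →
      (∀ k, s < k → k < s' → ¬ G.Adj v (h k)) → ∀ p q, s ≤ p → p < q → q ≤ s' →
      G.Adj x (h p) → G.Adj x (h q) → False)
    (hxgap : ∀ s s' : ℤ, s < s' → s' < s + N → G.Adj x (h s) → G.Adj x (h s') →
      (∀ k, s < k → k < s' → ¬ G.Adj x (h k)) → ∀ p q, s ≤ p → p < q → q ≤ s' →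
      G.Adj v (h p) → G.Adj v (h q) → False) : False := by
  obtain ⟨b, b2, b3, b4, hb0, hb12, hb23, hb34, hb4N, hb, hb2, hb3, hb4⟩ :=
    hx.exists_four hG hfree 0
  obtain ⟨c, c1, c2, hc, hcmin⟩ := exists_first (P := fun k => G.Adj x (h k)) (a := b + 1)
    (b := b2) (by omega) hb2
  obtain ⟨a, a1, a2, ha, hamax⟩ := exists_last (P := fun k => G.Adj x (h k)) (a := b4 - N)
    (b := b - 1) (by omega) (by rw [hh.sub_per]; exact hb4)
  obtain ⟨m1, m2, m3, m4, hm0, hm12, hm23, hm34, hm4N, hm1, hm2, hm3, hm4⟩ :=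
    hv.exists_four hG hfree (b + 1)
  obtain ⟨s', s'1, s'2, hs', hs'min⟩ := exists_first (P := fun k => G.Adj v (h k)) hm0 hm1
  -- If h b were a common neighbour, the nearer of the next neighbour of v and the next spoke of x
  -- would lie, along with h b, in a single gap of the other vertex.
  by_cases hvb : G.Adj v (h b)
  · by_cases hle : s' ≤ c
    · exact hxgap b c (by omega) (by omega) hb hc (fun k k1 k2 => hcmin k (by omega) k2) b s'
        le_rfl (by omega) hle hvb hs'
    · exact hvgap b s' (by omega) (by omega) hvb hs' (fun k k1 k2 => hs'min k (by omega) k2) b c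
        le_rfl (by omega) (by omega) hb hc
  have hm4b : m4 < b + N := by
    have : m4 ≠ b + N := by rintro rfl; rw [hh.per] at hm4; exact hvb hm4
    omega
  obtain ⟨s, s1, s2, hs, hsmax⟩ := exists_last (P := fun k => G.Adj v (h k)) (a := m4 - N)
    (b := b - 1) (by omega) (by rw [hh.sub_per]; exact hm4)
  have hgap : ∀ k, s < k → k < s' → ¬ G.Adj v (h k) := by
    intro k k1 k2
    rcases lt_trichotomy k b with hk | rfl | hk
    · exact hsmax k k1 (by omega)
    · exact hvb
    · exact hs'min k (by omega) k2
  have hb_only : ∀ k, s ≤ k → k ≤ s' → G.Adj x (h k) → k = b := by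
    intro k k1 k2 hk
    by_contra hne
    rcases lt_or_gt_of_ne hne with hl | hl
    · exact hvgap s s' (by omega) (by omega) hs hs' hgap k b k1 hl (by omega) hk hb
    · exact hvgap s s' (by omega) (by omega) hs hs' hgap b k (by omega) hl k2 hb hk
  have has : a < s := by
    by_contra hcon
    have := hb_only a (by omega) (by omega) ha
    omega
  have hcs : s' < c := by
    by_contra hcon
    have := hb_only c (by omega) (by omega) hc
    omega
  have hs_only : ∀ k, a ≤ k → k ≤ b → G.Adj v (h k) → k = s := by
    intro k k1 k2 hk
    by_contra hne
    have hg : ∀ k, a < k → k < b → ¬ G.Adj x (h k) := fun k k1 k2 => hamax k k1 (by omega)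
    rcases lt_or_gt_of_ne hne with hl | hl
    · exact hxgap a b (by omega) (by omega) ha hb hg k s k1 hl (by omega) hk hs
    · exact hxgap a b (by omega) (by omega) ha hb hg s k (by omega) hl k2 hs hk
  have hs'_only : ∀ k, b ≤ k → k ≤ c → G.Adj v (h k) → k = s' := by
    intro k k1 k2 hk
    by_contra hne
    have hg : ∀ k, b < k → k < c → ¬ G.Adj x (h k) := fun k k1 k2 => hcmin k (by omega) k2
    rcases lt_or_gt_of_ne hne with hl | hl
    · exact hxgap b c (by omega) (by omega) hb hc hg k s' k1 hl (by omega) hk hs'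
    · exact hxgap b c (by omega) (by omega) hb hc hg s' k (by omega) hl k2 hs' hk
  -- Here a < s < b < s' < c, with a, b, c consecutive spokes of x and s, s' consecutive neighbours
  -- of v. The hole is the gap from s to s' closed by v; x with the rest of its two sectors at b
  -- meets it in the edges at h b, h s and h s'.
  refine hh.not_isk4Free_of_gap hG hv.notMem (i := s) (j := s') (by omega) (by omega) hs hs' hgap
    (T := {x} ∪ arc h a (s - 1) ∪ arc h (s' + 1) c)
    (((ConnOn.singleton x).union (hh.connOn_arc a (s - 1)) rfl (mem_arc le_rfl (by omega))
      (Or.inr ha)).union (hh.connOn_arc (s' + 1) c) (s := x) (Or.inl rfl)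
      (mem_arc (by omega) le_rfl) (Or.inr hc))
    ?_ ?_ (c := h b) (d := h s) (e := h s') (s := x) (t := h (s - 1)) (u := h (s' + 1))
    (Or.inl (mem_arc (by omega) (by omega))) (Or.inl (mem_arc (by omega) (by omega)))
    (Or.inl (mem_arc (by omega) (by omega))) (hh.inj _ _ (by omega) (by omega)).symm
    (hh.inj _ _ (by omega) (by omega)) (hh.inj _ _ (by omega) (by omega)) (Or.inl (Or.inl rfl))
    (Or.inl (Or.inr (mem_arc (by omega) le_rfl))) (Or.inr (mem_arc le_rfl (by omega))) hb.symm
    (hh.adj' (by ring)).symm (hh.adj s') ?_ ?_ hfree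
  · rintro k k1 k2 ((hk | ⟨l, l1, l2, e⟩) | ⟨l, l1, l2, e⟩)
    · exact hx.notMem k hk
    · have := hh.eq_of_window (by omega) (by omega) e
      omega
    · have := hh.eq_of_window (by omega) (by omega) e
      omega
  · rintro ((hk | ⟨l, l1, l2, e⟩) | ⟨l, l1, l2, e⟩)
    · exact hxv hk.symm
    · exact hv.notMem _ e
    · exact hv.notMem _ e
  · rintro k k1 k2 w ((rfl | ⟨l, l1, l2, rfl⟩) | ⟨l, l1, l2, rfl⟩) hadj
    · exact Or.inl ⟨by rw [hb_only k k1 k2 hadj.symm], rfl⟩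
    · have := hh.adj_window (i := l) (j := k) (by omega) (by omega) hadj.symm
      obtain rfl : k = s := by omega
      obtain rfl : l = k - 1 := by omega
      exact Or.inr (Or.inl ⟨rfl, rfl⟩)
    · have := hh.adj_window (by omega) (by omega) hadj
      obtain rfl : k = s' := by omega
      obtain rfl : l = k + 1 := by omega
      exact Or.inr (Or.inr ⟨rfl, rfl⟩)
  · rintro w ((rfl | ⟨l, l1, l2, rfl⟩) | ⟨l, l1, l2, rfl⟩) hadj
    · exact absurd hadj.symm hnxv
    · have := hs_only l l1 (by omega) hadj
      omega
    · have := hs'_only l (by omega) l2 hadj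
      omega

end SimpleGraph

/-! ### Minimal wheels are proper -/

namespace SimpleGraph

variable {V : Type*} {G : SimpleGraph V}

theorem exists_minimal_wheel (hex : ∃ N h x, IsWheelFn G N h x) :
    ∃ N h x, IsWheelFn G N h x ∧ (∀ N' h' x', IsWheelFn G N' h' x' → N ≤ N') ∧
      ∀ h' x', IsWheelFn G N h' x' →
        (G.neighborSet x ∩ Set.range h).ncard ≤ (G.neighborSet x' ∩ Set.range h').ncard := by
  classical
  have h1 := Nat.find_spec hex
  have hmin : ∀ N' h' x', IsWheelFn G N' h' x' → Nat.find hex ≤ N' := fun N' h' x' hw =>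
    Nat.find_min' hex ⟨h', x', hw⟩
  generalize Nat.find hex = N at h1 hmin
  have hex2 : ∃ n, ∃ h x, IsWheelFn G N h x ∧ (G.neighborSet x ∩ Set.range h).ncard = n := by
    obtain ⟨h, x, hw⟩ := h1
    exact ⟨_, h, x, hw, rfl⟩
  obtain ⟨h, x, hw, hn⟩ := Nat.find_spec hex2
  exact ⟨N, h, x, hw, hmin, fun h' x' hw' => hn ▸ Nat.find_min' hex2 ⟨h', x', hw', rfl⟩⟩

theorem IsHoleFn.exists_gap_hole (hG : G.CliqueFree 3) {N : ℕ} {h : ℤ → V} (hh : IsHoleFn G N h)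
    {v : V} (hv : ∀ i, h i ≠ v) {i j : ℤ} (hij : i < j) (hj : j < i + N) (hvi : G.Adj v (h i))
    (hvj : G.Adj v (h j)) (hgap : ∀ k, i < k → k < j → ¬ G.Adj v (h k)) :
    ∃ (N' : ℕ) (h' : ℤ → V), IsHoleFn G N' h' ∧ (N' : ℤ) = j - i + 2 ∧
      Set.range h' = arc h i j ∪ {v} := by
  obtain ⟨N', h', hh', hN', hr⟩ := hh.close_set hG hij.le (hh.gap_lt hG hvi hvj hj)
    (PathSet.singleton v) (Or.inl hij) (fun k _ _ => hv k) hvj.symm hvi (by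
      rintro k k1 k2 u rfl huk
      by_cases e1 : k = j
      · exact Or.inl ⟨e1, rfl⟩
      · by_cases e2 : k = i
        · exact Or.inr ⟨e2, rfl⟩
        · exact absurd huk.symm (hgap k (by omega) (by omega)))
  refine ⟨N', h', hh', ?_, hr⟩
  rw [Set.ncard_singleton] at hN'
  push_cast at hN'
  omega

theorem not_mem_range_of_gap {h h' : ℤ → V} {i j : ℤ} {v x : V}
    (hr : Set.range h' = arc h i j ∪ {v}) (hx : ∀ k, h k ≠ x) (hvx : v ≠ x) : ∀ k, h' k ≠ x := by
  intro k hk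
  have : h' k ∈ arc h i j ∪ {v} := hr ▸ ⟨k, rfl⟩
  rcases this with ⟨l, l1, l2, e⟩ | e
  · exact hx l (e.trans hk)
  · exact hvx (e.symm.trans hk)

/-- A wheel whose rim has minimum length and which has, subject to that, as few spokes as possible
is proper. -/
theorem exists_properWheel [Finite V] (hG : G.CliqueFree 3) (hfree : G.ISK4Free)
    (hex : ∃ N h x, IsWheelFn G N h x) :
    ∃ N h x, IsWheelFn G N h x ∧ IsProperWheel G N h x := by
  obtain ⟨N, h, x, hx, hminN, hminn⟩ := exists_minimal_wheel hex
  refine ⟨N, h, x, hx, ?_⟩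
  have hh := hx.hole
  intro v hv hvx hnxv y hy z hz hvy hvz
  by_contra hbad
  have hvn : ∀ k, h k ≠ v := fun k e => hv ⟨k, e⟩
  have hyz : y ≠ z := by rintro rfl; exact hbad (SameSector.refl hh.toIsCycFn hy)
  -- A closed gap of v holds at most two spokes of x: with three of them, the gap closed up by v
  -- would be the rim of another wheel with centre x, and this is no longer than the given one.
  have vgap : ∀ s s' : ℤ, s < s' → s' < s + N → G.Adj v (h s) → G.Adj v (h s') →
      (∀ k, s < k → k < s' → ¬ G.Adj v (h k)) → ∀ p q r, s ≤ p → p < q → q < r → r ≤ s' →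
      G.Adj x (h p) → G.Adj x (h q) → G.Adj x (h r) → False := by
    intro s s' h1 h2 hs hs' hgap p q r hp hpq hqr hr hxp hxq hxr
    obtain ⟨N', h', hh', hN', hrange⟩ := hh.exists_gap_hole hG hvn h1 h2 hs hs' hgap
    have hw' : IsWheelFn G N' h' x := by
      have hs'N := hh.gap_lt hG hs hs' h2
      refine ⟨hh', not_mem_range_of_gap hrange hx.notMem hvx, h p, h q, h r,
        hh.inj _ _ hpq (by omega), hh.inj _ _ (by omega) (by omega), hh.inj _ _ hqr (by omega),
        ⟨?_, hxp⟩, ⟨?_, hxq⟩, ⟨?_, hxr⟩⟩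
      · rw [hrange]; exact Or.inl (mem_arc hp (by omega))
      · rw [hrange]; exact Or.inl (mem_arc (by omega) (by omega))
      · rw [hrange]; exact Or.inl (mem_arc (by omega) hr)
    have hle := hminN N' h' x hw'
    have hs'N := hh.gap_lt hG hs hs' h2
    -- Minimality forces equal length, so the gap misses a single rim vertex h (s' + 1), which is
    -- not a neighbour of v. As v violates properness, that vertex must be a spoke, and the new
    -- wheel loses it, against the minimal number of spokes.
    obtain rfl : N' = N := by omega
    have hn1 : ¬ G.Adj v (h (s' + 1)) := hh.not_adj_succ hG hs' rfl
    have hM : ∀ w ∈ Set.range h, G.Adj v w → w = h s ∨ w = h s' := by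
      intro w hw hvw
      obtain ⟨k, k1, k2, rfl⟩ := hh.exists_rep_of_mem s hw
      by_cases e1 : k = s
      · left; rw [e1]
      · by_cases e2 : k = s'
        · right; rw [e2]
        · by_cases e3 : k < s'
          · exact absurd hvw (hgap k (by omega) e3)
          · obtain rfl : k = s' + 1 := by omega
            exact absurd hvw hn1
    have hbad' : ¬ SameSector G N' h x (h s) (h s') := by
      rcases hM y hy hvy with rfl | rfl <;> rcases hM z hz hvz with rfl | rfl
      · exact absurd rfl hyz
      · exact hbad
      · exact fun hS => hbad hS.symm
      · exact absurd rfl hyz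
    rw [hh.sameSector_iff h1 h2, not_or] at hbad'
    obtain ⟨-, hb2⟩ := hbad'
    push Not at hb2
    obtain ⟨k, k1, k2, hk⟩ := hb2
    obtain rfl : k = s' + 1 := by omega
    have hlt : (G.neighborSet x ∩ Set.range h').ncard < (G.neighborSet x ∩ Set.range h).ncard := by
      refine Set.ncard_lt_ncard ⟨?_, ?_⟩ (Set.toFinite _)
      · rintro w ⟨hw1, hw2⟩
        refine ⟨hw1, ?_⟩
        rw [hrange] at hw2
        rcases hw2 with hw2 | rfl
        · exact arc_subset_range _ _ hw2
        · exact absurd hw1 hnxv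
      · intro hsub
        have := (hsub ⟨hk, ⟨_, rfl⟩⟩).2
        rw [hrange] at this
        rcases this with ⟨l, l1, l2, e⟩ | e
        · have := hh.eq_of_window (by omega) (by omega) e
          omega
        · exact hvn _ e
    exact absurd (hminn h' x hw') (by omega)
  by_cases h3 : ∃ w ∈ Set.range h, G.Adj v w ∧ w ≠ y ∧ w ≠ z
  · obtain ⟨w, hw, hvw, hwy, hwz⟩ := h3
    have hvW : IsWheelFn G N h v := ⟨hh, hvn, y, z, w, hyz, hwy.symm, hwz.symm, ⟨hy, hvy⟩,
      ⟨hz, hvz⟩, ⟨hw, hvw⟩⟩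
    -- The roles are exchanged, but now length alone decides: x has at least four spokes, so a gap
    -- of x closed up by x is strictly shorter than the rim.
    have xgap : ∀ s s' : ℤ, s < s' → s' < s + N → G.Adj x (h s) → G.Adj x (h s') →
        (∀ k, s < k → k < s' → ¬ G.Adj x (h k)) → ∀ p q r, s ≤ p → p < q → q < r → r ≤ s' →
        G.Adj v (h p) → G.Adj v (h q) → G.Adj v (h r) → False := by
      intro s s' h1 h2 hs hs' hgap p q r hp hpq hqr hr hvp hvq hvr
      have hs'N := hh.gap_lt hG hs hs' h2
      obtain ⟨N', h', hh', hN', hrange⟩ := hh.exists_gap_hole hG hx.notMem h1 h2 hs hs' hgap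
      have hw' : IsWheelFn G N' h' v := by
        refine ⟨hh', not_mem_range_of_gap hrange hvn hvx.symm, h p, h q, h r,
          hh.inj _ _ hpq (by omega), hh.inj _ _ (by omega) (by omega), hh.inj _ _ hqr (by omega),
          ⟨?_, hvp⟩, ⟨?_, hvq⟩, ⟨?_, hvr⟩⟩
        · rw [hrange]; exact Or.inl (mem_arc hp (by omega))
        · rw [hrange]; exact Or.inl (mem_arc (by omega) (by omega))
        · rw [hrange]; exact Or.inl (mem_arc (by omega) hr)
      have hle := hminN N' h' v hw'
      obtain ⟨a, b, c, d, g1, g2, g3, g4, g5, ha, hb, hc, hd⟩ := hx.exists_four hG hfree s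
      have key : ∀ k, s ≤ k → G.Adj x (h k) → k = s ∨ s' ≤ k := fun k k1 hk => by
        by_contra hcon
        exact hgap k (by omega) (by omega) hk
      have := key b (by omega) hb
      omega
    refine hh.not_isk4Free_of_alternating hG hfree hx hvW hvx.symm hnxv ?_ ?_
    · intro s s' h1 h2 hs hs' hgap p q hp hpq hq hxp hxq
      refine hh.not_isk4Free_of_two_in_gap hG hfree hx hvW hvx.symm hnxv h1 h2 hs hs' hgap hp hpq
        hq hxp hxq ?_
      intro k k1 k2 hk
      by_contra hne
      have T := vgap s s' h1 h2 hs hs' hgap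
      rcases lt_or_ge k p with c1 | c1
      · exact T k p q k1 c1 hpq hq hk hxp hxq
      · rcases lt_or_ge k q with c2 | c2
        · exact T p k q hp (by omega) c2 hq hxp hk hxq
        · exact T p q k hp hpq (by omega) k2 hxp hxq hk
    · intro s s' h1 h2 hs hs' hgap p q hp hpq hq hxp hxq
      refine hh.not_isk4Free_of_two_in_gap hG hfree hvW hx hvx (fun e => hnxv e.symm) h1 h2 hs hs'
        hgap hp hpq hq hxp hxq ?_
      intro k k1 k2 hk
      by_contra hne
      have T := xgap s s' h1 h2 hs hs' hgap
      rcases lt_or_ge k p with c1 | c1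
      · exact T k p q k1 c1 hpq hq hk hxp hxq
      · rcases lt_or_ge k q with c2 | c2
        · exact T p k q hp (by omega) c2 hq hxp hk hxq
        · exact T p q k hp hpq (by omega) k2 hxp hxq hk
  -- Now y and z are the only rim neighbours of v. By `vgap` each of the two arcs between them has
  -- at most two spokes, so four spokes place a, b on the first arc and c strictly beyond s'. The
  -- set {x} with the arc from s' + 1 to c then meets the hole closed up by v in the edges at h a, h
  -- b and h s'.
  · obtain ⟨s, rfl⟩ := hy
    obtain ⟨s', s1, s2, rfl⟩ := hh.exists_rep_of_mem s hz
    have hlt : s < s' := by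
      have : s' ≠ s := by rintro rfl; exact hyz rfl
      omega
    have hM : ∀ k, s ≤ k → k < s + N → G.Adj v (h k) → k = s ∨ k = s' := by
      intro k k1 k2 hk
      by_contra hne
      push Not at hne
      refine h3 ⟨h k, ⟨k, rfl⟩, hk, fun e => hne.1 ?_, fun e => hne.2 ?_⟩
      · exact hh.eq_of_window (by omega) (by omega) e
      · exact hh.eq_of_window (by omega) (by omega) e
    have hsN : G.Adj v (h (s + N)) := by rwa [hh.per]
    have g1 : ∀ k, s < k → k < s' → ¬ G.Adj v (h k) := fun k k1 k2 hk => by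
      have := hM k (by omega) (by omega) hk
      omega
    have g2 : ∀ k, s' < k → k < s + N → ¬ G.Adj v (h k) := fun k k1 k2 hk => by
      have := hM k (by omega) (by omega) hk
      omega
    have A1 := vgap s s' hlt s2 hvy hvz g1
    have A2 := vgap s' (s + N) s2 (by omega) hvz hsN g2
    obtain ⟨a, b, c, d, h1, h2, h3, h4, h5, ha, hb, hc, hd⟩ := hx.exists_four hG hfree s
    have c1 : s' < c := by
      by_contra hcon
      exact A1 a b c h1 h2 h3 (by omega) ha hb hc
    have c2 : b < s' := by
      by_contra hcon
      exact A2 b c d (by omega) h3 h4 (by omega) hb hc hd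
    refine hh.not_isk4Free_of_gap hG hvn hlt s2 hvy hvz g1 (T := {x} ∪ arc h (s' + 1) c)
      ((ConnOn.singleton x).union (hh.connOn_arc _ _) rfl (mem_arc (by omega) le_rfl)
        (Or.inr hc)) ?_ ?_ (c := h a) (d := h b) (e := h s') (s := x) (t := x) (u := h (s' + 1))
      (Or.inl (mem_arc h1 (by omega))) (Or.inl (mem_arc (by omega) (by omega)))
      (Or.inl (mem_arc (by omega) (by omega))) (hh.inj _ _ (by omega) (by omega))
      (hh.inj _ _ (by omega) (by omega)) (hh.inj _ _ (by omega) (by omega)) (Or.inl rfl)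
      (Or.inl rfl) (Or.inr (mem_arc le_rfl (by omega))) ha.symm hb.symm (hh.adj s') ?_ ?_ hfree
    · rintro k k1 k2 (hk | ⟨l, l1, l2, e⟩)
      · exact hx.notMem k hk
      · have := hh.eq_of_window (by omega) (by omega) e
        omega
    · rintro (hk | ⟨l, l1, l2, e⟩)
      · exact hvx hk
      · exact hvn _ e
    · rintro k k1 k2 w (rfl | ⟨l, l1, l2, rfl⟩) hadj
      · by_cases e1 : k = a
        · exact Or.inl ⟨by rw [e1], rfl⟩
        · by_cases e2 : k = b
          · exact Or.inr (Or.inl ⟨by rw [e2], rfl⟩)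
          · exfalso
            rcases lt_or_ge k a with c3 | c3
            · exact A1 k a b k1 c3 h2 (by omega) hadj.symm ha hb
            · rcases lt_or_ge k b with c4 | c4
              · exact A1 a k b h1 (by omega) c4 (by omega) ha hadj.symm hb
              · exact A1 a b k h1 h2 (by omega) k2 ha hb hadj.symm
      · have := hh.adj_window (by omega) (by omega) hadj
        obtain rfl : k = s' := by omega
        obtain rfl : l = k + 1 := by omega
        exact Or.inr (Or.inr ⟨rfl, rfl⟩)
    · rintro w (rfl | ⟨l, l1, l2, rfl⟩) hadj
      · exact absurd hadj.symm hnxv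
      · exact absurd hadj (g2 l (by omega) (by omega))

end SimpleGraph

/-! ### Detours produce proper wheels with fewer spokes -/

namespace SimpleGraph

variable {V : Type*} {G : SimpleGraph V}

/-- The induced path `P` closes the arc of the rim from `i` to `j` to a hole which avoids the closed
neighbourhood of the centre `x` outside the rim, and which has at least three, but not all, of the
spokes. -/
structure IsDetour (G : SimpleGraph V) (N : ℕ) (h : ℤ → V) (x : V) (i j : ℤ) (P : Set V)
    (a b : V) : Prop where
  path : PathSet G P a b
  off : ∀ u ∈ P, u ∉ Set.range h ∧ u ≠ x ∧ ¬ G.Adj x u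
  adj_left : G.Adj (h j) a
  adj_right : G.Adj b (h i)
  only : ∀ k, i ≤ k → k ≤ j → ∀ u ∈ P, G.Adj (h k) u → (k = j ∧ u = a) ∨ (k = i ∧ u = b)
  three : ∃ p q r, i ≤ p ∧ p < q ∧ q < r ∧ r ≤ j ∧ G.Adj x (h p) ∧ G.Adj x (h q) ∧ G.Adj x (h r)
  missing : ∃ m, j < m ∧ m < i + N ∧ G.Adj x (h m)

theorem IsProperWheel.exists_smaller_of_isDetour [Finite V] (hG : G.CliqueFree 3)
    (hfree : G.ISK4Free) {N : ℕ} {h : ℤ → V} {x : V} (hx : IsWheelFn G N h x)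
    (hprop : IsProperWheel G N h x) (β : ℕ) : ∀ (i j : ℤ) (P : Set V) (a b : V),
    IsDetour G N h x i j P a b → (G.neighborSet x ∩ arc h i j).ncard = β →
    ∃ (N' : ℕ) (h' : ℤ → V), IsWheelFn G N' h' x ∧ IsProperWheel G N' h' x ∧
      (G.neighborSet x ∩ Set.range h').ncard < (G.neighborSet x ∩ Set.range h).ncard := by
  have hh := hx.hole
  induction β using Nat.strong_induction_on with
  | _ β ih =>
  intro i j P a b hdet hβ
  -- The induction is on the number of spokes on the arc: it applies to a detour over a subarc that
  -- loses some spoke h m.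
  have hih : ∀ (i' j' : ℤ) (P' : Set V) (a' b' : V) (m : ℤ), IsDetour G N h x i' j' P' a' b' →
      i ≤ i' → j' ≤ j → i ≤ m → m ≤ j → G.Adj x (h m) → ¬ (i' ≤ m ∧ m ≤ j') →
      ∃ (N' : ℕ) (h' : ℤ → V), IsWheelFn G N' h' x ∧ IsProperWheel G N' h' x ∧
      (G.neighborSet x ∩ Set.range h').ncard < (G.neighborSet x ∩ Set.range h).ncard := by
    intro i' j' P' a' b' m hdet' h1 h2 h3 h4 hm h5
    obtain ⟨m', m1, m2, hm'⟩ := hdet.missing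
    refine ih _ ?_ i' j' P' a' b' hdet' rfl
    rw [← hβ]
    refine Set.ncard_lt_ncard ⟨?_, ?_⟩ (Set.toFinite _)
    · rintro w ⟨hw, k, k1, k2, rfl⟩
      exact ⟨hw, mem_arc (by omega) (by omega)⟩
    · intro hsub
      obtain ⟨k, k1, k2, e⟩ := (hsub ⟨hm, mem_arc h3 h4⟩).2
      have := hh.eq_of_window (by omega) (by omega) e
      omega
  obtain ⟨hP, hoff, hja, hbi, honly, ⟨p0, q0, r0, hp0, hpq0, hqr0, hr0, hxp0, hxq0, hxr0⟩,
    m, m1, m2, hxm⟩ := hdet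
  obtain ⟨N', h', hh', hN', e1, e2, e3⟩ := hh.close hG (i := i) (j := j) (by omega) (by omega) hP
    (Or.inl (by omega)) (fun k _ _ hk => (hoff _ hk).1 ⟨k, rfl⟩) hja hbi honly
  have hmem : ∀ k, h' k ∈ arc h i j ∪ P := by
    intro k
    obtain ⟨l, l1, l2, e⟩ := hh'.exists_rep i k
    rw [← e]
    by_cases hl : l ≤ j
    · left; rw [e1 l l1 hl]; exact mem_arc l1 hl
    · right; exact e2 l (by omega) l2
  have hxP : ∀ k, j < k → k < i + N' → ¬ G.Adj x (h' k) := fun k k1 k2 => (hoff _ (e2 k k1 k2)).2.2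
  have hw' : IsWheelFn G N' h' x := by
    refine ⟨hh', ?_, h p0, h q0, h r0, hh.inj _ _ hpq0 (by omega), hh.inj _ _ (by omega) (by omega),
      hh.inj _ _ hqr0 (by omega), ⟨⟨p0, e1 _ (by omega) (by omega)⟩, hxp0⟩,
      ⟨⟨q0, e1 _ (by omega) (by omega)⟩, hxq0⟩, ⟨⟨r0, e1 _ (by omega) (by omega)⟩, hxr0⟩⟩
    intro k hk
    rcases hmem k with ⟨l, _, _, e⟩ | hkP
    · exact hx.notMem l (e.trans hk)
    · exact (hoff _ hkP).2.1 hk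
  by_cases hprop' : IsProperWheel G N' h' x
  · refine ⟨N', h', hw', hprop', Set.ncard_lt_ncard ⟨?_, ?_⟩ (Set.toFinite _)⟩
    · rintro w ⟨hw, k, rfl⟩
      refine ⟨hw, ?_⟩
      rcases hmem k with hk | hk
      · exact arc_subset_range _ _ hk
      · exact absurd hw (hoff _ hk).2.2
    · intro hsub
      obtain ⟨k, hk⟩ := (hsub ⟨hxm, ⟨m, rfl⟩⟩).2
      rcases hmem k with ⟨l, l1, l2, e⟩ | hkP
      · have := hh.eq_of_window (i := l) (j := m) (by omega) (by omega) (e.trans hk)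
        omega
      · exact (hoff _ hkP).1 ⟨m, hk.symm⟩
  obtain ⟨v, hv, hvx, hnxv, y, hy, z, hz, hvy, hvz, hbad⟩ : ∃ v, v ∉ Set.range h' ∧ v ≠ x ∧
      ¬ G.Adj x v ∧ ∃ y ∈ Set.range h', ∃ z ∈ Set.range h', G.Adj v y ∧ G.Adj v z ∧
        ¬ SameSector G N' h' x y z := by
    by_contra hcon
    refine hprop' fun v h1 h2 h3 y hy z hz h4 h5 => ?_
    by_contra h6
    exact hcon ⟨v, h1, h2, h3, y, hy, z, hz, h4, h5, h6⟩
  have hi' : h' (i + N') = h i := by rw [hh'.per, e1 i le_rfl (by omega)]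
  -- P carries no spoke, so P together with the ends of the arc lies in one closed sector of the new
  -- wheel.
  have S1 : ∀ k l : ℤ, j ≤ k → l ≤ i + N' → k ≤ l → SameSector G N' h' x (h' k) (h' l) := by
    intro k l h1 h2 h3
    exact ⟨k, l, h3, by omega, Or.inl ⟨rfl, rfl⟩, fun t t1 t2 => hxP t (by omega) (by omega)⟩
  have S1' : ∀ k l : ℤ, j ≤ k → k ≤ i + N' → j ≤ l → l ≤ i + N' →
      SameSector G N' h' x (h' k) (h' l) := by
    intro k l h1 h2 h3 h4
    rcases le_total k l with hkl | hkl
    · exact S1 k l h1 h4 hkl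
    · exact (S1 l k h3 h2 hkl).symm
  -- A vertex of the old rim off the arc can be adjacent, on the new rim, only to P and to the ends
  -- of the arc. By `S1'` these share a sector, so it does not violate properness.
  have hvH : v ∉ Set.range h := by
    intro hvH
    obtain ⟨t, t1, t2, rfl⟩ := hh.exists_rep_of_mem i hvH
    have htj : j < t := by
      by_contra hcon
      exact hv ⟨t, e1 t t1 (by omega)⟩
    have key : ∀ w ∈ Set.range h', G.Adj (h t) w → ∃ k, j ≤ k ∧ k ≤ i + N' ∧ h' k = w := by
      rintro w hw hadj
      obtain ⟨k, k1, k2, rfl⟩ := hh'.exists_rep_of_mem i hw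
      by_cases hk : k ≤ j
      · rw [e1 k k1 hk] at hadj
        have := hh.adj_window (i := k) (j := t) (by omega) (by omega) hadj.symm
        by_cases hkj : k = j
        · exact ⟨k, by omega, by omega, rfl⟩
        · obtain rfl : k = i := by omega
          exact ⟨k + N', by omega, by omega, hh'.per k⟩
      · exact ⟨k, by omega, by omega, rfl⟩
    obtain ⟨k, k1, k2, rfl⟩ := key y hy hvy
    obtain ⟨l, l1, l2, rfl⟩ := key z hz hvz
    exact hbad (S1' k l k1 k2 l1 l2)
  -- Properness of the old wheel puts the neighbours of v on the arc in one sector. The missing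
  -- spoke h m rules out that the common sector runs round the outside.
  have S2 : ∀ k l, i ≤ k → k < l → l ≤ j → G.Adj v (h k) → G.Adj v (h l) →
      ∀ t, k < t → t < l → ¬ G.Adj x (h t) := by
    intro k l k1 kl l1 hvk hvl
    have := hprop v hvH hvx hnxv _ ⟨k, rfl⟩ _ ⟨l, rfl⟩ hvk hvl
    rw [hh.sameSector_iff kl (by omega)] at this
    rcases this with hS | hS
    · exact hS
    · exact absurd hxm (hS m (by omega) (by omega))
  -- one of the neighbours of `v` lies on the arc, the other one on `P`
  obtain ⟨k, l, k1, k2, l1, l2, hvk, hvl, hbad⟩ : ∃ k l : ℤ, i ≤ k ∧ k ≤ j ∧ j < l ∧ l < i + N' ∧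
      G.Adj v (h k) ∧ G.Adj v (h' l) ∧ ¬ SameSector G N' h' x (h' k) (h' l) := by
    obtain ⟨k, k1, k2, rfl⟩ := hh'.exists_rep_of_mem i hy
    obtain ⟨l, l1, l2, rfl⟩ := hh'.exists_rep_of_mem i hz
    by_cases hk : k ≤ j
    · have ek := e1 k k1 hk
      by_cases hl : l ≤ j
      · have el := e1 l l1 hl
        exfalso
        rcases lt_trichotomy k l with hkl | rfl | hkl
        · refine hbad ⟨k, l, hkl.le, by omega, Or.inl ⟨rfl, rfl⟩, fun t t1 t2 => ?_⟩
          rw [e1 t (by omega) (by omega)]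
          exact S2 k l k1 hkl hl (ek ▸ hvy) (el ▸ hvz) t t1 t2
        · exact hbad (SameSector.refl hh'.toIsCycFn hy)
        · refine hbad ⟨l, k, hkl.le, by omega, Or.inr ⟨rfl, rfl⟩, fun t t1 t2 => ?_⟩
          rw [e1 t (by omega) (by omega)]
          exact S2 l k l1 hkl hk (el ▸ hvz) (ek ▸ hvy) t t1 t2
      · exact ⟨k, l, k1, hk, by omega, l2, ek ▸ hvy, hvz, hbad⟩
    · by_cases hl : l ≤ j
      · have el := e1 l l1 hl
        exact ⟨l, k, l1, hl, by omega, k2, el ▸ hvz, hvy, fun hS => hbad hS.symm⟩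
      · exact absurd (S1' k l (by omega) (by omega) (by omega) (by omega)) hbad
  -- there are spokes of the arc on both sides of `k`
  obtain ⟨b₁, b11, b12, hxb₁⟩ : ∃ b₁, i ≤ b₁ ∧ b₁ < k ∧ G.Adj x (h b₁) := by
    by_contra hcon
    refine hbad ⟨l, k + N', by omega, by omega, Or.inr ⟨rfl, hh'.per k⟩, fun t t1 t2 ht => ?_⟩
    by_cases ht' : t < i + N'
    · exact hxP t (by omega) ht' ht
    · rw [← hh'.sub_per, e1 (t - N') (by omega) (by omega)] at ht
      exact hcon ⟨t - N', by omega, by omega, ht⟩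
  obtain ⟨b₄, b41, b42, hxb₄⟩ : ∃ b₄, k < b₄ ∧ b₄ ≤ j ∧ G.Adj x (h b₄) := by
    by_contra hcon
    refine hbad ⟨k, l, by omega, by omega, Or.inl ⟨rfl, rfl⟩, fun t t1 t2 ht => ?_⟩
    by_cases ht' : t ≤ j
    · rw [e1 t (by omega) ht'] at ht
      exact hcon ⟨t, t1, ht', ht⟩
    · exact hxP t (by omega) (by omega) ht
  obtain ⟨y₁, y11, y12, hvy₁, y₁min⟩ := exists_first (P := fun t => G.Adj v (h t)) k1 hvk
  obtain ⟨y₂, y21, y22, hvy₂, y₂max⟩ := exists_last (P := fun t => G.Adj v (h t)) k2 hvk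
  have hvP : v ∉ P := fun hvP => hv (by
    obtain ⟨t, _, _, e⟩ := e3 v hvP
    exact ⟨t, e⟩)
  have hlP := e2 l l1 l2
  obtain ⟨Q₁, hQ₁P, hQ₁, haQ₁⟩ := hP.attach hvP ⟨_, hlP, hvl⟩
  obtain ⟨Q₂, hQ₂P, hQ₂, haQ₂⟩ := hP.symm.attach hvP ⟨_, hlP, hvl⟩
  have hoff1 : ∀ Q ⊆ P, ∀ u ∈ Q ∪ {v}, u ∉ Set.range h ∧ u ≠ x ∧ ¬ G.Adj x u := by
    rintro Q hQ u (hu | rfl)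
    · exact hoff u (hQ hu)
    · exact ⟨hvH, hvx, hnxv⟩
  have honly1 : ∀ t, y₂ ≤ t → t ≤ j → ∀ u ∈ Q₁ ∪ {v}, G.Adj (h t) u →
      (t = j ∧ u = a) ∨ (t = y₂ ∧ u = v) := by
    rintro t t1 t2 u (hu | rfl) hadj
    · rcases honly t (by omega) t2 u (hQ₁P hu) hadj with hc | hc
      · exact Or.inl hc
      · omega
    · right
      refine ⟨?_, rfl⟩
      by_contra hne
      exact y₂max t (by omega) t2 hadj.symm
  have honly2 : ∀ t, i ≤ t → t ≤ y₁ → ∀ u ∈ Q₂ ∪ {v}, G.Adj (h t) u →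
      (t = y₁ ∧ u = v) ∨ (t = i ∧ u = b) := by
    rintro t t1 t2 u (hu | rfl) hadj
    · rcases honly t t1 (by omega) u (hQ₂P hu) hadj with hc | hc
      · omega
      · exact Or.inr hc
    · left
      refine ⟨?_, rfl⟩
      by_contra hne
      exact y₁min t t1 (by omega) hadj.symm
  -- Rerouting through v at its last (here) or first (`C2`) neighbour on the arc gives a detour over
  -- a shorter arc, which loses the spoke b₁ or b₄ on the other side of k.
  by_cases C1 : ∃ p q r, y₂ ≤ p ∧ p < q ∧ q < r ∧ r ≤ j ∧ G.Adj x (h p) ∧ G.Adj x (h q) ∧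
      G.Adj x (h r)
  · exact hih y₂ j (Q₁ ∪ {v}) a v b₁ ⟨hQ₁, hoff1 _ hQ₁P, hja, hvy₂, honly1, C1,
      ⟨m, m1, by omega, hxm⟩⟩ (by omega) le_rfl (by omega) (by omega) hxb₁ (by omega)
  by_cases C2 : ∃ p q r, i ≤ p ∧ p < q ∧ q < r ∧ r ≤ y₁ ∧ G.Adj x (h p) ∧ G.Adj x (h q) ∧
      G.Adj x (h r)
  · exact hih i y₁ (Q₂ ∪ {v}) v b b₄ ⟨hQ₂.symm, hoff1 _ hQ₂P, hvy₁.symm, hbi, honly2, C2,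
      ⟨m, by omega, m2, hxm⟩⟩ le_rfl (by omega) (by omega) (by omega) hxb₄ (by omega)
  exfalso
  have C3 : ∀ t, y₁ < t → t < y₂ → ¬ G.Adj x (h t) := fun t t1 t2 =>
    S2 y₁ y₂ y11 (by omega) y22 hvy₁ hvy₂ t t1 t2
  obtain ⟨p, q, r, s, hp, hpq, hqr, hrs, hsN, hxp, hxq, hxr, hxs⟩ :
      ∃ p q r s, i ≤ p ∧ p < q ∧ q < r ∧ r < s ∧ s ≤ j ∧ G.Adj x (h p) ∧ G.Adj x (h q) ∧
      G.Adj x (h r) ∧ G.Adj x (h s) := by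
    obtain ⟨p, q, r, s, hp, hpq, hqr, hrs, hsN, hxp, hxq, hxr, hxs⟩ := hw'.exists_four hG hfree i
    have hsj : s ≤ j := by
      by_contra hcon
      exact hxP s (by omega) hsN hxs
    rw [e1 _ (by omega) (by omega)] at hxp hxq hxr hxs
    exact ⟨p, q, r, s, hp, hpq, hqr, hrs, hsj, hxp, hxq, hxr, hxs⟩
  have hry₁ : y₁ < r := by
    by_contra hcon
    exact C2 ⟨p, q, r, hp, hpq, hqr, by omega, hxp, hxq, hxr⟩
  have hry₂ : y₂ ≤ r := by
    by_contra hcon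
    exact C3 r hry₁ (by omega) hxr
  have hqy₂ : q < y₂ := by
    by_contra hcon
    exact C1 ⟨q, r, s, by omega, hqr, hrs, hsN, hxq, hxr, hxs⟩
  have hqy₁ : q ≤ y₁ := by
    by_contra hcon
    exact C3 q (by omega) hqy₂ hxq
  have hrs_only : ∀ t, y₂ ≤ t → t ≤ j → G.Adj x (h t) → t = r ∨ t = s := by
    intro t t1 t2 ht
    by_contra hne
    rcases lt_or_ge t r with c1 | c1
    · exact C1 ⟨t, r, s, t1, c1, hrs, hsN, ht, hxr, hxs⟩
    · rcases lt_or_ge t s with c2 | c2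
      · exact C1 ⟨r, t, s, hry₂, by omega, c2, hsN, hxr, ht, hxs⟩
      · exact C1 ⟨r, s, t, hry₂, hrs, by omega, t2, hxr, hxs, ht⟩
  have hQx : ∀ u ∈ Q₁ ∪ {v}, ¬ G.Adj u x := fun u hu hadj => (hoff1 _ hQ₁P u hu).2.2 hadj.symm
  have hQh : ∀ u ∈ Q₁ ∪ {v}, ∀ t, h t ≠ u := fun u hu t e => (hoff1 _ hQ₁P u hu).1 ⟨t, e⟩
  -- Four spokes p < q < r < s on the arc must split as q ≤ y₁ and y₂ ≤ r. The arc from y₂ to j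
  -- closed up by Q₁ and v is a hole on which x sees only h r and h s. The third edge comes from the
  -- arc from q towards y₁: it ends at v if y₁ < y₂, and at h y₁ if y₁ = y₂, when the arc has to
  -- stop at y₁ - 1 to stay off the hole.
  rcases Int.lt_or_le y₁ y₂ with hlt | hle
  · refine hh.not_isk4Free_of_arc hG (i := y₂) (j := j) (by omega) (by omega) hQ₁
      (Or.inl (by omega)) (fun t _ _ ht => hQh _ ht t rfl) hja hvy₂ honly1
      (T := {x} ∪ arc h q y₁) ((ConnOn.singleton x).union (hh.connOn_arc _ _) rfl
      (mem_arc le_rfl hqy₁) (Or.inr hxq)) ?_ ?_ (c := h r) (d := h s) (e := v) (s := x) (t := x)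
      (u := h y₁) (Or.inl (mem_arc (by omega) (by omega))) (Or.inl (mem_arc (by omega) (by omega)))
      (Or.inr (Or.inr rfl)) (hh.inj _ _ hrs (by omega)) (hQh v (Or.inr rfl) _)
      (hQh v (Or.inr rfl) _) (Or.inl rfl) (Or.inl rfl) (Or.inr (mem_arc hqy₁ le_rfl)) hxr.symm
      hxs.symm hvy₁ ?_ ?_ hfree
    · rintro t t1 t2 (ht | ⟨t', t3, t4, e⟩)
      · exact hx.notMem t ht
      · have := hh.eq_of_window (by omega) (by omega) e
        omega
    · rintro u hu (rfl | ⟨t', t3, t4, e⟩)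
      · exact (hoff1 _ hQ₁P u hu).2.1 rfl
      · exact hQh u hu t' e
    · rintro t t1 t2 w (rfl | ⟨t', t3, t4, rfl⟩) hadj
      · rcases hrs_only t t1 t2 hadj.symm with rfl | rfl
        · exact Or.inl ⟨rfl, rfl⟩
        · exact Or.inr (Or.inl ⟨rfl, rfl⟩)
      · have := hh.adj_window (i := t') (j := t) (by omega) (by omega) hadj.symm
        obtain rfl : t = y₂ := by omega
        obtain rfl : t' = y₁ := by omega
        exact absurd hvy₂ (hh.not_adj_succ hG hvy₁ (by omega))
    · rintro u hu w (rfl | ⟨t', t3, t4, rfl⟩) hadj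
      · exact absurd hadj (hQx u hu)
      · rcases hu with hu | rfl
        · have := honly t' (by omega) (by omega) u (hQ₁P hu) hadj.symm
          omega
        · right; right
          refine ⟨rfl, ?_⟩
          by_cases e : t' = y₁
          · rw [e]
          · exact absurd hadj (y₁min t' (by omega) (by omega))
  · obtain rfl : y₁ = y₂ := by omega
    refine hh.not_isk4Free_of_arc hG (i := y₁) (j := j) (by omega) (by omega) hQ₁
      (Or.inl (by omega)) (fun t _ _ ht => hQh _ ht t rfl) hja hvy₂ honly1
      (T := {x} ∪ arc h q (y₁ - 1)) ((ConnOn.singleton x).union (hh.connOn_arc _ _) rfl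
      (mem_arc le_rfl (by omega)) (Or.inr hxq)) ?_ ?_ (c := h r) (d := h s) (e := h y₁) (s := x)
      (t := x) (u := h (y₁ - 1)) (Or.inl (mem_arc (by omega) (by omega)))
      (Or.inl (mem_arc (by omega) (by omega))) (Or.inl (mem_arc (by omega) (by omega)))
      (hh.inj _ _ hrs (by omega)) (hh.inj _ _ (by omega) (by omega)).symm
      (hh.inj _ _ (by omega) (by omega)).symm (Or.inl rfl) (Or.inl rfl)
      (Or.inr (mem_arc (by omega) le_rfl)) hxr.symm hxs.symm (hh.adj' (by ring)).symm ?_ ?_ hfree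
    · rintro t t1 t2 (ht | ⟨t', t3, t4, e⟩)
      · exact hx.notMem t ht
      · have := hh.eq_of_window (by omega) (by omega) e
        omega
    · rintro u hu (rfl | ⟨t', t3, t4, e⟩)
      · exact (hoff1 _ hQ₁P u hu).2.1 rfl
      · exact hQh u hu t' e
    · rintro t t1 t2 w (rfl | ⟨t', t3, t4, rfl⟩) hadj
      · rcases hrs_only t t1 t2 hadj.symm with rfl | rfl
        · exact Or.inl ⟨rfl, rfl⟩
        · exact Or.inr (Or.inl ⟨rfl, rfl⟩)
      · have := hh.adj_window (i := t') (j := t) (by omega) (by omega) hadj.symm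
        obtain rfl : t = y₁ := by omega
        obtain rfl : t' = t - 1 := by omega
        exact Or.inr (Or.inr ⟨rfl, rfl⟩)
    · rintro u hu w (rfl | ⟨t', t3, t4, rfl⟩) hadj
      · exact absurd hadj (hQx u hu)
      · rcases hu with hu | rfl
        · have := honly t' (by omega) (by omega) u (hQ₁P hu) hadj.symm
          omega
        · exact absurd hadj (y₁min t' (by omega) (by omega))

end SimpleGraph

/-! ### Proper wheels without detours are separated -/

namespace SimpleGraph

variable {V : Type*} {G : SimpleGraph V}

theorem PathSet.exists_tail {S : Set V} {a b : V} (hS : PathSet G S a b) (hab : a ≠ b) :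
    ∃ a', PathSet G (S \ {a}) a' b := by
  obtain ⟨n, p, hp, rfl, rfl, hmem⟩ := hS
  have hn : 1 ≤ n := by
    by_contra hcon
    obtain rfl : n = 0 := by omega
    exact hab rfl
  refine ⟨p 1, ?_⟩
  convert hp.pathSet_sub hn le_rfl using 1
  ext v
  simp only [Set.mem_sdiff, hmem, Set.mem_singleton_iff]
  constructor
  · rintro ⟨⟨i, hi, rfl⟩, hne⟩
    refine ⟨i, ?_, hi, rfl⟩
    by_contra hcon
    obtain rfl : i = 0 := by omega
    exact hne rfl
  · rintro ⟨i, h1, h2, rfl⟩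
    exact ⟨⟨i, h2, rfl⟩, (hp.inj 0 i (by omega) h2).symm⟩

variable {N : ℕ} {h : ℤ → V}

theorem IsWheelFn.exists_next (hG : G.CliqueFree 3) (hfree : G.ISK4Free) {x : V}
    (hx : IsWheelFn G N h x) (k : ℤ) :
    ∃ b, k < b ∧ b < k + N ∧ G.Adj x (h b) ∧ ∀ t, k < t → t < b → ¬ G.Adj x (h t) := by
  obtain ⟨p, q, r, s, h1, h2, h3, h4, h5, hp, hq, hr, hs⟩ := hx.exists_four hG hfree k
  obtain ⟨b, b1, b2, hb, hmin⟩ := exists_first (P := fun t => G.Adj x (h t)) (a := k + 1) (b := q)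
    (by omega) hq
  exact ⟨b, by omega, by omega, hb, fun t t1 t2 => hmin t (by omega) t2⟩

theorem IsWheelFn.exists_prev (hG : G.CliqueFree 3) (hfree : G.ISK4Free) {x : V}
    (hx : IsWheelFn G N h x) (k : ℤ) :
    ∃ a, a < k ∧ k < a + N ∧ G.Adj x (h a) ∧ ∀ t, a < t → t < k → ¬ G.Adj x (h t) := by
  obtain ⟨p, q, r, s, h1, h2, h3, h4, h5, hp, hq, hr, hs⟩ := hx.exists_four hG hfree (k - N)
  obtain ⟨a, a1, a2, ha, hmax⟩ := exists_last (P := fun t => G.Adj x (h t)) (a := q) (b := k - 1)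
    (by omega) hq
  exact ⟨a, by omega, by omega, ha, fun t t1 t2 => hmax t t1 (by omega)⟩

/-- In a wheel with at least four spokes, vertices which are pairwise in a common sector are all in
one sector. -/
theorem IsWheelFn.exists_sector (hG : G.CliqueFree 3) (hfree : G.ISK4Free) {x : V}
    (hx : IsWheelFn G N h x) {E : Set V} (hE : E ⊆ Set.range h) (hne : E.Nonempty)
    (hpair : ∀ y ∈ E, ∀ z ∈ E, SameSector G N h x y z) :
    ∃ a b : ℤ, a < b ∧ b < a + N ∧ G.Adj x (h a) ∧ G.Adj x (h b) ∧
      (∀ t, a < t → t < b → ¬ G.Adj x (h t)) ∧ ∀ e ∈ E, ∃ k, a ≤ k ∧ k ≤ b ∧ h k = e := by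
  have hh := hx.hole
  have h4 := hh.four
  -- A vertex of E that is not a spoke is interior to exactly one sector, which then contains all of
  -- E.
  by_cases hns : ∃ e ∈ E, ¬ G.Adj x e
  · obtain ⟨e, heE, hxe⟩ := hns
    obtain ⟨k, rfl⟩ := hE heE
    obtain ⟨a, a1, a2, ha, hamax⟩ := hx.exists_prev hG hfree k
    obtain ⟨b, b1, b2, hb, hbmin⟩ := hx.exists_next hG hfree k
    have hno : ∀ t, a < t → t < b → ¬ G.Adj x (h t) := by
      intro t t1 t2
      rcases lt_trichotomy t k with ht | rfl | ht
      · exact hamax t t1 ht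
      · exact hxe
      · exact hbmin t ht t2
    refine ⟨a, b, by omega, ?_, ha, hb, hno, ?_⟩
    · obtain ⟨p, q, r, s, h1, h2, h3, h4, h5, hp, hq, hr, hs⟩ := hx.exists_four hG hfree (a + 1)
      by_contra hcon
      exact hno p (by omega) (by omega) hp
    · intro e' he'
      obtain ⟨l, l1, l2, rfl⟩ := hh.exists_rep_of_mem k (hE he')
      by_cases hlk : l = k
      · exact ⟨l, by omega, by omega, rfl⟩
      have hS := hpair _ heE _ he'
      rw [hh.sameSector_iff (by omega) l2] at hS
      rcases hS with hS | hS
      · refine ⟨l, by omega, ?_, rfl⟩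
        by_contra hcon
        exact hS b (by omega) (by omega) hb
      · refine ⟨l - N, ?_, by omega, hh.sub_per l⟩
        by_contra hcon
        exact hS (a + N) (by omega) (by omega) (by rwa [hh.per])
  · push Not at hns
    obtain ⟨e, heE⟩ := hne
    obtain ⟨k, rfl⟩ := hE heE
    have hxk := hns _ heE
    by_cases hsing : ∀ e' ∈ E, e' = h k
    · obtain ⟨b, b1, b2, hb, hbmin⟩ := hx.exists_next hG hfree k
      exact ⟨k, b, b1, b2, hxk, hb, hbmin, fun e' he' => ⟨k, le_rfl, b1.le, (hsing e' he').symm⟩⟩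
    · push Not at hsing
      obtain ⟨e', he', hne'⟩ := hsing
      obtain ⟨a, b, hab, hbN, haE, hbE, hno⟩ : ∃ a b : ℤ, a < b ∧ b < a + N ∧ h a ∈ E ∧ h b ∈ E ∧
          ∀ t, a < t → t < b → ¬ G.Adj x (h t) := by
        obtain ⟨l, l1, l2, rfl⟩ := hh.exists_rep_of_mem k (hE he')
        have hlk : l ≠ k := by rintro rfl; exact hne' rfl
        have hS := hpair _ heE _ he'
        rw [hh.sameSector_iff (by omega) l2] at hS
        rcases hS with hS | hS
        · exact ⟨k, l, by omega, l2, heE, he', hS⟩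
        · exact ⟨l, k + N, l2, by omega, he', by rwa [hh.per], hS⟩
      refine ⟨a, b, hab, hbN, hns _ haE, hns _ hbE, hno, ?_⟩
      intro e'' he''
      obtain ⟨l, l1, l2, rfl⟩ := hh.exists_rep_of_mem a (hE he'')
      by_cases hlb : l ≤ b
      · exact ⟨l, l1, hlb, rfl⟩
      exfalso
      have hS1 := hpair _ haE _ he''
      have hS2 := hpair _ hbE _ he''
      rw [hh.sameSector_iff (by omega) l2] at hS1
      rw [hh.sameSector_iff (by omega) (by omega)] at hS2
      have hS1' := hS1.resolve_left fun hc => hc b hab (by omega) (hns _ hbE)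
      have hS2' := hS2.resolve_right fun hc => hc (a + N) l2 (by omega) (by
        rw [hh.per]; exact hns _ haE)
      -- Three spokes that pairwise bound a sector would be all the spokes, whereas there are at
      -- least four.
      obtain ⟨p, q, r, s, h1, h2, h3, h4, h5, hp, hq, hr, hs⟩ := hx.exists_four hG hfree a
      have key : ∀ t, a ≤ t → t < a + N → G.Adj x (h t) → t = a ∨ t = b ∨ t = l := by
        intro t t1 t2 ht
        by_contra hcon
        push Not at hcon
        rcases lt_or_ge t b with c1 | c1
        · exact hno t (by omega) c1 ht
        · rcases lt_or_ge t l with c2 | c2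
          · exact hS2' t (by omega) c2 ht
          · exact hS1' t (by omega) t2 ht
      have := key p (by omega) (by omega) hp
      have := key q (by omega) (by omega) hq
      have := key r (by omega) (by omega) hr
      have := key s (by omega) (by omega) hs
      omega

/-- D leads from the sector [a, b] to the sector [c, d]. Each of the two arcs of the rim between the
attachments of its ends is closed up by D to a hole; a detour is excluded, so an arc with three
spokes cannot close up without missing none. This pins down the spokes on the outer hole, to which x
and a piece of the sector [a, b] are then joined by three edges. The bound d < a + N means that the
two sectors share at most the spoke h b = h c. -/
theorem IsWheelFn.false_of_bad_path (hG : G.CliqueFree 3) (hfree : G.ISK4Free) {x : V}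
    (hx : IsWheelFn G N h x) (hnd : ∀ i j P a b, ¬ IsDetour G N h x i j P a b) {D : Set V}
    {p q : V} (hD : PathSet G D p q) (hpq : p ≠ q)
    (hoff : ∀ u ∈ D, u ∉ Set.range h ∧ u ≠ x ∧ ¬ G.Adj x u) {a b c d : ℤ} (hab : a < b)
    (hbc : b ≤ c) (hcd : c < d) (hda : d < a + N) (ha : G.Adj x (h a)) (hb : G.Adj x (h b))
    (hc : G.Adj x (h c)) (hd : G.Adj x (h d)) (hnab : ∀ t, a < t → t < b → ¬ G.Adj x (h t))
    (hncd : ∀ t, c < t → t < d → ¬ G.Adj x (h t))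
    (hp : ∀ u ∈ D, u ≠ q → ∀ w ∈ Set.range h, G.Adj u w → ∃ k, a ≤ k ∧ k ≤ b ∧ h k = w)
    (hq : ∀ u ∈ D, u ≠ p → ∀ w ∈ Set.range h, G.Adj u w → ∃ k, c ≤ k ∧ k ≤ d ∧ h k = w)
    {y z : V} (hy : y ∈ Set.range h) (hz : z ∈ Set.range h) (hpy : G.Adj p y) (hqz : G.Adj q z)
    (hbad : ¬ SameSector G N h x y z) : False := by
  have hh := hx.hole
  have hpD := hD.left_mem
  have hqD := hD.right_mem
  obtain ⟨y, y1, y2, rfl⟩ := hp p hpD hpq y hy hpy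
  obtain ⟨z, z1, z2, rfl⟩ := hq q hqD hpq.symm z hz hqz
  have hyc : y ≠ c := by
    rintro rfl
    exact hbad ⟨y, z, z1, by omega, Or.inl ⟨rfl, rfl⟩, fun t t1 t2 => hncd t t1 (by omega)⟩
  have hzb : z ≠ b := by
    rintro rfl
    exact hbad ⟨y, z, y2, by omega, Or.inl ⟨rfl, rfl⟩, fun t t1 t2 => hnab t (by omega) t2⟩
  rw [hh.sameSector_iff (by omega) (by omega), not_or] at hbad
  obtain ⟨hbad1, hbad2⟩ := hbad
  push Not at hbad1 hbad2
  obtain ⟨m, m1, m2, hm⟩ := hbad1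
  obtain ⟨m', m'1, m'2, hm'⟩ := hbad2
  obtain ⟨u₀, u01, u02, hu₀, u₀min⟩ := exists_first (P := fun t => G.Adj p (h t)) y1 hpy
  obtain ⟨u₁, u11, u12, hu₁, u₁max⟩ := exists_last (P := fun t => G.Adj p (h t)) y2 hpy
  obtain ⟨w₀, w01, w02, hw₀, w₀min⟩ := exists_first (P := fun t => G.Adj q (h t)) z1 hqz
  obtain ⟨w₁, w11, w12, hw₁, w₁max⟩ := exists_last (P := fun t => G.Adj q (h t)) z2 hqz
  have posp : ∀ k, G.Adj p (h k) → ∃ k', u₀ ≤ k' ∧ k' ≤ u₁ ∧ h k' = h k := by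
    intro k hk
    obtain ⟨k', k1, k2, e⟩ := hp p hpD hpq _ ⟨k, rfl⟩ hk
    refine ⟨k', ?_, ?_, e⟩
    · by_contra hcon
      exact u₀min k' k1 (by omega) (by rwa [e])
    · by_contra hcon
      exact u₁max k' (by omega) k2 (by rwa [e])
  have posq : ∀ k, G.Adj q (h k) → ∃ k', w₀ ≤ k' ∧ k' ≤ w₁ ∧ h k' = h k := by
    intro k hk
    obtain ⟨k', k1, k2, e⟩ := hq q hqD hpq.symm _ ⟨k, rfl⟩ hk
    refine ⟨k', ?_, ?_, e⟩
    · by_contra hcon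
      exact w₀min k' k1 (by omega) (by rwa [e])
    · by_contra hcon
      exact w₁max k' (by omega) k2 (by rwa [e])
  -- An inner vertex of D obeys both restrictions, so its rim neighbours lie in both sectors.
  have posi : ∀ u ∈ D, u ≠ p → u ≠ q → ∀ k, G.Adj u (h k) → b = c ∧ h b = h k := by
    intro u hu hup huq k hk
    obtain ⟨k1, k11, k12, e1⟩ := hp u hu huq _ ⟨k, rfl⟩ hk
    obtain ⟨k2, k21, k22, e2⟩ := hq u hu hup _ ⟨k, rfl⟩ hk
    have := hh.eq_of_window (by omega) (by omega) (e1.trans e2.symm)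
    obtain rfl : k1 = b := by omega
    exact ⟨by omega, e1⟩
  have hperp : ∀ k, G.Adj x (h k) → G.Adj x (h (k + N)) := fun k hk => by rwa [hh.per]
  have onlyB : ∀ k, w₁ ≤ k → k ≤ u₀ + N → ∀ u ∈ D, G.Adj (h k) u →
      (k = u₀ + N ∧ u = p) ∨ (k = w₁ ∧ u = q) := by
    intro k k1 k2 u hu hadj
    by_cases hup : u = p
    · subst hup
      obtain ⟨k', k'1, k'2, e⟩ := posp k hadj.symm
      left
      refine ⟨?_, rfl⟩
      by_contra hne
      have := hh.eq_of_window (by omega) (by omega) e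
      omega
    · by_cases huq : u = q
      · subst huq
        obtain ⟨k', k'1, k'2, e⟩ := posq k hadj.symm
        have := hh.eq_of_window (by omega) (by omega) e
        exact Or.inr ⟨by omega, rfl⟩
      · obtain ⟨e1, e2⟩ := posi u hu hup huq k hadj.symm
        have := hh.eq_of_window (by omega) (by omega) e2
        omega
  have threeB : ∀ p q r, w₁ ≤ p → p < q → q < r → r ≤ u₀ + N → G.Adj x (h p) → G.Adj x (h q) →
      G.Adj x (h r) → False := by
    intro p' q' r' h1 h2 h3 h4 hp' hq' hr'
    refine hnd w₁ (u₀ + N) D p q ⟨hD, hoff, ?_, hw₁, onlyB, ⟨p', q', r', h1, h2, h3, h4, hp', hq',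
      hr'⟩, ⟨m + N, by omega, by omega, hperp m hm⟩⟩
    rw [hh.per]; exact hu₀.symm
  -- The outer arc, from the last neighbour of q to the first neighbour of p, contains the spokes d
  -- and a + N. A third one would make D a detour.
  have onlyd : ∀ k, w₁ ≤ k → k ≤ u₀ + N → G.Adj x (h k) → k = d ∨ k = a + N := by
    intro k k1 k2 hk
    by_contra hne
    rcases lt_or_ge k d with c1 | c1
    · exact threeB k d (a + N) k1 c1 hda (by omega) hk hd (hperp a ha)
    · rcases lt_or_ge k (a + N) with c2 | c2
      · exact threeB d k (a + N) (by omega) (by omega) c2 (by omega) hd hk (hperp a ha)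
      · exact threeB d (a + N) k (by omega) hda (by omega) k2 hd (hperp a ha) hk
  -- If the sectors shared a spoke, then a, b and d would be the only spokes. Consequently inner
  -- vertices of D have no neighbours on the rim.
  have hbc' : b < c := by
    by_contra hcon
    obtain rfl : b = c := by omega
    obtain ⟨s1, s2, s3, s4, h1, h2, h3, h4, h5, hs1, hs2, hs3, hs4⟩ := hx.exists_four hG hfree a
    have key : ∀ t, a ≤ t → t < a + N → G.Adj x (h t) → t = a ∨ t = b ∨ t = d := by
      intro t t1 t2 ht
      by_contra hne
      push Not at hne
      rcases lt_or_ge t b with c1 | c1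
      · exact hnab t (by omega) c1 ht
      · rcases lt_or_ge t d with c2 | c2
        · exact hncd t (by omega) c2 ht
        · have := onlyd t (by omega) (by omega) ht
          omega
    have := key s1 (by omega) (by omega) hs1
    have := key s2 (by omega) (by omega) hs2
    have := key s3 (by omega) (by omega) hs3
    have := key s4 (by omega) (by omega) hs4
    omega
  have onlyA : ∀ k, u₁ ≤ k → k ≤ w₀ → ∀ u ∈ D, G.Adj (h k) u →
      (k = w₀ ∧ u = q) ∨ (k = u₁ ∧ u = p) := by
    intro k k1 k2 u hu hadj
    by_cases hup : u = p
    · subst hup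
      obtain ⟨k', k'1, k'2, e⟩ := posp k hadj.symm
      have := hh.eq_of_window (by omega) (by omega) e
      exact Or.inr ⟨by omega, rfl⟩
    · by_cases huq : u = q
      · subst huq
        obtain ⟨k', k'1, k'2, e⟩ := posq k hadj.symm
        have := hh.eq_of_window (by omega) (by omega) e
        exact Or.inl ⟨by omega, rfl⟩
      · have := (posi u hu hup huq k hadj.symm).1
        omega
  -- Otherwise a, b, c are three spokes on the inner arc and D is a detour over it. Likewise u₀ = b
  -- would put d, a + N and b + N on the outer arc.
  have hau₁ : a < u₁ := by
    by_contra hcon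
    exact hnd u₁ w₀ D q p ⟨hD.symm, hoff, hw₀.symm, hu₁, onlyA, ⟨a, b, c, by omega, hab, hbc', w01,
      ha, hb, hc⟩, ⟨m', by omega, by omega, hm'⟩⟩
  have hu₀b : u₀ < b := by
    by_contra hcon
    exact threeB d (a + N) (b + N) (by omega) hda (by omega) (by omega) hd (hperp a ha) (hperp b hb)
  have hcb : c ≠ b + 1 := fun e => hh.not_adj_succ hG hb e hc
  have hDx : ∀ u ∈ D, ¬ G.Adj u x := fun u hu hadj => (hoff u hu).2.2 hadj.symm
  have hDh : ∀ u ∈ D, ∀ t, h t ≠ u := fun u hu t e => (hoff u hu).1 ⟨t, e⟩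
  have hu₀N : G.Adj (h (u₀ + N)) p := by rw [hh.per]; exact hu₀.symm
  -- On the outer arc closed up by D, x sees exactly h d and h a. The arc of the first sector ending
  -- at b, together with x, supplies the third edge: it is at p if p has two rim neighbours, and
  -- otherwise it is the rim edge following u₀.
  rcases Int.lt_or_le u₀ u₁ with hlt | hle
  · refine hh.not_isk4Free_of_arc hG (i := w₁) (j := u₀ + N) (by omega) (by omega) hD
      (Or.inl (by omega)) (fun t _ _ ht => hDh _ ht t rfl) hu₀N hw₁ onlyB
      (T := {x} ∪ arc h u₁ b) ((ConnOn.singleton x).union (hh.connOn_arc _ _) rfl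
      (mem_arc (by omega) le_rfl) (Or.inr hb)) ?_ ?_ (c := h d) (d := h (a + N)) (e := p) (s := x)
      (t := x) (u := h u₁) (Or.inl (mem_arc (by omega) (by omega)))
      (Or.inl (mem_arc (by omega) (by omega))) (Or.inr hpD) (hh.inj _ _ hda (by omega))
      (hDh p hpD _) (hDh p hpD _) (Or.inl rfl) (Or.inl rfl) (Or.inr (mem_arc le_rfl (by omega)))
      hd.symm (hperp a ha).symm hu₁ ?_ ?_ hfree
    · rintro t t1 t2 (ht | ⟨t', t3, t4, e⟩)
      · exact hx.notMem t ht
      · have := hh.eq_of_window (by omega) (by omega) e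
        omega
    · rintro u hu (rfl | ⟨t', t3, t4, e⟩)
      · exact (hoff u hu).2.1 rfl
      · exact hDh u hu t' e
    · rintro t t1 t2 w (rfl | ⟨t', t3, t4, rfl⟩) hadj
      · rcases onlyd t t1 t2 hadj.symm with rfl | rfl
        · exact Or.inl ⟨rfl, rfl⟩
        · exact Or.inr (Or.inl ⟨rfl, rfl⟩)
      · have := hh.adj_window (i := t') (j := t) (by omega) (by omega) hadj.symm
        obtain rfl : u₁ = u₀ + 1 := by omega
        exact absurd hu₁ (hh.not_adj_succ hG hu₀ rfl)
    · rintro u hu w (rfl | ⟨t', t3, t4, rfl⟩) hadj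
      · exact absurd hadj (hDx u hu)
      · rcases onlyA t' t3 (by omega) u hu hadj.symm with e | e
        · omega
        · exact Or.inr (Or.inr ⟨e.2, by rw [e.1]⟩)
  · obtain rfl : u₀ = u₁ := by omega
    refine hh.not_isk4Free_of_arc hG (i := w₁) (j := u₀ + N) (by omega) (by omega) hD
      (Or.inl (by omega)) (fun t _ _ ht => hDh _ ht t rfl) hu₀N hw₁ onlyB
      (T := {x} ∪ arc h (u₀ + 1) b) ((ConnOn.singleton x).union (hh.connOn_arc _ _) rfl
      (mem_arc (by omega) le_rfl) (Or.inr hb)) ?_ ?_ (c := h d) (d := h (a + N)) (e := h (u₀ + N))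
      (s := x) (t := x) (u := h (u₀ + 1)) (Or.inl (mem_arc (by omega) (by omega)))
      (Or.inl (mem_arc (by omega) (by omega))) (Or.inl (mem_arc (by omega) (by omega)))
      (hh.inj _ _ hda (by omega)) (hh.inj _ _ (by omega) (by omega))
      (hh.inj _ _ (by omega) (by omega)) (Or.inl rfl) (Or.inl rfl)
      (Or.inr (mem_arc le_rfl (by omega)))
      hd.symm (hperp a ha).symm (by rw [hh.per]; exact hh.adj u₀) ?_ ?_ hfree
    · rintro t t1 t2 (ht | ⟨t', t3, t4, e⟩)
      · exact hx.notMem t ht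
      · have := hh.eq_of_window (by omega) (by omega) e
        omega
    · rintro u hu (rfl | ⟨t', t3, t4, e⟩)
      · exact (hoff u hu).2.1 rfl
      · exact hDh u hu t' e
    · rintro t t1 t2 w (rfl | ⟨t', t3, t4, rfl⟩) hadj
      · rcases onlyd t t1 t2 hadj.symm with rfl | rfl
        · exact Or.inl ⟨rfl, rfl⟩
        · exact Or.inr (Or.inl ⟨rfl, rfl⟩)
      · have := hh.adj_window (i := t') (j := t) (by omega) (by omega) hadj.symm
        obtain rfl : t = u₀ + N := by omega
        obtain rfl : t' = u₀ + 1 := by omega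
        exact Or.inr (Or.inr ⟨rfl, rfl⟩)
    · rintro u hu w (rfl | ⟨t', t3, t4, rfl⟩) hadj
      · exact absurd hadj (hDx u hu)
      · rcases onlyA t' (by omega) (by omega) u hu hadj.symm with e | e
        · omega
        · omega

/-- A minimal connected set joining two sectors is an induced path whose inner vertices see the rim
in one sector together with either end. -/
theorem exists_minimal_bad_path [Finite V] {x : V} (hprop : IsProperWheel G N h x)
    (hns : ¬ IsSeparatedWheel G N h x) :
    ∃ (D : Set V) (p q y z : V), PathSet G D p q ∧ p ≠ q ∧
      (∀ u ∈ D, u ∉ Set.range h ∧ u ≠ x ∧ ¬ G.Adj x u) ∧ y ∈ Set.range h ∧ z ∈ Set.range h ∧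
      G.Adj p y ∧ G.Adj q z ∧ ¬ SameSector G N h x y z ∧
      (∀ y' ∈ Set.range h, ∀ z' ∈ Set.range h, (∃ u ∈ D \ {p}, G.Adj u y') →
        (∃ u ∈ D \ {p}, G.Adj u z') → SameSector G N h x y' z') ∧
      ∀ y' ∈ Set.range h, ∀ z' ∈ Set.range h, (∃ u ∈ D \ {q}, G.Adj u y') →
        (∃ u ∈ D \ {q}, G.Adj u z') → SameSector G N h x y' z' := by
  classical
  have hex : ∃ n, ∃ D : Set V, D.ncard = n ∧ ConnOn G D ∧
      (∀ u ∈ D, u ∉ Set.range h ∧ u ≠ x ∧ ¬ G.Adj x u) ∧ ∃ y ∈ Set.range h, ∃ z ∈ Set.range h,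
      (∃ u ∈ D, G.Adj u y) ∧ (∃ u ∈ D, G.Adj u z) ∧ ¬ SameSector G N h x y z := by
    by_contra hcon
    refine hns fun D hD hoff y hy z hz hDy hDz => ?_
    by_contra hbad
    exact hcon ⟨_, D, rfl, hD, hoff, y, hy, z, hz, hDy, hDz, hbad⟩
  obtain ⟨D, hDn, hD, hoff, y, hy, z, hz, ⟨p, hpD, hpy⟩, ⟨q, hqD, hqz⟩, hbad⟩ := Nat.find_spec hex
  have hmin : ∀ D' : Set V, D' ⊆ D → ConnOn G D' → ∀ y ∈ Set.range h, ∀ z ∈ Set.range h,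
      (∃ u ∈ D', G.Adj u y) → (∃ u ∈ D', G.Adj u z) → ¬ SameSector G N h x y z → D' = D := by
    intro D' hsub hD' y hy z hz hDy hDz hbad
    refine Set.eq_of_subset_of_ncard_le hsub ?_ (Set.toFinite _)
    rw [hDn]
    exact Nat.find_min' hex ⟨D', rfl, hD', fun u hu => hoff u (hsub hu), y, hy, z, hz, hDy, hDz,
      hbad⟩
  -- A shortest path in D between the two attachments is itself a bad connected set, so by
  -- minimality it is all of D. Deleting an end of the path keeps it connected, hence what remains
  -- is not bad.
  obtain ⟨S, hSD, hS⟩ := hD.exists_pathSet hpD hqD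
  have hSeq := hmin S hSD hS.connOn y hy z hz ⟨p, hS.left_mem, hpy⟩ ⟨q, hS.right_mem, hqz⟩ hbad
  rw [hSeq] at hS
  have hpq : p ≠ q := by
    rintro rfl
    exact hbad (hprop p (hoff p hpD).1 (hoff p hpD).2.1 (hoff p hpD).2.2 y hy z hz hpy hqz)
  have hsmall : ∀ r ∈ D, ConnOn G (D \ {r}) → ∀ y' ∈ Set.range h, ∀ z' ∈ Set.range h,
      (∃ u ∈ D \ {r}, G.Adj u y') → (∃ u ∈ D \ {r}, G.Adj u z') → SameSector G N h x y' z' := by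
    intro r hr hconn y' hy' z' hz' h1 h2
    by_contra hb
    have := hmin _ Set.sdiff_subset hconn y' hy' z' hz' h1 h2 hb
    exact (this.ge hr : r ∈ D \ {r}).2 rfl
  obtain ⟨p', hp'⟩ := hS.exists_tail hpq
  obtain ⟨q', hq'⟩ := hS.symm.exists_tail hpq.symm
  exact ⟨D, p, q, y, z, hS, hpq, hoff, hy, hz, hpy, hqz, hbad, hsmall p hpD hp'.connOn,
    hsmall q hqD hq'.connOn⟩

theorem IsProperWheel.isSeparatedWheel [Finite V] (hG : G.CliqueFree 3) (hfree : G.ISK4Free)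
    {x : V} (hx : IsWheelFn G N h x) (hprop : IsProperWheel G N h x)
    (hnd : ∀ i j P a b, ¬ IsDetour G N h x i j P a b) : IsSeparatedWheel G N h x := by
  by_contra hns
  have hh := hx.hole
  obtain ⟨D, p, q, y, z, hD, hpq, hoff, hy, hz, hpy, hqz, hbad, hDp, hDq⟩ :=
    exists_minimal_bad_path hprop hns
  have sector : ∀ r y, (∃ u ∈ D \ {r}, G.Adj u y) → y ∈ Set.range h →
      (∀ y' ∈ Set.range h, ∀ z' ∈ Set.range h, (∃ u ∈ D \ {r}, G.Adj u y') →
        (∃ u ∈ D \ {r}, G.Adj u z') → SameSector G N h x y' z') →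
      ∃ a b : ℤ, a < b ∧ b < a + N ∧ G.Adj x (h a) ∧ G.Adj x (h b) ∧
      (∀ t, a < t → t < b → ¬ G.Adj x (h t)) ∧
      ∀ u ∈ D, u ≠ r → ∀ w ∈ Set.range h, G.Adj u w → ∃ k, a ≤ k ∧ k ≤ b ∧ h k = w := by
    intro r y hyr hy hr
    obtain ⟨a, b, h1, h2, h3, h4, h5, h6⟩ := hx.exists_sector hG hfree
      (E := {w | w ∈ Set.range h ∧ ∃ u ∈ D \ {r}, G.Adj u w}) (fun w hw => hw.1) ⟨y, hy, hyr⟩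
      (fun y hy z hz => hr y hy.1 z hz.1 hy.2 hz.2)
    exact ⟨a, b, h1, h2, h3, h4, h5, fun u hu hur w hw hadj => h6 w ⟨hw, u, ⟨hu, hur⟩, hadj⟩⟩
  obtain ⟨a, b, hab, hbN, ha, hb, hnab, hp⟩ := sector q y ⟨p, ⟨hD.left_mem, hpq⟩, hpy⟩ hy hDq
  obtain ⟨c, d, hcd, hdN, hc, hd, hncd, hq⟩ := sector p z ⟨q, ⟨hD.right_mem, hpq.symm⟩, hqz⟩ hz hDp
  -- The second sector is moved by periods so that it starts in the window of the first.
  obtain ⟨m, m1, m2⟩ := hh.exists_shift a c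
  have hc' : G.Adj x (h (c + m * N)) := by rwa [hh.per_mul]
  have hd' : G.Adj x (h (d + m * N)) := by rwa [hh.per_mul]
  have hncd' : ∀ t, c + m * N < t → t < d + m * N → ¬ G.Adj x (h t) := by
    intro t t1 t2 ht
    rw [← hh.per_mul t (-m), neg_mul] at ht
    exact hncd _ (by omega) (by omega) ht
  have hq' : ∀ u ∈ D, u ≠ p → ∀ w ∈ Set.range h, G.Adj u w →
      ∃ k, c + m * N ≤ k ∧ k ≤ d + m * N ∧ h k = w := by
    intro u hu hup w hw hadj
    obtain ⟨k, k1, k2, e⟩ := hq u hu hup w hw hadj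
    exact ⟨k + m * N, by omega, by omega, by rw [hh.per_mul, e]⟩
  have hcd' : c + m * N < d + m * N := by omega
  have hdN' : d + m * N < c + m * N + N := by omega
  clear hc hd hncd hq hcd hdN
  generalize c + m * N = c at *
  generalize d + m * N = d at *
  have hperx : ∀ k, G.Adj x (h k) → G.Adj x (h (k + N)) := fun k hk => by rwa [hh.per]
  by_cases hca : c = a
  · subst hca
    have hbd : b = d := by
      rcases lt_trichotomy b d with hl | hl | hl
      · exact absurd hb (hncd' b hab hl)
      · exact hl
      · exact absurd hd' (hnab d hcd' hl)
    subst hbd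
    obtain ⟨k, k1, k2, rfl⟩ := hp p hD.left_mem hpq y hy hpy
    obtain ⟨l, l1, l2, rfl⟩ := hq' q hD.right_mem hpq.symm z hz hqz
    rcases le_total k l with hkl | hkl
    · exact hbad ⟨k, l, hkl, by omega, Or.inl ⟨rfl, rfl⟩,
        fun t t1 t2 => hnab t (by omega) (by omega)⟩
    · exact hbad ⟨l, k, hkl, by omega, Or.inr ⟨rfl, rfl⟩,
        fun t t1 t2 => hnab t (by omega) (by omega)⟩
  have hbc : b ≤ c := by
    by_contra hcon
    exact hnab c (by omega) (by omega) hc'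
  have hda : d ≤ a + N := by
    by_contra hcon
    exact hncd' (a + N) (by omega) (by omega) (hperx a ha)
  rcases hda.lt_or_eq with hlt | heq
  · exact hx.false_of_bad_path hG hfree hnd hD hpq hoff hab hbc hcd' hlt ha hb hc' hd' hnab hncd' hp
      hq' hy hz hpy hqz hbad
  -- The sectors share the spoke h a = h d. Exchanging p with q and the first sector with the second
  -- brings the shared spoke into the position that `IsWheelFn.false_of_bad_path` allows.
  · have hbc' : b < c := by
      by_contra hcon
      obtain rfl : b = c := by omega
      obtain ⟨s1, s2, s3, s4, h1, h2, h3, h4, h5, hs1, hs2, hs3, hs4⟩ := hx.exists_four hG hfree a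
      have key : ∀ t, a ≤ t → t < a + N → G.Adj x (h t) → t = a ∨ t = b := by
        intro t t1 t2 ht
        by_contra hne
        push Not at hne
        rcases lt_or_ge t b with c1 | c1
        · exact hnab t (by omega) c1 ht
        · exact hncd' t (by omega) (by omega) ht
      have := key s1 (by omega) (by omega) hs1
      have := key s2 (by omega) (by omega) hs2
      have := key s3 (by omega) (by omega) hs3
      omega
    refine hx.false_of_bad_path hG hfree hnd hD.symm hpq.symm hoff (a := c) (b := d) (c := a + N)
      (d := b + N) hcd' hda (by omega) (by omega) hc' hd' (hperx a ha) (hperx b hb) hncd' ?_ hq' ?_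
      hz hy hqz hpy (fun hS => hbad hS.symm)
    · intro t t1 t2 ht
      rw [← hh.sub_per] at ht
      exact hnab (t - N) (by omega) (by omega) ht
    · intro u hu huq w hw hadj
      obtain ⟨k, k1, k2, e⟩ := hp u hu huq w hw hadj
      exact ⟨k + N, by omega, by omega, by rw [hh.per, e]⟩

/-- Descent on the number of spokes at a fixed centre: a detour gives a proper wheel with fewer
spokes, and without detours the wheel is separated. The rim need not remain shortest, since only
properness is used. -/
theorem exists_separatedWheel [Finite V] (hG : G.CliqueFree 3) (hfree : G.ISK4Free)
    (hex : ∃ N h x, IsWheelFn G N h x) :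
    ∃ N h x, IsWheelFn G N h x ∧ IsSeparatedWheel G N h x := by
  obtain ⟨N, h, x, hx, hprop⟩ := exists_properWheel hG hfree hex
  induction hn : (G.neighborSet x ∩ Set.range h).ncard using Nat.strong_induction_on
    generalizing N h with
  | _ n ih =>
  by_cases hdet : ∃ i j P a b, IsDetour G N h x i j P a b
  · obtain ⟨i, j, P, a, b, hdet⟩ := hdet
    obtain ⟨N', h', hx', hprop', hlt⟩ :=
      hprop.exists_smaller_of_isDetour hG hfree hx _ i j P a b hdet rfl
    exact ih _ (hn ▸ hlt) N' h' hx' hprop' rfl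
  · push Not at hdet
    exact ⟨N, h, x, hx, hprop.isSeparatedWheel hG hfree hx hdet⟩

end SimpleGraph

/-! ### Bridged cycles from subdivisions of K₄ -/

namespace SimpleGraph

variable {V : Type*} {G : SimpleGraph V} {N : ℕ} {h : ℤ → V} {T : Set V}

/-- The rim vertex `a` has a neighbour in `T`. -/
def Attaches (G : SimpleGraph V) (h : ℤ → V) (T : Set V) (a : V) : Prop :=
  a ∈ Set.range h ∧ ∃ t ∈ T, G.Adj t a

/-- `h` is a cycle and `T` is a connected set disjoint from it, with neighbours at three or more
vertices of the cycle. -/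
structure IsBridgedCycle (G : SimpleGraph V) (N : ℕ) (h : ℤ → V) (T : Set V) : Prop where
  cyc : IsCycFn G N h
  conn : ConnOn G T
  disj : ∀ i, h i ∉ T
  three : ∃ a b c, a ≠ b ∧ a ≠ c ∧ b ≠ c ∧ Attaches G h T a ∧ Attaches G h T b ∧ Attaches G h T c

theorem IsBridgedCycle.map {U : Type*} {S : SimpleGraph U} {N : ℕ} {h : ℤ → U} {T : Set U}
    (hb : IsBridgedCycle S N h T) (φ : S →g G) (hφ : Function.Injective φ) :
    IsBridgedCycle G N (fun i => φ (h i)) (φ '' T) := by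
  have att : ∀ a, Attaches S h T a → Attaches G (fun i => φ (h i)) (φ '' T) (φ a) := by
    rintro a ⟨⟨i, rfl⟩, t, ht, hta⟩
    exact ⟨⟨i, rfl⟩, φ t, ⟨t, ht, rfl⟩, φ.map_adj hta⟩
  refine ⟨⟨hb.cyc.three, fun i => congrArg φ (hb.cyc.per i),
    fun i j h1 h2 e => hb.cyc.inj i j h1 h2 (hφ e), fun i => φ.map_adj (hb.cyc.adj i)⟩, ?_, ?_, ?_⟩
  · rintro _ ⟨u, hu, rfl⟩ _ ⟨v, hv, rfl⟩
    have := hb.conn u hu v hv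
    induction this with
    | refl => exact Relation.ReflTransGen.refl
    | tail _ hbc ih =>
      exact (ih hbc.2.1).tail ⟨φ.map_adj hbc.1, ⟨_, hbc.2.1, rfl⟩, ⟨_, hbc.2.2, rfl⟩⟩
  · rintro i ⟨t, ht, e⟩
    exact hb.disj i (hφ e ▸ ht)
  · obtain ⟨a, b, c, hab, hac, hbc, ha, hb', hc⟩ := hb.three
    exact ⟨φ a, φ b, φ c, hφ.ne hab, hφ.ne hac, hφ.ne hbc, att a ha, att b hb', att c hc⟩

theorem exists_isCycFn_of_walk {u : V} (w : G.Walk u u) (hl : 3 ≤ w.length)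
    (hw : w.support.tail.Nodup) :
    ∃ h, IsCycFn G w.length h ∧ Set.range h = {v | v ∈ w.support} := by
  have hget : ∀ i j, 1 ≤ i → i < j → j ≤ w.length → w.getVert i ≠ w.getVert j := by
    intro i j hi hij hj e
    have hs : w.support.length = w.length + 1 := w.length_support
    have h1 : i - 1 < w.support.tail.length := by simp; omega
    have h2 : j - 1 < w.support.tail.length := by simp; omega
    have := (List.nodup_iff_injective_get.1 hw) (a₁ := ⟨i - 1, h1⟩) (a₂ := ⟨j - 1, h2⟩) (by
      simp only [List.get_eq_getElem, List.getElem_tail, Walk.support_getElem_eq_getVert,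
        show i - 1 + 1 = i by omega, show j - 1 + 1 = j by omega, e])
    simp only [Fin.mk.injEq] at this
    omega
  -- The window starts at 1 because only the tail of the support is free of repetitions: the
  -- vertices at positions 0 and `w.length` coincide.
  obtain ⟨h, hh, hg⟩ := IsCycFn.exists_window (G := G) 1 (fun i => w.getVert i.toNat) hl
    (fun i j h1 h2 h3 => hget _ _ (by omega) (by omega) (by omega))
    (fun i h1 h2 => by
      have := w.adj_getVert_succ (i := i.toNat) (by omega)
      rwa [show i.toNat + 1 = (i + 1).toNat by omega] at this)
    (by
      have := w.adj_getVert_succ (i := 0) (by omega)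
      simpa using this)
  refine ⟨h, hh, ?_⟩
  ext v
  constructor
  · intro hv
    obtain ⟨i, h1, h2, rfl⟩ := hh.exists_rep_of_mem 1 hv
    rw [hg i h1 h2]
    exact w.getVert_mem_support _
  · intro hv
    obtain ⟨n, rfl, hn⟩ := (Walk.mem_support_iff_exists_getVert).1 hv
    by_cases h0 : n = 0
    · subst h0
      refine ⟨w.length, ?_⟩
      rw [hg _ (by omega) (by omega)]
      simp
    · refine ⟨n, ?_⟩
      rw [hg _ (by omega) (by omega)]
      simp

/-- The cycle passes through the branch vertices 0, 1, 2. The three paths from branch vertex 3,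
without their far ends, form the connected set, which attaches at those three branch vertices. -/
theorem IsSubdivision.exists_isBridgedCycle {U : Type*} {S : SimpleGraph U}
    (hS : IsSubdivision (completeGraph (Fin 4)) S) : ∃ N h T, IsBridgedCycle S N h T := by
  obtain ⟨f, P, hpath, -, hend, hdisj, -, -⟩ := hS
  have adj : ∀ a b : Fin 4, a ≠ b → (completeGraph (Fin 4)).Adj a b := fun a b h => h
  have h01 := adj 0 1 (by decide)
  have h12 := adj 1 2 (by decide)
  have h20 := adj 2 0 (by decide)
  have hlen : ∀ a b h, 1 ≤ (P a b h).length := by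
    intro a b h
    by_contra hc
    exact h (f.injective (Walk.eq_of_length_eq_zero (p := P a b h) (by omega)))
  have htail : ∀ a b h, f a ∉ (P a b h).support.tail := by
    intro a b h
    have := (hpath a b h).support_nodup
    rw [← Walk.cons_tail_support] at this
    exact (List.nodup_cons.1 this).1
  have hmeet : ∀ a b h c d h', s(a, b) ≠ s(c, d) → ∀ u, u ∈ (P a b h).support →
      u ∈ (P c d h').support → ∃ w, u = f w ∧ (w = a ∨ w = b) ∧ (w = c ∨ w = d) := by
    intro a b h c d h' hne u hu hu'
    obtain ⟨w, rfl⟩ := hdisj a b h c d h' hne u hu hu'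
    exact ⟨w, rfl, hend _ _ _ _ hu, hend _ _ _ _ hu'⟩
  have hnd : ∀ a b h, (P a b h).support.tail.Nodup := fun a b h =>
    (hpath a b h).support_nodup.sublist (List.tail_sublist _)
  have hdj : ∀ a b c h h', a ≠ b → a ≠ c → b ≠ c → ∀ u, u ∈ (P a b h).support.tail →
      u ∈ (P b c h').support.tail → False := by
    intro a b c h h' hab hac hbc u hu hu'
    obtain ⟨w, rfl, h1, h2⟩ := hmeet a b h b c h' (by simp [hab, hac]) u
      (List.mem_of_mem_tail hu) (List.mem_of_mem_tail hu')
    have : w = b := by rcases h1 with rfl | rfl <;> simp_all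
    subst this
    exact htail _ _ _ hu'
  obtain ⟨h, hh, hr⟩ := exists_isCycFn_of_walk
    ((P 0 1 h01).append ((P 1 2 h12).append (P 2 0 h20)))
    (by
      have := hlen 0 1 h01
      have := hlen 1 2 h12
      have := hlen 2 0 h20
      simp only [Walk.length_append]; omega)
    (by
      rw [Walk.tail_support_append, Walk.tail_support_append, List.nodup_append',
        List.nodup_append']
      refine ⟨hnd _ _ _, ⟨hnd _ _ _, hnd _ _ _, ?_⟩, ?_⟩
      · exact fun u hu hu' => hdj 1 2 0 h12 h20 (by decide) (by decide) (by decide) u hu hu'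
      · intro u hu hu'
        rcases List.mem_append.1 hu' with hu' | hu'
        · exact hdj 0 1 2 h01 h12 (by decide) (by decide) (by decide) u hu hu'
        · exact hdj 2 0 1 h20 h01 (by decide) (by decide) (by decide) u hu' hu)
  have hmem : ∀ u, u ∈ Set.range h ↔ u ∈ (P 0 1 h01).support ∨ u ∈ (P 1 2 h12).support ∨
      u ∈ (P 2 0 h20).support := by
    intro u
    rw [hr]
    simp only [Set.mem_ofPred_eq, Walk.mem_support_append_iff]
  have h3 : ∀ a : Fin 4, a ≠ 3 → (completeGraph (Fin 4)).Adj 3 a := fun a ha => adj 3 a ha.symm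
  set T : Set U := {u | ∃ a, ∃ ha : a ≠ 3, u ∈ (P 3 a (h3 a ha)).support ∧ u ≠ f a} with hT
  have hgT : ∀ a (ha : a ≠ 3) i, i < (P 3 a (h3 a ha)).length →
      (P 3 a (h3 a ha)).getVert i ∈ T := by
    intro a ha i hi
    refine ⟨a, ha, Walk.getVert_mem_support _ _, fun e => ?_⟩
    have := (hpath 3 a (h3 a ha)).getVert_injOn (x₁ := i) (x₂ := (P 3 a (h3 a ha)).length)
      (by simp; omega) (by simp) (by rw [e, Walk.getVert_length])
    omega
  have hreach : ∀ u ∈ T, ReachIn S T (f 3) u := by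
    rintro u ⟨a, ha, hu, hne⟩
    obtain ⟨n, rfl, hn⟩ := (Walk.mem_support_iff_exists_getVert).1 hu
    have hlt : n < (P 3 a (h3 a ha)).length := by
      rcases hn.lt_or_eq with h | h
      · exact h
      · rw [h, Walk.getVert_length] at hne
        exact absurd rfl hne
    have := IsPathFn.reachIn (G := S) (n := n) (p := (P 3 a (h3 a ha)).getVert) (T := T)
      (fun i hi => Walk.adj_getVert_succ _ (by omega)) (fun i hi => hgT a ha i (by omega))
    rwa [Walk.getVert_zero] at this
  have hatt : ∀ a : Fin 4, a ≠ 3 → Attaches S h T (f a) := by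
    intro a ha
    refine ⟨(hmem _).2 ?_, (P 3 a (h3 a ha)).getVert ((P 3 a (h3 a ha)).length - 1),
      hgT a ha _ ?_, ?_⟩
    · fin_cases a
      · exact Or.inl (Walk.start_mem_support _)
      · exact Or.inl (Walk.end_mem_support _)
      · exact Or.inr (Or.inl (Walk.end_mem_support _))
      · exact absurd rfl ha
    · have := hlen 3 a (h3 a ha); omega
    · have h1 := hlen 3 a (h3 a ha)
      have := (P 3 a (h3 a ha)).adj_getVert_succ (i := (P 3 a (h3 a ha)).length - 1) (by omega)
      rwa [Nat.sub_add_cancel h1, Walk.getVert_length] at this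
  refine ⟨_, h, T, hh, ConnOn.of_center _ hreach, ?_, f 0, f 1, f 2, ?_, ?_, ?_,
    hatt 0 (by decide), hatt 1 (by decide), hatt 2 (by decide)⟩
  · rintro i ⟨a, ha, hu, hne⟩
    have hdisj' : ∀ c d (h' : (completeGraph (Fin 4)).Adj c d), c ≠ 3 → d ≠ 3 →
        h i ∈ (P c d h').support → False := by
      intro c d h' hc hd hu'
      obtain ⟨w, e, h1, h2⟩ := hmeet 3 a (h3 a ha) c d h' (by simp [hc.symm, hd.symm]) _ hu hu'
      rcases h1 with rfl | rfl
      · rcases h2 with h2 | h2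
        · exact hc h2.symm
        · exact hd h2.symm
      · exact hne e
    rcases (hmem (h i)).1 ⟨i, rfl⟩ with hu' | hu' | hu'
    · exact hdisj' _ _ _ (by decide) (by decide) hu'
    · exact hdisj' _ _ _ (by decide) (by decide) hu'
    · exact hdisj' _ _ _ (by decide) (by decide) hu'
  all_goals exact f.injective.ne (by decide)

theorem exists_isBridgedCycle (hsp : ¬ G.IsSeriesParallel) :
    ∃ N h T, IsBridgedCycle G N h T := by
  obtain ⟨G', hG'⟩ := not_not.1 hsp
  obtain ⟨N, h, T, hb⟩ := hG'.exists_isBridgedCycle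
  exact ⟨N, _, _, hb.map G'.hom Subgraph.hom_injective⟩

end SimpleGraph

/-! ### Minimal bridged cycles -/

namespace SimpleGraph

variable {V : Type*} {G : SimpleGraph V} {N : ℕ} {h : ℤ → V} {T : Set V}

/-- A chord of a cycle cuts off a shorter cycle. -/
theorem IsCycFn.exists_of_chord (hh : IsCycFn G N h) {i j : ℤ} (hij : i + 1 < j) (hj : j < i + N)
    (ha : G.Adj (h j) (h i)) :
    ∃ (N' : ℕ) (h' : ℤ → V), (N' : ℤ) = j - i + 1 ∧ IsCycFn G N' h' ∧
      Set.range h' = arc h i j := by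
  have hN' : (((j - i + 1).toNat : ℕ) : ℤ) = j - i + 1 := by omega
  obtain ⟨h', hh', hg⟩ := IsCycFn.exists_window (G := G) (N := (j - i + 1).toNat) i h (by omega)
    (fun s t h1 h2 h3 => hh.inj s t h2 (by omega)) (fun s _ _ => hh.adj s)
    (by rwa [show i + ((j - i + 1).toNat : ℤ) - 1 = j by omega])
  refine ⟨_, h', hN', hh', ?_⟩
  ext v
  constructor
  · intro hv
    obtain ⟨k, h1, h2, rfl⟩ := hh'.exists_rep_of_mem i hv
    rw [hg k h1 h2]
    exact mem_arc h1 (by omega)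
  · rintro ⟨k, h1, h2, rfl⟩
    exact ⟨k, hg k h1 (by omega)⟩

/-- A bridged cycle that is minimal, first with respect to the length of the cycle and then with
respect to the size of the connected set. -/
structure IsMinBridgedCycle (G : SimpleGraph V) (N : ℕ) (h : ℤ → V) (T : Set V) : Prop
    extends IsBridgedCycle G N h T where
  min : ∀ N' h' T', IsBridgedCycle G N' h' T' → N < N' ∨ (N = N' ∧ T.ncard ≤ T'.ncard)

theorem IsBridgedCycle.exists_min (hb : IsBridgedCycle G N h T) :
    ∃ N h T, IsMinBridgedCycle G N h T := by
  classical
  have hex : ∃ N h T, IsBridgedCycle G N h T := ⟨N, h, T, hb⟩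
  have hex2 : ∃ n h T, IsBridgedCycle G (Nat.find hex) h T ∧ T.ncard = n := by
    obtain ⟨h, T, hb⟩ := Nat.find_spec hex
    exact ⟨_, h, T, hb, rfl⟩
  obtain ⟨h', T', hb', hn⟩ := Nat.find_spec hex2
  refine ⟨_, h', T', hb', fun N'' h'' T'' hb'' => ?_⟩
  rcases (Nat.find_min' hex ⟨h'', T'', hb''⟩).lt_or_eq with hl | hl
  · exact Or.inl hl
  · refine Or.inr ⟨hl, ?_⟩
    subst hl
    rw [hn]
    exact Nat.find_min' hex2 ⟨h'', T'', hb'', rfl⟩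

theorem IsMinBridgedCycle.not_shorter (hb : IsMinBridgedCycle G N h T) {N' : ℕ} {h' : ℤ → V}
    {T' : Set V} (hN : N' < N) : ¬ IsBridgedCycle G N' h' T' := by
  intro hb'
  rcases hb.min _ _ _ hb' with h1 | h1 <;> omega

theorem Attaches.of_range {h h' : ℤ → V} {T' : Set V} {a : V} (ha : Attaches G h T a)
    (hr : a ∈ Set.range h') (hT : T ⊆ T') : Attaches G h' T' a := by
  obtain ⟨-, t, ht, hta⟩ := ha
  exact ⟨hr, t, hT ht, hta⟩

/-- If one side of a chord has no attachment in its interior, the cycle on the other side keeps all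
attachments of T and is shorter. -/
theorem IsMinBridgedCycle.chord_aux (hb : IsMinBridgedCycle G N h T) {i j : ℤ} (hij : i + 1 < j)
    (hj : j < i + N - 1) (ha : G.Adj (h j) (h i))
    (hno : ∀ k, j < k → k < i + N → ¬ Attaches G h T (h k)) : False := by
  obtain ⟨N', h', hN', hh', hr⟩ := hb.cyc.exists_of_chord hij (by omega) ha
  have key : ∀ a, Attaches G h T a → Attaches G h' T a := by
    intro a hat
    refine hat.of_range ?_ le_rfl
    obtain ⟨k, h1, h2, rfl⟩ := hb.cyc.exists_rep_of_mem i hat.1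
    rw [hr]
    by_contra hc
    refine hno k ?_ h2 hat
    by_contra hk
    exact hc (mem_arc h1 (by omega))
  refine hb.not_shorter (N' := N') (h' := h') (T' := T) (by omega) ⟨hh', hb.conn, fun k hk => ?_, ?_⟩
  · have : h' k ∈ arc h i j := hr ▸ ⟨k, rfl⟩
    obtain ⟨l, -, -, e⟩ := this
    exact hb.disj l (e ▸ hk)
  · obtain ⟨a, b, c, hab, hac, hbc, h1, h2, h3⟩ := hb.three
    exact ⟨a, b, c, hab, hac, hbc, key a h1, key b h2, key c h3⟩

/-- By `IsMinBridgedCycle.chord_aux` a chord would have attachments on both sides. Then the interior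
of one side can be moved into T: it is connected to T by an attachment there, and it sees both ends
of the chord. Those two ends and an attachment on the other side make the shorter cycle bridged. -/
theorem IsMinBridgedCycle.isHoleFn (hG : G.CliqueFree 3) (hb : IsMinBridgedCycle G N h T) :
    IsHoleFn G N h := by
  have hh := hb.cyc
  refine ⟨hh, ?_, ?_⟩
  · have := hh.three
    by_contra hlt
    obtain rfl : N = 3 := by omega
    refine hG.no_triangle (hh.adj 0) (hh.adj (0 + 1)) ?_
    have h1 := hh.adj (0 + 1 + 1)
    have h2 := hh.per 0
    norm_num at h1 h2 ⊢
    rw [h2] at h1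
    exact h1.symm
  · intro i j hij hj hadj
    by_cases h1 : ∃ k, i < k ∧ k < j ∧ Attaches G h T (h k)
    · by_cases h2 : ∃ k, j < k ∧ k < i + N ∧ Attaches G h T (h k)
      · obtain ⟨k, k1, k2, hk⟩ := h1
        obtain ⟨l, l1, l2, -, t, ht, htl⟩ := h2
        obtain ⟨N', h', hN', hh', hr⟩ := hh.exists_of_chord hij (by omega) hadj.symm
        refine hb.not_shorter (N' := N') (h' := h') (T' := T ∪ arc h (j + 1) (i + N - 1)) (by omega)
          ⟨hh', hb.conn.union (hh.connOn_arc _ _) ht (mem_arc (by omega) (by omega)) (Or.inr htl),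
            fun s hs => ?_, h i, h k, h j, hh.inj _ _ k1 (by omega), hh.inj _ _ (by omega) (by omega),
            hh.inj _ _ k2 (by omega), ⟨hr ▸ mem_arc le_rfl (by omega), h (i + N - 1),
              Or.inr (mem_arc (by omega) le_rfl), ?_⟩,
            hk.of_range (hr ▸ mem_arc k1.le k2.le) Set.subset_union_left,
            ⟨hr ▸ mem_arc (by omega) le_rfl, h (j + 1), Or.inr (mem_arc le_rfl (by omega)),
              (hh.adj j).symm⟩⟩
        · have : h' s ∈ arc h i j := hr ▸ ⟨s, rfl⟩
          obtain ⟨m, m1, m2, e⟩ := this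
          rcases hs with hs | ⟨n, n1, n2, e'⟩
          · exact hb.disj m (e ▸ hs)
          · exact hh.inj m n (by omega) (by omega) (e.trans e'.symm)
        · rw [← hh.per i]
          exact hh.adj' (by ring)
      · exact hb.chord_aux hij hj hadj.symm (fun k k1 k2 hk => h2 ⟨k, k1, k2, hk⟩)
    · refine hb.chord_aux (i := j) (j := i + N) (by omega) (by omega) (by rwa [hh.per]) ?_
      intro k k1 k2 hk
      refine h1 ⟨k - N, by omega, by omega, ?_⟩
      rwa [hh.sub_per]

theorem ConnOn.exists_adj_of_ssubset (hT : ConnOn G T) {Q : Set V} (hQ : Q ⊂ T)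
    (hne : Q.Nonempty) : ∃ v ∈ T, v ∉ Q ∧ ∃ q ∈ Q, G.Adj v q := by
  obtain ⟨t, ht, htQ⟩ := Set.exists_of_ssubset hQ
  obtain ⟨R, hR, r, hP, hd, ⟨q, hq, hrq⟩, -⟩ := hT.exists_approach hQ.subset hne ht htQ
  exact ⟨r, hR hP.right_mem, fun h => hd.ne_of_mem hP.right_mem h rfl, q, hq, hrq⟩

/-- A connected proper subset of a connected set misses a vertex that does not disconnect it. -/
theorem ConnOn.exists_connOn_diff [Finite V] (hT : ConnOn G T) {P : Set V} (hP : ConnOn G P)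
    (hne : P.Nonempty) (hPT : P ⊂ T) : ∃ v ∈ T, v ∉ P ∧ ConnOn G (T \ {v}) := by
  obtain ⟨Q, hQ, hmax⟩ := (Set.toFinite {Q : Set V | ConnOn G Q ∧ P ⊆ Q ∧ Q ⊂ T}).exists_maximal
    ⟨P, hP, le_rfl, hPT⟩
  obtain ⟨hQc, hPQ, hQT⟩ := hQ
  obtain ⟨v, hv, hvQ, q, hq, hvq⟩ := hT.exists_adj_of_ssubset hQT (hne.mono hPQ)
  -- Q is maximal among the connected proper subsets of T that contain P, so adding one adjacent
  -- vertex already gives T.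
  have hins : Insert.insert v Q = T := by
    by_contra hne'
    exact hvQ (hmax ⟨hQc.insert hq hvq, hPQ.trans (Set.subset_insert _ _),
      (Set.insert_subset hv hQT.subset).ssubset_of_ne hne'⟩ (Set.subset_insert _ _)
      (Set.mem_insert _ _))
  refine ⟨v, hv, fun h => hvQ (hPQ h), ?_⟩
  rwa [← hins, Set.insert_sdiff_self_of_notMem hvQ]

end SimpleGraph

/-! ### Four attachments: double forks -/

namespace SimpleGraph

variable {V : Type*} {G : SimpleGraph V} {N : ℕ} {h : ℤ → V} {T : Set V}

theorem IsHoleFn.close_vertex (hG : G.CliqueFree 3) (hh : IsHoleFn G N h) {i j : ℤ} (hij : i < j)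
    (hj : j < i + N - 1) {v : V} (hv : ∀ k, h k ≠ v) (hi : G.Adj v (h i)) (hj' : G.Adj v (h j))
    (honly : ∀ k, i ≤ k → k ≤ j → G.Adj v (h k) → h k = h i ∨ h k = h j) :
    ∃ (N' : ℕ) (h' : ℤ → V), IsHoleFn G N' h' ∧ (N' : ℤ) = j - i + 2 ∧
      Set.range h' = arc h i j ∪ {v} := by
  obtain ⟨N', h', hh', hN', hr⟩ := hh.close_set hG hij.le hj (PathSet.singleton v) (Or.inl hij)
    (fun k _ _ => hv k) hj'.symm hi (by
      rintro k h1 h2 u rfl hu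
      rcases honly k h1 h2 hu.symm with e | e
      · exact Or.inr ⟨hh.eq_of_window (by omega) (by omega) e, rfl⟩
      · exact Or.inl ⟨hh.eq_of_window (by omega) (by omega) e, rfl⟩)
  exact ⟨N', h', hh', by rw [hN', Set.ncard_singleton]; push_cast; ring, hr⟩

/-- `p` and `q` are the only vertices of `T` with neighbours on the cycle; those of `p` are `h i`
and `h j`, those of `q` are `h k` and `h l`. -/
structure IsDoubleFork (G : SimpleGraph V) (N : ℕ) (h : ℤ → V) (T : Set V) (p q : V)
    (i j k l : ℤ) : Prop where
  min : IsMinBridgedCycle G N h T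
  left_mem : p ∈ T
  right_mem : q ∈ T
  ne : p ≠ q
  conn_left : ConnOn G (T \ {p})
  adj_i : G.Adj p (h i)
  adj_j : G.Adj p (h j)
  adj_k : G.Adj q (h k)
  adj_l : G.Adj q (h l)
  only : ∀ m, ∀ t ∈ T, G.Adj t (h m) →
    (t = p ∧ (h m = h i ∨ h m = h j)) ∨ (t = q ∧ (h m = h k ∨ h m = h l))

variable {p q : V} {i j k l : ℤ}

/-- Passing from (i, j) to (j, i + N) exchanges the two arcs between the neighbours of p, so that a
statement about one of the arcs also serves for the other. -/
theorem IsDoubleFork.swap (hf : IsDoubleFork G N h T p q i j k l) :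
    IsDoubleFork G N h T p q j (i + N) k l := by
  obtain ⟨h1, h2, h3, h4, h5, h6, h7, h8, h9, h10⟩ := hf
  have hper := h1.cyc.per i
  refine ⟨h1, h2, h3, h4, h5, h7, by rwa [hper], h8, h9, fun m t ht hm => ?_⟩
  rw [hper, or_comm (a := h m = h j)]
  exact h10 m t ht hm

theorem IsDoubleFork.swap_right (hf : IsDoubleFork G N h T p q i j k l) :
    IsDoubleFork G N h T p q i j l k := by
  obtain ⟨h1, h2, h3, h4, h5, h6, h7, h8, h9, h10⟩ := hf
  refine ⟨h1, h2, h3, h4, h5, h6, h7, h9, h8, fun m t ht hm => ?_⟩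
  rw [or_comm (a := h m = h l)]
  exact h10 m t ht hm

theorem IsDoubleFork.shift_last (hf : IsDoubleFork G N h T p q i j k l) :
    IsDoubleFork G N h T p q i j k (l + N) := by
  obtain ⟨h1, h2, h3, h4, h5, h6, h7, h8, h9, h10⟩ := hf
  have hl := h1.cyc.per l
  exact ⟨h1, h2, h3, h4, h5, h6, h7, h8, by rwa [hl], by rwa [hl]⟩

theorem IsDoubleFork.only_left (hf : IsDoubleFork G N h T p q i j k l) {m : ℤ}
    (hm : G.Adj p (h m)) : h m = h i ∨ h m = h j := by
  rcases hf.only m p hf.left_mem hm with h1 | h1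
  · exact h1.2
  · exact absurd h1.1 hf.ne

theorem IsDoubleFork.gap (hG : G.CliqueFree 3) (hf : IsDoubleFork G N h T p q i j k l)
    (hij : i < j) : i + 1 < j := by
  by_contra hc
  obtain rfl : j = i + 1 := by omega
  exact hG.no_triangle hf.adj_i (hf.min.cyc.adj i) hf.adj_j

theorem IsDoubleFork.exists_adj (hf : IsDoubleFork G N h T p q i j k l) :
    ∃ t ∈ T \ {p}, G.Adj t p := by
  obtain ⟨v, hv, hvp, u, rfl, hvu⟩ := hf.min.conn.exists_adj_of_ssubset (Q := {p})
    ((Set.singleton_subset_iff.2 hf.left_mem).ssubset_of_ne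
      (fun e => hf.ne (e ▸ hf.right_mem : q ∈ ({p} : Set V)).symm)) ⟨p, rfl⟩
  exact ⟨v, ⟨hv, hvp⟩, hvu⟩

/-- Both neighbours of q lie beyond j. Replacing the arc from i to j, of length at least two, by the
path through p does not lengthen the cycle, while the connected set loses p and still attaches at h
k, h l and p. -/
theorem IsDoubleFork.false_of_parallel [Finite V] (hG : G.CliqueFree 3)
    (hf : IsDoubleFork G N h T p q i j k l) (hij : i < j) (hk : j < k) (hkl : k < l)
    (hl : l < i + N) : False := by
  have hgap := hf.gap hG hij
  have hh := hf.min.isHoleFn hG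
  have hd := hf.min.disj
  have hpr : ∀ m, h m ≠ p := fun m e => hd m (e ▸ hf.left_mem)
  obtain ⟨N', h', hh', hN', hr⟩ := hh.close_vertex hG (i := j) (j := i + N) (by omega) (by omega)
    (v := p) hpr hf.adj_j (by rw [hh.per]; exact hf.adj_i)
    (fun m _ _ hm => by rw [hh.per]; exact (hf.only_left hm).symm)
  obtain ⟨t, ht, htp⟩ := hf.exists_adj
  have hq : q ∈ T \ {p} := ⟨hf.right_mem, hf.ne.symm⟩
  have hlt : (T \ {p}).ncard < T.ncard :=
    Set.ncard_lt_ncard (Set.sdiff_singleton_ssubset.2 hf.left_mem)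
  have hb : IsBridgedCycle G N' h' (T \ {p}) := by
    refine ⟨hh'.toIsCycFn, hf.conn_left, fun m hm => ?_, h k, h l, p,
      hh.inj _ _ hkl (by omega), hpr _, hpr _,
      ⟨hr ▸ Or.inl (mem_arc (by omega) (by omega)), q, hq, hf.adj_k⟩,
      ⟨hr ▸ Or.inl (mem_arc (by omega) (by omega)), q, hq, hf.adj_l⟩,
      ⟨hr ▸ Or.inr rfl, t, ht, htp⟩⟩
    have : h' m ∈ arc h j (i + N) ∪ {p} := hr ▸ ⟨m, rfl⟩
    rcases this with ⟨n, -, -, e⟩ | e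
    · exact hd n (e ▸ hm.1)
    · exact hm.2 e
  rcases hf.min.min N' h' _ hb with h1 | h1 <;> omega

/-- Were the arc from j to i + N longer than two, replacing it by the path through p would shorten
the cycle. The interior of that arc joins T \ {p} through h l, and the new connected set attaches at
h i, h k and p. -/
theorem IsDoubleFork.le_of_crossing (hG : G.CliqueFree 3)
    (hf : IsDoubleFork G N h T p q i j k l) (hik : i < k) (hkj : k < j) (hjl : j < l)
    (hl : l < i + N) : i + N ≤ j + 2 := by
  have hgap := hf.swap.gap hG (by omega)
  by_contra hcon
  have hh := hf.min.isHoleFn hG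
  have hd := hf.min.disj
  have hpr : ∀ m, h m ≠ p := fun m e => hd m (e ▸ hf.left_mem)
  obtain ⟨N', h', hh', hN', hr⟩ := hh.close_vertex hG (i := i) (j := j) (by omega) (by omega)
    (v := p) hpr hf.adj_i hf.adj_j (fun m _ _ hm => hf.only_left hm)
  obtain ⟨t, ht, htp⟩ := hf.exists_adj
  have hq : q ∈ T \ {p} := ⟨hf.right_mem, hf.ne.symm⟩
  refine hf.min.not_shorter (N' := N') (h' := h') (T' := (T \ {p}) ∪ arc h (j + 1) (i + N - 1))
    (by omega) ⟨hh'.toIsCycFn, hf.conn_left.union (hh.connOn_arc _ _) hq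
      (mem_arc (k := l) (by omega) (by omega)) (Or.inr hf.adj_l), fun m hm => ?_, h i, h k, p,
      hh.inj _ _ hik (by omega), hpr _, hpr _,
      ⟨hr ▸ Or.inl (mem_arc le_rfl (by omega)), h (i + N - 1), Or.inr (mem_arc (by omega) le_rfl),
        ?_⟩,
      ⟨hr ▸ Or.inl (mem_arc (by omega) (by omega)), q, Or.inl hq, hf.adj_k⟩,
      ⟨hr ▸ Or.inr rfl, t, Or.inl ht, htp⟩⟩
  · have : h' m ∈ arc h i j ∪ {p} := hr ▸ ⟨m, rfl⟩
    rcases this with ⟨n, n1, n2, e⟩ | e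
    · rcases hm with hm | ⟨s, s1, s2, e'⟩
      · exact hd n (e ▸ hm.1)
      · exact hh.inj n s (by omega) (by omega) (e.trans e'.symm)
    · rcases hm with hm | ⟨s, s1, s2, e'⟩
      · exact hm.2 e
      · exact hpr s (e'.trans e)
  · rw [← hh.per i]
    exact hh.adj' (by ring)

/-- Nine edges suffice: two vertices on the same side have a common neighbour, so triangle-freeness
makes them nonadjacent. -/
theorem isIndContained_of_forall_adj (hG : G.CliqueFree 3) {a b c x y z : V} (hab : a ≠ b)
    (hac : a ≠ c) (hbc : b ≠ c) (hxy : x ≠ y) (hxz : x ≠ z) (hyz : y ≠ z) (hax : G.Adj a x)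
    (hay : G.Adj a y) (haz : G.Adj a z) (hbx : G.Adj b x) (hby : G.Adj b y) (hbz : G.Adj b z)
    (hcx : G.Adj c x) (hcy : G.Adj c y) (hcz : G.Adj c z) :
    (completeBipartiteGraph (Fin 3) (Fin 3)).IsIndContained G := by
  have hadj : ∀ i j, G.Adj (![a, b, c] i) (![x, y, z] j) := by
    intro i j
    fin_cases i <;> fin_cases j <;> assumption
  have hinj1 : Function.Injective ![a, b, c] := by
    intro i j e
    fin_cases i <;> fin_cases j <;> simp_all
  have hinj2 : Function.Injective ![x, y, z] := by
    intro i j e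
    fin_cases i <;> fin_cases j <;> simp_all
  refine ⟨⟨⟨Sum.elim ![a, b, c] ![x, y, z], ?_⟩, ?_⟩⟩
  · rintro (i | i) (j | j) e
    · exact congrArg _ (hinj1 e)
    · exact absurd e (hadj i j).ne
    · exact absurd e (hadj j i).ne'
    · exact congrArg _ (hinj2 e)
  · rintro (i | i) (j | j)
    · exact iff_of_false (fun h => hG.no_triangle h (hadj j 0) (hadj i 0)) (by simp)
    · exact iff_of_true (hadj i j) (by simp)
    · exact iff_of_true (hadj j i).symm (by simp)
    · exact iff_of_false (fun h => hG.no_triangle (hadj 0 i) h (hadj 0 j)) (by simp)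

/-- In the case of a cycle of length four, a double fork gives an induced `K₃,₃` or an induced
subdivision of `K₄`. -/
theorem IsDoubleFork.false_of_four (hG : G.CliqueFree 3) (hfree : G.ISK4Free)
    (hK : ¬ (completeBipartiteGraph (Fin 3) (Fin 3)).IsIndContained G)
    (hf : IsDoubleFork G 4 h T p q i (i + 2) (i + 1) (i + 3)) : False := by
  have hh := hf.min.isHoleFn hG
  have hd := hf.min.disj
  have hpr : ∀ m, h m ≠ p := fun m e => hd m (e ▸ hf.left_mem)
  have hqr : ∀ m, h m ≠ q := fun m e => hd m (e ▸ hf.right_mem)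
  have e01 : h i ≠ h (i + 1) := hh.inj _ _ (by omega) (by push_cast; omega)
  have e02 : h i ≠ h (i + 2) := hh.inj _ _ (by omega) (by push_cast; omega)
  have e03 : h i ≠ h (i + 3) := hh.inj _ _ (by omega) (by push_cast; omega)
  have e12 : h (i + 1) ≠ h (i + 2) := hh.inj _ _ (by omega) (by push_cast; omega)
  have e13 : h (i + 1) ≠ h (i + 3) := hh.inj _ _ (by omega) (by push_cast; omega)
  have e23 : h (i + 2) ≠ h (i + 3) := hh.inj _ _ (by omega) (by push_cast; omega)
  have a01 : G.Adj (h i) (h (i + 1)) := hh.adj i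
  have a12 : G.Adj (h (i + 1)) (h (i + 2)) := hh.adj' (by ring)
  have a23 : G.Adj (h (i + 2)) (h (i + 3)) := hh.adj' (by ring)
  have a30 : G.Adj (h (i + 3)) (h i) := by
    rw [← hh.per i]; exact hh.adj' (by push_cast; ring)
  have n02 : ¬ G.Adj (h i) (h (i + 2)) := fun h1 => hG.no_triangle a01 a12 h1
  have n13 : ¬ G.Adj (h (i + 1)) (h (i + 3)) := fun h1 => hG.no_triangle a12 a23 h1
  have np1 : ¬ G.Adj p (h (i + 1)) := fun h1 => by
    rcases hf.only_left h1 with e | e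
    · exact e01 e.symm
    · exact e12 e
  have np3 : ¬ G.Adj p (h (i + 3)) := fun h1 => by
    rcases hf.only_left h1 with e | e
    · exact e03 e.symm
    · exact e23 e.symm
  have nq : ∀ m, G.Adj q (h m) → h m = h (i + 1) ∨ h m = h (i + 3) := fun m hm => by
    rcases hf.only m q hf.right_mem hm with h1 | h1
    · exact absurd h1.1.symm hf.ne
    · exact h1.2
  have nq0 : ¬ G.Adj q (h i) := fun h1 => by
    rcases nq i h1 with e | e
    · exact e01 e
    · exact e03 e
  have nq2 : ¬ G.Adj q (h (i + 2)) := fun h1 => by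
    rcases nq _ h1 with e | e
    · exact e12 e.symm
    · exact e23 e
  -- If p and q are adjacent, then h i, h (i + 2), q against h (i + 1), h (i + 3), p is an induced
  -- K₃,₃. If not, the 4-hole h i, h (i + 1), h (i + 2), p is joined to the connected set {h (i +
  -- 3), q} by exactly three edges.
  by_cases hpq : G.Adj p q
  · refine hK (isIndContained_of_forall_adj hG e02 (hqr _) (hqr _) e13 (hpr _) (hpr _)
      a01 a30.symm hf.adj_i.symm a12.symm a23 hf.adj_j.symm hf.adj_k hf.adj_l hpq.symm)
  · refine hh.not_isk4Free_of_arc hG (i := i) (j := i + 2) (by omega) (by push_cast; omega)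
      (PathSet.singleton p) (Or.inl (by omega)) (fun m _ _ e => hpr m e) hf.adj_j.symm hf.adj_i ?_
      (T := {h (i + 3)} ∪ {q}) ((ConnOn.singleton _).union (ConnOn.singleton _) rfl rfl
        (Or.inr hf.adj_l.symm)) ?_ ?_ (c := h i) (d := h (i + 2)) (e := h (i + 1))
      (s := h (i + 3)) (t := h (i + 3)) (u := q) (Or.inl (mem_arc (by omega) (by omega)))
      (Or.inl (mem_arc (by omega) (by omega))) (Or.inl (mem_arc (by omega) (by omega))) e02 e01
      e12.symm (Or.inl rfl) (Or.inl rfl) (Or.inr rfl) a30.symm a23 hf.adj_k.symm ?_ ?_ hfree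
    · rintro m h1 h2 u rfl hu
      obtain rfl | rfl | rfl : m = i ∨ m = i + 1 ∨ m = i + 2 := by omega
      · exact Or.inr ⟨rfl, rfl⟩
      · exact absurd hu.symm np1
      · exact Or.inl ⟨rfl, rfl⟩
    · rintro m h1 h2 (e | e)
      · exact hh.inj m (i + 3) (by omega) (by push_cast; omega) e
      · exact hqr m e
    · rintro u rfl (e | e)
      · exact hpr _ e.symm
      · exact hf.ne e
    · rintro m h1 h2 w hw hmw
      obtain rfl | rfl | rfl : m = i ∨ m = i + 1 ∨ m = i + 2 := by omega
      all_goals rcases hw with rfl | rfl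
      · exact Or.inl ⟨rfl, rfl⟩
      · exact absurd hmw.symm nq0
      · exact absurd hmw n13
      · exact Or.inr (Or.inr ⟨rfl, rfl⟩)
      · exact Or.inr (Or.inl ⟨rfl, rfl⟩)
      · exact absurd hmw.symm nq2
    · rintro u rfl w (rfl | rfl) huw
      · exact absurd huw np3
      · exact absurd huw hpq

/-- If the neighbours of q lie on the same side of the pair of p, the parallel case applies. If the
pairs cross, the length bound for both arcs and triangle-freeness make each arc of length two, so
the cycle has length four. -/
theorem IsDoubleFork.false_of_lt [Finite V] (hG : G.CliqueFree 3) (hfree : G.ISK4Free)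
    (hK : ¬ (completeBipartiteGraph (Fin 3) (Fin 3)).IsIndContained G)
    (hf : IsDoubleFork G N h T p q i j k l) (hij : i < j) (hjN : j < i + N) (hik : i < k)
    (hkl : k < l) (hl : l < i + N) (hkj : k ≠ j) (hlj : l ≠ j) : False := by
  rcases lt_or_gt_of_ne hkj with h1 | h1
  · rcases lt_or_gt_of_ne hlj with h2 | h2
    · exact hf.swap.shift_last.swap_right.shift_last.swap_right.false_of_parallel hG hjN
        (by omega) (by omega) (by omega)
    · have h3 := hf.le_of_crossing hG hik h1 h2 hl
      have h4 := hf.swap.swap_right.shift_last.le_of_crossing hG h2 hl (by omega) (by omega)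
      have h5 := hf.gap hG hij
      have h6 := hf.swap.gap hG hjN
      obtain rfl : j = i + 2 := by omega
      obtain rfl : N = 4 := by omega
      obtain rfl : k = i + 1 := by omega
      obtain rfl : l = i + 3 := by omega
      exact hf.false_of_four hG hfree hK
  · exact hf.false_of_parallel hG hij h1 hkl hl

end SimpleGraph

/-! ### A minimal bridged cycle yields a wheel -/

namespace SimpleGraph

variable {V : Type*} {G : SimpleGraph V} {N : ℕ} {h : ℤ → V} {T : Set V} {p q : V}

theorem IsMinBridgedCycle.not_attaches_diff [Finite V] (hb : IsMinBridgedCycle G N h T)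
    (hp : p ∈ T) (hconn : ConnOn G (T \ {p})) {a b c : V} (hab : a ≠ b) (hac : a ≠ c)
    (hbc : b ≠ c) (ha : Attaches G h (T \ {p}) a) (hb' : Attaches G h (T \ {p}) b)
    (hc : Attaches G h (T \ {p}) c) : False := by
  have hlt : (T \ {p}).ncard < T.ncard := Set.ncard_lt_ncard (Set.sdiff_singleton_ssubset.2 hp)
  rcases hb.min N h _ ⟨hb.cyc, hconn, fun i hi => hb.disj i hi.1, a, b, c, hab, hac, hbc, ha, hb',
    hc⟩ with h1 | h1 <;> omega

/-- If a minimal bridged cycle has exactly three attachments and the first two of them have just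
one neighbour in the connected set, then there is a wheel. -/
theorem IsMinBridgedCycle.exists_isWheelFn_of_three [Finite V] (hG : G.CliqueFree 3)
    (hfree : G.ISK4Free) (hb : IsMinBridgedCycle G N h T) (hp : p ∈ T) (hq : q ∈ T)
    {i k j : ℤ} (hik : i < k) (hkj : k < j) (hj : j < i + N) (hpi : G.Adj p (h i))
    (hqk : G.Adj q (h k)) {t : V} (ht : t ∈ T) (htj : G.Adj t (h j))
    (honly : ∀ m, ∀ u ∈ T, G.Adj u (h m) →
      (h m = h i ∧ u = p) ∨ (h m = h k ∧ u = q) ∨ h m = h j) :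
    ∃ N h x, IsWheelFn G N h x := by
  have hh := hb.isHoleFn hG
  have hd := hb.disj
  have eik : h i ≠ h k := hh.inj _ _ hik (by omega)
  have eij : h i ≠ h j := hh.inj _ _ (by omega) (by omega)
  have ekj : h k ≠ h j := hh.inj _ _ (by omega) (by omega)
  by_cases hτ : ∃ u ∈ T, u ≠ t ∧ G.Adj u (h j)
  swap
  · refine absurd hfree (not_isk4Free_of_three_edges hG hh hb.conn hd ⟨i, rfl⟩ ⟨k, rfl⟩ ⟨j, rfl⟩
      eik eij ekj hp hq ht hpi.symm hqk.symm htj.symm ?_)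
    intro m u hu hmu
    rcases honly m u hu hmu.symm with h1 | h1 | h1
    · exact Or.inl h1
    · exact Or.inr (Or.inl h1)
    · refine Or.inr (Or.inr ⟨h1, ?_⟩)
      by_contra hne
      exact hτ ⟨u, hu, hne, h1 ▸ hmu.symm⟩
  obtain ⟨u, hu, hut, huj⟩ := hτ
  obtain ⟨S, hST, hS⟩ := hb.conn.exists_pathSet hp hq
  -- A vertex off the induced path from p to q could be deleted: h i and h k keep p and q, and h j
  -- has two neighbours in T, of which at least one survives.
  obtain rfl : S = T := by
    by_contra hne
    obtain ⟨v, hv, hvS, hconn⟩ := hb.conn.exists_connOn_diff hS.connOn ⟨p, hS.left_mem⟩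
      (hST.ssubset_of_ne hne)
    have hj' : Attaches G h (T \ {v}) (h j) := by
      by_cases hvt : t = v
      · exact ⟨⟨j, rfl⟩, u, ⟨hu, fun e => hut (e.trans hvt.symm)⟩, huj⟩
      · exact ⟨⟨j, rfl⟩, t, ⟨ht, hvt⟩, htj⟩
    refine hb.not_attaches_diff hv hconn eik eij ekj ⟨⟨i, rfl⟩, p, ⟨hp, ?_⟩, hpi⟩
      ⟨⟨k, rfl⟩, q, ⟨hq, ?_⟩, hqk⟩ hj'
    · rintro rfl; exact hvS hS.left_mem
    · rintro rfl; exact hvS hS.right_mem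
  have harc : ∀ m, i ≤ m → m ≤ k → ∀ w ∈ S, G.Adj (h m) w → (m = k ∧ w = q) ∨ (m = i ∧ w = p) := by
    intro m h1 h2 w hw hmw
    rcases honly m w hw hmw.symm with ⟨e, e'⟩ | ⟨e, e'⟩ | e
    · exact Or.inr ⟨hh.eq_of_window (by omega) (by omega) e, e'⟩
    · exact Or.inl ⟨hh.eq_of_window (by omega) (by omega) e, e'⟩
    · exact absurd e (hh.inj m j (by omega) (by omega))
  obtain ⟨N', h', hh', -, hr⟩ := hh.close_set hG hik.le (by omega) hS.symm (Or.inl hik)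
    (fun m _ _ => hd m) hqk.symm hpi harc
  by_contra hno
  -- The arc from i to k closed up by the path is a hole; a third neighbour of h j on it would give
  -- a wheel with centre h j.
  have key : ∀ w ∈ arc h i k ∪ S, G.Adj (h j) w → w = t ∨ w = u := by
    intro w hw hjw
    by_contra hc
    push Not at hc
    refine hno ⟨N', h', h j, hh', fun m e => ?_, t, u, w, hut.symm, hc.1.symm, hc.2.symm,
      ⟨hr ▸ Or.inr ht, htj.symm⟩, ⟨hr ▸ Or.inr hu, huj.symm⟩, ⟨hr ▸ hw, hjw⟩⟩
    have : h j ∈ arc h i k ∪ S := by rw [← e, ← hr]; exact ⟨m, rfl⟩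
    rcases this with ⟨n, n1, n2, e⟩ | e
    · exact hh.inj n j (by omega) (by omega) e
    · exact hd j e
  -- The connected set is the arc from j to just before i + N. Its edges to the new hole are the two
  -- from h j to t and u, and the rim edge that ends at h i.
  refine hh.not_isk4Free_of_arc hG hik.le (by omega) hS.symm (Or.inl hik)
    (fun m _ _ => hd m) hqk.symm hpi harc (hh.connOn_arc j (i + N - 1)) ?_ ?_
    (c := t) (d := u) (e := h i) (s := h j) (t := h j) (u := h (i + N - 1)) (Or.inr ht) (Or.inr hu)
    (Or.inl (mem_arc le_rfl hik.le)) hut.symm (fun e => hd i (e ▸ ht)) (fun e => hd i (e ▸ hu))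
    (mem_arc le_rfl (by omega)) (mem_arc le_rfl (by omega)) (mem_arc (by omega) le_rfl) htj huj ?_
    ?_ ?_ hfree
  · rintro m m1 m2 ⟨n, n1, n2, e⟩
    exact hh.inj m n (by omega) (by omega) e.symm
  · rintro w hw ⟨n, n1, n2, rfl⟩
    exact hd n hw
  · rw [← hh.per i]
    exact (hh.adj' (by ring)).symm
  · rintro m m1 m2 _ ⟨n, n1, n2, rfl⟩ hmn
    rcases hh.adj_window (by omega) (by omega) hmn with e | e
    · obtain rfl : m = k := by omega
      obtain rfl : n = j := by omega
      rcases key (h m) (Or.inl (mem_arc m1 m2)) hmn.symm with e | e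
      · exact absurd ht (e ▸ hd m)
      · exact absurd hu (e ▸ hd m)
    · obtain rfl : m = i := by omega
      exact Or.inr (Or.inr ⟨rfl, by rw [e]⟩)
  · rintro w hw _ ⟨n, n1, n2, rfl⟩ hwn
    rcases honly n w hw hwn with ⟨e, -⟩ | ⟨e, -⟩ | e
    · exact absurd e.symm (hh.inj i n (by omega) (by omega))
    · exact absurd e.symm (hh.inj k n (by omega) (by omega))
    · rw [e] at hwn ⊢
      rcases key w (Or.inr hw) hwn.symm with rfl | rfl
      · exact Or.inl ⟨rfl, rfl⟩
      · exact Or.inr (Or.inl ⟨rfl, rfl⟩)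

theorem IsMinBridgedCycle.false_of_four [Finite V] (hG : G.CliqueFree 3) (hfree : G.ISK4Free)
    (hK : ¬ (completeBipartiteGraph (Fin 3) (Fin 3)).IsIndContained G)
    (hb : IsMinBridgedCycle G N h T) (hp : p ∈ T) (hq : q ∈ T) (hpq : p ≠ q)
    (hcp : ConnOn G (T \ {p})) {a b c d : V} (ha : a ∈ Set.range h)
    (hb' : b ∈ Set.range h) (hc : c ∈ Set.range h) (hd : d ∈ Set.range h) (hab : a ≠ b)
    (hac : a ≠ c) (had : a ≠ d) (hbc : b ≠ c) (hbd : b ≠ d) (hcd : c ≠ d) (hpa : G.Adj p a)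
    (hpb : G.Adj p b) (hqc : G.Adj q c) (hqd : G.Adj q d)
    (honly : ∀ m, ∀ t ∈ T, G.Adj t (h m) →
      (t = p ∧ (h m = a ∨ h m = b)) ∨ (t = q ∧ (h m = c ∨ h m = d))) : False := by
  obtain ⟨i, rfl⟩ := ha
  have hh := hb.cyc
  obtain ⟨j, j1, j2, rfl⟩ := hh.exists_rep_of_mem i hb'
  obtain ⟨k, k1, k2, rfl⟩ := hh.exists_rep_of_mem i hc
  obtain ⟨l, l1, l2, rfl⟩ := hh.exists_rep_of_mem i hd
  have nij : i ≠ j := fun e => hab (by rw [e])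
  have nik : i ≠ k := fun e => hac (by rw [e])
  have nil : i ≠ l := fun e => had (by rw [e])
  have njk : j ≠ k := fun e => hbc (by rw [e])
  have njl : j ≠ l := fun e => hbd (by rw [e])
  have nkl : k ≠ l := fun e => hcd (by rw [e])
  have hf : IsDoubleFork G N h T p q i j k l :=
    ⟨hb, hp, hq, hpq, hcp, hpa, hpb, hqc, hqd, honly⟩
  rcases lt_or_gt_of_ne nkl with hl | hl
  · exact hf.false_of_lt hG hfree hK (by omega) j2 (by omega) hl l2 njk.symm njl.symm
  · exact hf.swap_right.false_of_lt hG hfree hK (by omega) j2 (by omega) hl k2 njl.symm njk.symm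

theorem IsMinBridgedCycle.exists_isWheelFn [Finite V] (hG : G.CliqueFree 3) (hfree : G.ISK4Free)
    (hK : ¬ (completeBipartiteGraph (Fin 3) (Fin 3)).IsIndContained G)
    (hb : IsMinBridgedCycle G N h T) : ∃ N h x, IsWheelFn G N h x := by
  have hh := hb.isHoleFn hG
  obtain ⟨x, y, z, hxy, hxz, hyz, hx, hy, hz⟩ := hb.three
  obtain ⟨t, ht, -⟩ := hx.2
  by_cases hT : T = {t}
  · subst hT
    have hadj : ∀ a, Attaches G h {t} a → a ∈ Set.range h ∧ G.Adj t a := by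
      rintro a ⟨h1, _, rfl, h2⟩; exact ⟨h1, h2⟩
    exact ⟨N, h, t, hh, fun m e => hb.disj m e, x, y, z, hxy, hxz, hyz, hadj _ hx, hadj _ hy,
      hadj _ hz⟩
  -- Two distinct vertices p and q are chosen whose deletion leaves T connected. By minimality
  -- neither T \ {p} nor T \ {q} has three attachments.
  obtain ⟨p, hp, -, hcp⟩ := hb.conn.exists_connOn_diff (ConnOn.singleton t) ⟨t, rfl⟩
    ((Set.singleton_subset_iff.2 ht).ssubset_of_ne (Ne.symm hT))
  have hTp : T ≠ {p} := by
    rintro rfl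
    exact hT (by rw [Set.mem_singleton_iff.1 ht])
  obtain ⟨q, hq, hqp, hcq⟩ := hb.conn.exists_connOn_diff (ConnOn.singleton p) ⟨p, rfl⟩
    ((Set.singleton_subset_iff.2 hp).ssubset_of_ne hTp.symm)
  have hpq : p ≠ q := fun e => hqp e.symm
  -- the rim vertices whose only neighbour in `T` is `r`
  have hsole : ∀ r ∈ T, ConnOn G (T \ {r}) → ∀ a b c, a ≠ b → a ≠ c → b ≠ c → Attaches G h T a →
      Attaches G h T b → Attaches G h T c → (∀ t ∈ T, G.Adj t a → t = r) ∨
        (∀ t ∈ T, G.Adj t b → t = r) ∨ (∀ t ∈ T, G.Adj t c → t = r) := by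
    intro r hr hconn a b c hab hac hbc ha hb' hc
    by_contra hcon
    push Not at hcon
    obtain ⟨⟨s, hs, hsa, hsr⟩, ⟨s', hs', hsb, hsr'⟩, ⟨s'', hs'', hsc, hsr''⟩⟩ := hcon
    exact hb.not_attaches_diff hr hconn hab hac hbc ⟨ha.1, s, ⟨hs, hsr⟩, hsa⟩
      ⟨hb'.1, s', ⟨hs', hsr'⟩, hsb⟩ ⟨hc.1, s'', ⟨hs'', hsr''⟩, hsc⟩
  have hP := hsole p hp hcp
  have hQ := hsole q hq hcq
  have hexcl : ∀ a, Attaches G h T a → (∀ t ∈ T, G.Adj t a → t = p) →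
      (∀ t ∈ T, G.Adj t a → t = q) → False := by
    rintro a ⟨-, t, ht, hta⟩ h1 h2
    exact hpq ((h1 t ht hta).symm.trans (h2 t ht hta))
  have hadj : ∀ a r, Attaches G h T a → (∀ t ∈ T, G.Adj t a → t = r) → G.Adj r a := by
    rintro a r ⟨-, t, ht, hta⟩ h1
    exact h1 t ht hta ▸ hta
  obtain ⟨a, b, c, hab, hac, hbc, ha, hb', hc, hpa, hqc⟩ : ∃ a b c, a ≠ b ∧ a ≠ c ∧ b ≠ c ∧
      Attaches G h T a ∧ Attaches G h T b ∧ Attaches G h T c ∧ (∀ t ∈ T, G.Adj t a → t = p) ∧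
        (∀ t ∈ T, G.Adj t c → t = q) := by
    rcases hP x y z hxy hxz hyz hx hy hz with h1 | h1 | h1 <;>
      rcases hQ x y z hxy hxz hyz hx hy hz with h2 | h2 | h2
    · exact (hexcl _ hx h1 h2).elim
    · exact ⟨x, z, y, hxz, hxy, hyz.symm, hx, hz, hy, h1, h2⟩
    · exact ⟨x, y, z, hxy, hxz, hyz, hx, hy, hz, h1, h2⟩
    · exact ⟨y, z, x, hyz, hxy.symm, hxz.symm, hy, hz, hx, h1, h2⟩
    · exact (hexcl _ hy h1 h2).elim
    · exact ⟨y, x, z, hxy.symm, hyz, hxz, hy, hx, hz, h1, h2⟩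
    · exact ⟨z, y, x, hyz.symm, hxz.symm, hxy.symm, hz, hy, hx, h1, h2⟩
    · exact ⟨z, x, y, hxz.symm, hyz.symm, hxy, hz, hx, hy, h1, h2⟩
    · exact (hexcl _ hz h1 h2).elim
  by_cases hd : ∃ d, Attaches G h T d ∧ d ≠ a ∧ d ≠ b ∧ d ≠ c
  · exfalso
    -- Since a already belongs to p alone and c to q alone, any two further attachments are divided
    -- between them: one has p as its only neighbour in T, the other has q. In particular there is
    -- no fifth attachment.
    have key : ∀ b' d, b' ≠ a → b' ≠ c → b' ≠ d → d ≠ a → d ≠ c → Attaches G h T b' →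
        Attaches G h T d → ((∀ t ∈ T, G.Adj t b' → t = p) ∧ ∀ t ∈ T, G.Adj t d → t = q) ∨
          ((∀ t ∈ T, G.Adj t b' → t = q) ∧ ∀ t ∈ T, G.Adj t d → t = p) := by
      intro b' d n1 n2 n3 n4 n5 h1 h2
      rcases hP b' d c n3 n2 n5 h1 h2 hc with h3 | h3 | h3
      · rcases hQ a b' d n1.symm n4.symm n3 ha h1 h2 with h4 | h4 | h4
        · exact (hexcl _ ha hpa h4).elim
        · exact (hexcl _ h1 h3 h4).elim
        · exact Or.inl ⟨h3, h4⟩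
      · rcases hQ a b' d n1.symm n4.symm n3 ha h1 h2 with h4 | h4 | h4
        · exact (hexcl _ ha hpa h4).elim
        · exact Or.inr ⟨h4, h3⟩
        · exact (hexcl _ h2 h3 h4).elim
      · exact (hexcl _ hc h3 hqc).elim
    obtain ⟨b, d, hab, hbc, hbd, had, hdc, hb', hd, hpb, hqd⟩ : ∃ b d, a ≠ b ∧ b ≠ c ∧ b ≠ d ∧
        a ≠ d ∧ d ≠ c ∧ Attaches G h T b ∧ Attaches G h T d ∧ (∀ t ∈ T, G.Adj t b → t = p) ∧
          (∀ t ∈ T, G.Adj t d → t = q) := by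
      obtain ⟨d, hd, hda, hdb, hdc⟩ := hd
      rcases key b d hab.symm hbc hdb.symm hda hdc hb' hd with h1 | h1
      · exact ⟨b, d, hab, hbc, hdb.symm, hda.symm, hdc, hb', hd, h1.1, h1.2⟩
      · exact ⟨d, b, hda.symm, hdc, hdb, hab, hbc, hd, hb', h1.2, h1.1⟩
    refine hb.false_of_four hG hfree hK hp hq hpq hcp ha.1 hb'.1 hc.1 hd.1 hab hac had hbc hbd
      hdc.symm (hadj _ _ ha hpa) (hadj _ _ hb' hpb) (hadj _ _ hc hqc) (hadj _ _ hd hqd) ?_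
    intro m s hs hsm
    have hm : Attaches G h T (h m) := ⟨⟨m, rfl⟩, s, hs, hsm⟩
    by_cases e1 : h m = a
    · exact Or.inl ⟨hpa s hs (e1 ▸ hsm), Or.inl e1⟩
    by_cases e2 : h m = b
    · exact Or.inl ⟨hpb s hs (e2 ▸ hsm), Or.inr e2⟩
    by_cases e3 : h m = c
    · exact Or.inr ⟨hqc s hs (e3 ▸ hsm), Or.inl e3⟩
    by_cases e4 : h m = d
    · exact Or.inr ⟨hqd s hs (e4 ▸ hsm), Or.inr e4⟩
    exfalso
    rcases key b (h m) hab.symm hbc (Ne.symm e2) e1 e3 hb' hm with h1 | h1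
    · rcases key d (h m) had.symm hdc (Ne.symm e4) e1 e3 hd hm with h2 | h2
      · exact hexcl _ hd h2.1 hqd
      · exact hexcl _ hm h2.2 h1.2
    · exact hexcl _ hb' hpb h1.1
  · have hcase : ∀ d, Attaches G h T d → d = a ∨ d = b ∨ d = c := by
      intro d h1
      by_contra hc
      push Not at hc
      exact hd ⟨d, h1, hc.1, hc.2.1, hc.2.2⟩
    have hpa' := hadj _ _ ha hpa
    have hqc' := hadj _ _ hc hqc
    have honly : ∀ m, ∀ u ∈ T, G.Adj u (h m) →
        (h m = a ∧ u = p) ∨ (h m = c ∧ u = q) ∨ h m = b := by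
      intro m u hu hum
      rcases hcase _ ⟨⟨m, rfl⟩, u, hu, hum⟩ with e | e | e
      · exact Or.inl ⟨e, hpa u hu (e ▸ hum)⟩
      · exact Or.inr (Or.inr e)
      · exact Or.inr (Or.inl ⟨e, hqc u hu (e ▸ hum)⟩)
    obtain ⟨⟨i, rfl⟩, -⟩ := ha
    obtain ⟨k, k1, k2, rfl⟩ := hh.exists_rep_of_mem i hc.1
    obtain ⟨j, j1, j2, rfl⟩ := hh.exists_rep_of_mem i hb'.1
    obtain ⟨-, s, hs, hsj⟩ := hb'
    have nij : i ≠ j := fun e => hab (by rw [e])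
    have nik : i ≠ k := fun e => hac (by rw [e])
    have njk : j ≠ k := fun e => hbc (by rw [e])
    rcases lt_or_gt_of_ne njk with hl | hl
    · refine hb.exists_isWheelFn_of_three hG hfree hq hp (i := k) (k := i + N)
        (j := j + N) k2 (by omega) (by omega) hqc' (by rwa [hh.per]) hs (by rwa [hh.per]) ?_
      rw [hh.per, hh.per]
      intro m u hu hum
      rcases honly m u hu hum with h1 | h1 | h1
      · exact Or.inr (Or.inl h1)
      · exact Or.inl h1
      · exact Or.inr (Or.inr h1)
    · exact hb.exists_isWheelFn_of_three hG hfree hp hq (by omega) hl j2 hpa' hqc' hs hsj honly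

/-- A graph without triangles, induced `K₃,₃` and induced subdivisions of `K₄` that is not
series-parallel contains a wheel. -/
theorem exists_isWheelFn [Finite V] (hG : G.CliqueFree 3) (hfree : G.ISK4Free)
    (hK : ¬ (completeBipartiteGraph (Fin 3) (Fin 3)).IsIndContained G)
    (hsp : ¬ G.IsSeriesParallel) : ∃ N h x, IsWheelFn G N h x := by
  obtain ⟨N, h, T, hb⟩ := exists_isBridgedCycle hsp
  obtain ⟨N, h, T, hb⟩ := hb.exists_min
  exact hb.exists_isWheelFn hG hfree hK

end SimpleGraph

/-! ### Separated wheels give wheel decompositions -/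

namespace SimpleGraph

variable {V : Type*} {G : SimpleGraph V} {N : ℕ} {h : ℤ → V} {x : V}

theorem IsHoleFn.isHole (hh : IsHoleFn G N h) : IsHole G (Set.range h) := by
  have h4 := hh.four
  have hN : ((N - 1 : ℕ) : ℤ) = N - 1 := by omega
  obtain ⟨w, hw, hs, hl, he⟩ := exists_walk_of_fn (G := G) (n := N - 1) (p := fun i => h i)
    (fun i j h1 h2 => hh.inj _ _ (by omega) (by omega)) (fun i _ => hh.adj' (by push_cast; ring))
  have hadj : G.Adj (h (N - 1 : ℕ)) (h (0 : ℕ)) := by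
    have := hh.per 0
    rw [Nat.cast_zero, ← this]
    exact hh.adj' (by omega)
  have hmem : ∀ v, v ∈ (Walk.cons hadj w).support ↔ v ∈ Set.range h := by
    intro v
    rw [Walk.support_cons, List.mem_cons, hs]
    constructor
    · rintro (rfl | ⟨i, -, rfl⟩)
      · exact ⟨_, rfl⟩
      · exact ⟨_, rfl⟩
    · intro hv
      obtain ⟨i, h1, h2, rfl⟩ := hh.exists_rep_of_mem 0 hv
      exact Or.inr ⟨i.toNat, by omega, by simp [h1]⟩
  refine ⟨_, Walk.cons hadj w, (Walk.cons_isCycle_iff _ _).2 ⟨hw, ?_⟩, ?_, ?_, ?_⟩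
  · rw [he]
    rintro ⟨i, hi, e⟩
    rcases Sym2.eq_iff.1 e with ⟨e1, -⟩ | ⟨e1, e2⟩
    · have := hh.eq_of_window (by omega) (by omega) e1
      omega
    · have h1 := hh.eq_of_window (by push_cast; omega) (by push_cast; omega) e1
      have h2 := hh.eq_of_window (by omega) (by omega) e2
      omega
  · rw [Walk.length_cons, hl]; omega
  · rw [Walk.isChordless_iff_forall_mem_edges]
    have key : ∀ i j : ℤ, 0 ≤ i → i < j → j < N → G.Adj (h i) (h j) →
        s(h i, h j) ∈ (Walk.cons hadj w).edges := by
      intro i j h1 h2 h3 ha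
      rw [Walk.edges_cons, List.mem_cons, he]
      rcases hh.adj_window h2 (by omega) ha with rfl | rfl
      · refine Or.inr ⟨i.toNat, by omega, ?_⟩
        push_cast
        rw [Int.toNat_of_nonneg h1]
      · obtain rfl : i = 0 := by omega
        left
        rw [hN, Sym2.eq_swap]
        simp
    intro u v hu hv huv
    obtain ⟨i, i1, i2, rfl⟩ := hh.exists_rep_of_mem 0 ((hmem u).1 hu)
    obtain ⟨j, j1, j2, rfl⟩ := hh.exists_rep_of_mem 0 ((hmem v).1 hv)
    rcases lt_trichotomy i j with hl | rfl | hl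
    · exact key i j i1 hl (by omega) huv
    · exact absurd rfl huv.ne
    · rw [Sym2.eq_swap]
      exact key j i j1 hl (by omega) huv.symm
  · ext v; exact hmem v

theorem IsWheelFn.isWheel (hw : IsWheelFn G N h x) : IsWheel G (Set.range h) x := by
  refine ⟨hw.hole.isHole, fun ⟨i, hi⟩ => hw.notMem i hi, ?_⟩
  obtain ⟨a, b, c, hab, hac, hbc, ⟨ha, hxa⟩, ⟨hb, hxb⟩, ⟨hc, hxc⟩⟩ := hw.three
  have hsub : ({a, b, c} : Set V) ⊆ G.neighborSet x ∩ Set.range h := by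
    rintro v (rfl | rfl | rfl)
    · exact ⟨hxa, ha⟩
    · exact ⟨hxb, hb⟩
    · exact ⟨hxc, hc⟩
  refine le_trans (le_of_eq ?_) (Set.encard_le_encard hsub)
  rw [Set.encard_insert_of_notMem (by simp [hab, hac]), Set.encard_pair hbc]
  norm_num

theorem Separates.isCutset {C A B : Set V} (hs : Separates G C A B) : IsCutset G C := by
  obtain ⟨⟨a, ha, haC⟩, ⟨b, hb, hbC⟩, hsep⟩ := hs
  intro hconn
  obtain ⟨w⟩ := hconn ⟨a, haC⟩ ⟨b, hbC⟩
  obtain ⟨v, hvC, hv⟩ := hsep a ha b hb (w.map (Embedding.induce Cᶜ).toHom)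
  have hmap := Walk.support_map (Embedding.induce Cᶜ).toHom w
  obtain ⟨u, -, rfl⟩ := List.mem_map.1 ((congrArg (v ∈ ·) hmap).mp hv)
  exact u.2 hvC

theorem Walk.end_mem_of_closed {R C : Set V} (hR : ∀ y ∈ R, ∀ z, G.Adj y z → z ∉ C → z ∈ R)
    {u v : V} (w : G.Walk u v) (hu : u ∈ R) (hw : ∀ y ∈ w.support, y ∉ C) : v ∈ R := by
  induction w with
  | nil => exact hu
  | cons hadj w ih =>
    rw [Walk.support_cons] at hw
    exact ih (hR _ hu _ hadj (hw _ (List.mem_cons_of_mem _ w.start_mem_support)))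
      (fun y hy => hw y (List.mem_cons_of_mem _ hy))

/-- Outside the cutset, the interior of the sector can be left only through vertices off the rim and
off the closed neighbourhood of x. A connected set of such vertices touching this interior sees the
rim in this one sector only, so no walk reaches the rest of the rim. -/
theorem IsSeparatedWheel.separates (hG : G.CliqueFree 3) (hw : IsWheelFn G N h x)
    (hs : IsSeparatedWheel G N h x) {i j : ℤ} (hij : i < j) (hj : j < i + N)
    (hxi : G.Adj x (h i)) (hxj : G.Adj x (h j)) (hno : ∀ k, i < k → k < j → ¬ G.Adj x (h k)) :
    Separates G ((insert x (G.neighborSet x) \ Set.range h) ∪ {h i, h j}) (arc h i j)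
      (Set.range h \ arc h i j) := by
  have hh := hw.hole
  have hC : ∀ k, h k ≠ h i → h k ≠ h j →
      h k ∉ (insert x (G.neighborSet x) \ Set.range h) ∪ {h i, h j} := by
    rintro k h1 h2 (h3 | h3 | h3)
    · exact h3.2 ⟨k, rfl⟩
    · exact h1 h3
    · exact h2 h3
  refine ⟨⟨h (i + 1), ?_⟩, ?_, ?_⟩
  · have : i + 1 < j := by
      by_contra hc
      obtain rfl : j = i + 1 := by omega
      exact hG.no_triangle hxi (hh.adj i) hxj
    exact ⟨mem_arc (by omega) (by omega), hC _ (hh.inj i _ (by omega) (by omega)).symm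
      (hh.inj _ _ this (by omega))⟩
  · obtain ⟨c, hc, hxc, hci, hcj⟩ : ∃ c ∈ Set.range h, G.Adj x c ∧ c ≠ h i ∧ c ≠ h j := by
      obtain ⟨a, b, c, hab, hac, hbc, ⟨ha, hxa⟩, ⟨hb, hxb⟩, ⟨hc, hxc⟩⟩ := hw.three
      by_contra hcon
      push Not at hcon
      have h1 := hcon a ha hxa
      have h2 := hcon b hb hxb
      have h3 := hcon c hc hxc
      grind
    obtain ⟨k, rfl⟩ := hc
    refine ⟨h k, ⟨⟨k, rfl⟩, ?_⟩, hC k hci hcj⟩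
    rintro ⟨m, m1, m2, e⟩
    rw [← e] at hxc hci hcj
    have : m ≠ i := fun e => hci (by rw [e])
    have : m ≠ j := fun e => hcj (by rw [e])
    exact hno m (by omega) (by omega) hxc
  · intro u hu v hv w
    by_contra hcon
    push Not at hcon
    replace hcon : ∀ y ∈ w.support,
        y ∉ (insert x (G.neighborSet x) \ Set.range h) ∪ {h i, h j} := fun y hy hyC => hcon y hyC hy
    set Q : Set V := {y | ∃ k, i < k ∧ k < j ∧ h k = y} with hQ
    -- R consists of the sector interior and all connected sets of allowed vertices that touch it.
    -- It is closed under adjacency outside the cutset and meets the rim only in Q.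
    set R : Set V := {y | y ∈ Q ∨ ∃ D, ConnOn G D ∧ y ∈ D ∧
      (∀ d ∈ D, d ∉ Set.range h ∧ d ≠ x ∧ ¬ G.Adj x d) ∧ ∃ d ∈ D, ∃ z ∈ Q, G.Adj d z} with hR
    have hQarc : ∀ y ∈ arc h i j,
        y ∉ (insert x (G.neighborSet x) \ Set.range h) ∪ {h i, h j} → y ∈ Q := by
      rintro _ ⟨k, k1, k2, rfl⟩ hk
      have : k ≠ i := by rintro rfl; exact hk (Or.inr (Or.inl rfl))
      have : k ≠ j := by rintro rfl; exact hk (Or.inr (Or.inr rfl))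
      exact ⟨k, by omega, by omega, rfl⟩
    have hQR : ∀ y ∈ R, y ∈ Set.range h → y ∈ Q := by
      rintro y (hy | ⟨D, -, hyD, hD, -⟩) hyr
      · exact hy
      · exact absurd hyr (hD y hyD).1
    have hclosed : ∀ y ∈ R, ∀ z, G.Adj y z →
        z ∉ (insert x (G.neighborSet x) \ Set.range h) ∪ {h i, h j} → z ∈ R := by
      intro y hy z hyz hz
      by_cases hzr : z ∈ Set.range h
      · refine Or.inl (hQarc z ?_ hz)
        rcases hy with ⟨k, k1, k2, rfl⟩ | ⟨D, hD, hyD, hoff, d, hd, _, ⟨k, k1, k2, rfl⟩, hdk⟩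
        · rcases hh.eq_of_adj hzr hyz with rfl | rfl
          · exact mem_arc (by omega) (by omega)
          · exact mem_arc (by omega) (by omega)
        · have hsec := hs D hD hoff (h k) ⟨k, rfl⟩ z hzr ⟨d, hd, hdk⟩ ⟨y, hyD, hyz⟩
          obtain ⟨m, m1, m2, rfl⟩ := hh.exists_rep_of_mem k hzr
          rcases m1.eq_or_lt with rfl | m1
          · exact mem_arc k1.le k2.le
          rcases (hh.sameSector_iff m1 m2).1 hsec with h1 | h1
          · refine mem_arc (by omega) ?_
            by_contra hc
            exact h1 j k2 (by omega) hxj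
          · rw [← hh.sub_per m]
            refine mem_arc ?_ (by omega)
            by_contra hc
            exact h1 (i + N) (by omega) (by omega) (by rwa [hh.per])
      · have hzoff : z ∉ Set.range h ∧ z ≠ x ∧ ¬ G.Adj x z :=
          ⟨hzr, fun e => hz (Or.inl ⟨Or.inl e, hzr⟩), fun e => hz (Or.inl ⟨Or.inr e, hzr⟩)⟩
        right
        rcases hy with hy | ⟨D, hD, hyD, hoff, hatt⟩
        · exact ⟨{z}, ConnOn.singleton z, rfl, by rintro _ rfl; exact hzoff, z, rfl, y, hy, hyz.symm⟩
        · obtain ⟨d, hd, hdz⟩ := hatt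
          refine ⟨D ∪ {z}, hD.union (ConnOn.singleton z) hyD rfl (Or.inr hyz), Or.inr rfl, ?_, d,
            Or.inl hd, hdz⟩
          rintro e (he | rfl)
          · exact hoff e he
          · exact hzoff
    have huR : u ∈ R := Or.inl (hQarc u hu (hcon u w.start_mem_support))
    have hvR := hQR v (w.end_mem_of_closed hclosed huR hcon) hv.1
    obtain ⟨k, k1, k2, rfl⟩ := hvR
    exact hv.2 (mem_arc k1.le k2.le)

/-- A path of length at least one along a hole runs in one direction. -/
theorem IsHoleFn.exists_arc_of_isPath (hh : IsHoleFn G N h) {a b : V} {p : G.Walk a b}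
    (hp : p.IsPath) (hab : a ≠ b) (hH : ∀ v ∈ p.support, v ∈ Set.range h) :
    ∃ i j : ℤ, i < j ∧ j < i + N ∧ {v | v ∈ p.support} = arc h i j ∧
      ((h i = a ∧ h j = b) ∨ (h i = b ∧ h j = a)) := by
  obtain ⟨i, hi⟩ := hH a p.start_mem_support
  have hlen : 1 ≤ p.length := by
    by_contra hc
    exact hab (Walk.eq_of_length_eq_zero (p := p) (by omega))
  have hinj : ∀ m n, m < n → n ≤ p.length → p.getVert m ≠ p.getVert n := by
    intro m n h1 h2 e
    have := hp.getVert_injOn (x₁ := m) (x₂ := n) (by simp; omega) (by simpa using h2) e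
    omega
  have hnext : ∀ k n, n < p.length → p.getVert n = h k →
      p.getVert (n + 1) = h (k + 1) ∨ p.getVert (n + 1) = h (k - 1) := by
    intro k n hn hk
    refine hh.eq_of_adj (hH _ (p.getVert_mem_support _)) ?_
    rw [← hk]
    exact p.adj_getVert_succ hn
  -- The first step fixes the direction. A vertex of the hole has just two neighbours on it, and a
  -- path cannot turn back, so every later step has the same sign.
  obtain ⟨ε, hε, h1⟩ : ∃ ε : ℤ, (ε = 1 ∨ ε = -1) ∧ p.getVert 1 = h (i + ε) := by
    rcases hnext i 0 hlen (by rw [Walk.getVert_zero, hi]) with h1 | h1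
    · exact ⟨1, Or.inl rfl, h1⟩
    · exact ⟨-1, Or.inr rfl, h1⟩
  have hall : ∀ n, n + 1 ≤ p.length → p.getVert n = h (i + ε * n) ∧
      p.getVert (n + 1) = h (i + ε * (n + 1)) := by
    intro n
    induction n with
    | zero => intro _; exact ⟨by simp [hi], by simpa using h1⟩
    | succ n ih =>
      intro hn
      obtain ⟨h2, h3⟩ := ih (by omega)
      refine ⟨by rw [h3]; push_cast; rfl, ?_⟩
      have hne : p.getVert (n + 1 + 1) ≠ h (i + ε * n) := by
        rw [← h2]
        exact (hinj _ _ (by omega) (by omega)).symm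
      push_cast
      rcases hε with rfl | rfl
      · rcases hnext _ _ (by omega) h3 with h4 | h4
        · rw [h4]; congr 1; ring
        · refine absurd ?_ hne
          rw [h4]; congr 1; ring
      · rcases hnext _ _ (by omega) h3 with h4 | h4
        · refine absurd ?_ hne
          rw [h4]; congr 1; ring
        · rw [h4]; congr 1; ring
  have hget : ∀ n ≤ p.length, p.getVert n = h (i + ε * n) := by
    intro n hn
    rcases hn.eq_or_lt with rfl | hn
    · have := (hall (p.length - 1) (by omega)).2
      rw [Nat.sub_add_cancel hlen] at this
      rw [this]
      congr 3
      omega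
    · exact (hall n hn).1
  -- After N steps in one direction the path would be back at its start.
  have hlt : p.length < N := by
    by_contra hc
    refine hinj 0 N (by have := hh.four; omega) (by omega) ?_
    rw [hget N (by omega), Walk.getVert_zero, ← hi]
    rcases hε with rfl | rfl
    · rw [one_mul, hh.per]
    · rw [neg_one_mul, ← sub_eq_add_neg, hh.sub_per]
  have hb := hget p.length le_rfl
  rw [Walk.getVert_length] at hb
  have hsupp : ∀ v, v ∈ p.support ↔ ∃ n ≤ p.length, h (i + ε * n) = v := by
    intro v
    rw [Walk.mem_support_iff_exists_getVert]
    constructor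
    · rintro ⟨n, rfl, hn⟩
      exact ⟨n, hn, (hget n hn).symm⟩
    · rintro ⟨n, hn, rfl⟩
      exact ⟨n, hget n hn, hn⟩
  rcases hε with rfl | rfl
  · refine ⟨i, i + p.length, by omega, by omega, ?_, Or.inl ⟨hi, (hb.trans (by rw [one_mul])).symm⟩⟩
    ext v
    rw [Set.mem_ofPred_eq, hsupp]
    constructor
    · rintro ⟨n, hn, rfl⟩
      exact mem_arc (by omega) (by omega)
    · rintro ⟨k, k1, k2, rfl⟩
      exact ⟨(k - i).toNat, by omega, by congr 1; omega⟩
  · refine ⟨i - p.length, i, by omega, by omega, ?_, Or.inr ⟨(hb.trans (by congr 1; ring)).symm, hi⟩⟩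
    ext v
    rw [Set.mem_ofPred_eq, hsupp]
    constructor
    · rintro ⟨n, hn, rfl⟩
      exact mem_arc (by omega) (by omega)
    · rintro ⟨k, k1, k2, rfl⟩
      exact ⟨(i - k).toNat, by omega, by congr 1; omega⟩

theorem IsSeparatedWheel.hasWheelDecomposition (hG : G.CliqueFree 3) (hw : IsWheelFn G N h x)
    (hs : IsSeparatedWheel G N h x) : G.HasWheelDecomposition := by
  refine ⟨Set.range h, x, hw.isWheel, ?_⟩
  rintro a b p ⟨hp, hab, hH, hxa, hxb, hno⟩
  obtain ⟨i, j, hij, hj, hsupp, hends⟩ := hw.hole.exists_arc_of_isPath hp hab hH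
  have key : Separates G ((insert x (G.neighborSet x) \ Set.range h) ∪ {h i, h j}) (arc h i j)
      (Set.range h \ arc h i j) := by
    refine hs.separates hG hw hij hj ?_ ?_ ?_
    · rcases hends with ⟨e, -⟩ | ⟨e, -⟩ <;> rwa [e]
    · rcases hends with ⟨-, e⟩ | ⟨-, e⟩ <;> rwa [e]
    · intro k k1 k2
      have h1 : h k ≠ h i := (hw.hole.inj i k k1 (by omega)).symm
      have h2 : h k ≠ h j := hw.hole.inj k j k2 (by omega)
      have h3 : h k ∈ {v | v ∈ p.support} := hsupp ▸ mem_arc k1.le k2.le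
      rcases hends with ⟨e, e'⟩ | ⟨e, e'⟩
      · exact hno _ h3 (e ▸ h1) (e' ▸ h2)
      · exact hno _ h3 (e' ▸ h2) (e ▸ h1)
  have hpair : ({h i, h j} : Set V) = {a, b} := by
    rcases hends with ⟨e, e'⟩ | ⟨e, e'⟩
    · rw [e, e']
    · rw [e, e', Set.pair_comm]
  rw [hpair, ← hsupp] at key
  exact ⟨key.isCutset, key⟩

end SimpleGraph

theorem mainTheorem4 {V : Type*} [Finite V] (G : SimpleGraph V)
    (hTriangle : G.CliqueFree 3) (hISK4 : G.ISK4Free)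
    (hK33 : ¬ (completeBipartiteGraph (Fin 3) (Fin 3)).IsIndContained G) :
    G.IsSeriesParallel ∨ G.HasWheelDecomposition := by
  by_cases hsp : G.IsSeriesParallel
  · exact Or.inl hsp
  obtain ⟨N, h, x, hw, hs⟩ := SimpleGraph.exists_separatedWheel hTriangle hISK4
    (SimpleGraph.exists_isWheelFn hTriangle hISK4 hK33 hsp)
  exact Or.inr (hs.hasWheelDecomposition hTriangle hw)
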